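/- Let $\gamma\in(0,1]$, let $\theta_0\in H^{2-\gamma}(\mathbb R^2)$ be real-valued, let $0<T<\infty$, and let $\theta$ be a real-valued solution in the class $$\theta\in C([0,T];H^{2-\gamma}(\mathbb R^2))\cap L^2(0,T;H^{2-\gamma/2}(\mathbb R^2))$$ of the dissipative quasi-geostrophic equation $$\partial_t\theta+u\cdot\nabla\theta+(-\Delta)^{\gamma/2}\theta=0\ \text{ on }(0,T)\times\mathbb R^2,\qquad \theta(0,\cdot)=\theta_0,\qquad u=\big(-\partial_{x_2}(-\Delta)^{-1/2}\theta,\ \partial_{x_1}(-\Delta)^{-1/2}\theta\big),$$ meaning that for every real Schwartz function $\varphi$ on $\mathbb R^2$ and every $t\in[0,T]$ $$\int\theta(t)\varphi\,dx=\int\theta_0\varphi\,dx+\int_0^t\Big(\int\theta\,u\cdot\nabla\varphi\,dx-\int\theta\,(-\Delta)^{\gamma/2}\varphi\,dx\Big)ds .$$ (By a theorem of Miura, for every $\theta_0\in H^{2-\gamma}$ such a solution exists for some $T>0$ and is unique.) Write $\|f\|_{\dot H^s}=\|(-\Delta)^{s/2}f\|_{L^2}$. Then 1. for every $\beta\ge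 0$, $\ \sup_{0<t<T}t^{\beta/\gamma}\|\theta(t,\cdot)\|_{\dot H^{2-\gamma+\beta}}<\infty$; 2. for every $\beta>0$, $\ \lim_{t\to0^+}t^{\beta/\gamma}\|\theta(t,\cdot)\|_{\dot H^{2-\gamma+\beta}}=0$; 3. $\theta$ is $C^\infty$ in $(0,T)\times\mathbb R^2$: there is a function $\Theta\in C^\infty((0,T)\times\mathbb R^2)$ with $\Theta(t,\cdot)=\theta(t,\cdot)$ almost everywhere for every $t\in(0,T)$. -/

import Mathlib

open MeasureTheory Set Filter Topology FourierTransform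
open scoped ENNReal SchwartzMap ContDiff

noncomputable section

namespace QG

/-- The Euclidean plane `ℝ²`. -/
abbrev Plane : Type := EuclideanSpace ℝ (Fin 2)

/-- Real-valued square integrable functions on `ℝ²`. -/
abbrev L2 : Type := Lp ℝ 2 (volume : Measure Plane)

/-- Complex-valued square integrable functions on `ℝ²`. -/
abbrev L2C : Type := Lp ℂ 2 (volume : Measure Plane)

/-- A real-valued `L²` function viewed as a complex-valued one. -/
def toComplex (f : L2) : L2C := Complex.ofRealCLM.compLp f

/-- The Fourier transform of a real-valued `L²` function, with the convention
`f̂(ξ) = ∫ f(x) exp(-2πi x·ξ) dx`. -/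
def fourierL2 (f : L2) : L2C := 𝓕 (toComplex f)

open Classical in
/-- The Fourier multiplier `f ↦ 𝓕⁻¹ (m f̂)` on its natural domain `{f ∈ L² : m f̂ ∈ L²}`
(and `0` off that domain). The symbols used below satisfy `m(-ξ) = conj (m ξ)`, so that
`𝓕⁻¹ (m f̂)` is real-valued and taking the real part only changes the type. -/
def fourierMultiplier (m : Plane → ℂ) (f : L2) : L2 :=
  if h : MemLp (fun ξ => m ξ * fourierL2 f ξ) 2 volume then
    Complex.reCLM.compLp (𝓕⁻ (h.toLp _ : L2C) : L2C)
  else 0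

/-- The Riesz transform `∂_{x_j} (-Δ)^{-1/2}`, with symbol `i ξ_j / |ξ|`. -/
def riesz (j : Fin 2) (f : L2) : L2 :=
  fourierMultiplier (fun ξ => Complex.I * ((ξ j / ‖ξ‖ : ℝ) : ℂ)) f

/-- `(-Δ)^{s/2}`, with symbol `(2π|ξ|)^s`. -/
def fracLaplacian (s : ℝ) (f : L2) : L2 :=
  fourierMultiplier (fun ξ => (((2 * Real.pi * ‖ξ‖) ^ s : ℝ) : ℂ)) f

/-- The velocity `u = (-R₂ θ, R₁ θ)` generated by `θ`. -/
def velocity (f : L2) (x : Plane) : Plane := !₂[-(riesz 1 f x), riesz 0 f x]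

/-- The homogeneous Sobolev norm `‖f‖_{Ḣ^s} = ‖ |2πξ|^s f̂ ‖_{L²} = ‖(-Δ)^{s/2} f‖_{L²}`,
equal to `∞` if `f ∉ Ḣ^s`. -/
def homSobolevNorm (s : ℝ) (f : L2) : ℝ≥0∞ :=
  eLpNorm (fun ξ => (((2 * Real.pi * ‖ξ‖) ^ s : ℝ) : ℂ) * fourierL2 f ξ) 2 volume

/-- The inhomogeneous Sobolev norm `‖f‖_{H^s} = ‖f‖_{Ḣ^s} + ‖f‖_{L²}` (for `s ≥ 0`),
equal to `∞` if `f ∉ H^s`. -/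
def sobolevNorm (s : ℝ) (f : L2) : ℝ≥0∞ :=
  homSobolevNorm s f + eLpNorm f 2 volume

/-- `θ ∈ C([0,T]; H^s)`. -/
def ContinuousInSobolev (s T : ℝ) (θ : ℝ → L2) : Prop :=
  (∀ t ∈ Icc 0 T, sobolevNorm s (θ t) < ⊤) ∧
    ∀ t ∈ Icc 0 T, Tendsto (fun r => sobolevNorm s (θ r - θ t)) (𝓝[Icc 0 T] t) (𝓝 0)

/-- `θ` is a weak solution on `[0,T]` of
`∂_t θ + u · ∇θ + (-Δ)^{γ/2} θ = 0`, `u = (-R₂ θ, R₁ θ)`, `θ(0) = θ₀`.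
Since `div u = 0`, the transport term is `div (u θ)`, and it is tested as such. -/
def IsWeakSolution (γ : ℝ) (θ₀ : L2) (T : ℝ) (θ : ℝ → L2) : Prop :=
  θ 0 = θ₀ ∧
    ∀ φ : 𝓢(Plane, ℝ), ∀ t ∈ Icc 0 T,
      (∫ x, θ t x * φ x) =
        (∫ x, θ₀ x * φ x) +
          ∫ s in (0 : ℝ)..t,
            ((∫ x, θ s x * fderiv ℝ φ x (velocity (θ s) x)) -
              (∫ x, θ s x * fracLaplacian γ (φ.toLp 2) x))

/-- A solution on `[0,T]` with data `θ₀` in the class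
`C([0,T]; H^{2-γ}) ∩ L²(0,T; H^{2-γ/2})`. -/
structure IsSolution (γ : ℝ) (θ₀ : L2) (T : ℝ) (θ : ℝ → L2) : Prop where
  continuous : ContinuousInSobolev (2 - γ) T θ
  square_integrable : (∫⁻ t in Ioo 0 T, sobolevNorm (2 - γ / 2) (θ t) ^ 2) < ⊤
  weak : IsWeakSolution γ θ₀ T θ

end QG

end

noncomputable section

namespace QG

open scoped ComplexConjugate LineDeriv

/-! ### The `L²` Fourier transform -/

/-! Everything happens on the Fourier side. With f the transform of θ(t), the weak formulation
becomes ∂ₜf = 2π `nonlin f f` − (2π|ξ|)^γ f, an identity in L² after division by (1+|ξ|)³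
(`fourier_integral_equation`). The kernel of `nonlin` is a cross product of ξ and η divided by |η|.
Because u is divergence free, it is bounded by |ξ| and also by |ξ−η|.

The engine is an energy estimate with weight W = min(|ξ|, N)^{2s}, s ≥ 1. Hermitian symmetry of f
and the substitution ξ ↦ η−ξ replace W(ξ) in the trilinear term by half of W(ξ) − W(ξ−η)
(`enorm_two_mul_integral_nonlin_le`). The resulting symbol is at most a constant, independent of N,
times the smallest of |ξ|, |η|, |ξ−η| times the s-th powers of the other two truncated frequencies.
A scale-invariant Cauchy–Schwarz argument (`tri_le_critical`) then bounds the trilinear term by the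
critical norm ‖|ξ|^{2−γ} f‖ times the dissipation. Scale invariance leaves no small factor to spare.
Smallness comes instead from continuity of θ in H^{2−γ} on the compact interval [0,T], which makes
the frequencies |ξ| ≥ R uniformly small in the critical norm (`exists_highWeight_le`). The
frequencies below R cost only a multiple of the energy (`lintegral_commSymbol_le`). Part of the
dissipation therefore survives, and N → ∞ gives `energy_inequality`.

With time weights t^{k+1} this inequality is iterated: control of τ^k times an energy in L¹(0,T)
yields pointwise control with t^{k+1}, and integrated control with γ/2 more derivatives. The
induction starts from θ ∈ L²(0,T; H^{2−γ/2}). The pointwise bound at time t is an integral over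
(0,t), so it tends to 0 with t. Fractional orders follow from the elementary inequality y^λ ≤ δ^λ +
δ^{λ−n} yⁿ at y = t|ξ|^γ (`rpow_mul_energy_le`).

For smoothness, all V_n = (1+|ξ|)ⁿ f are now in L² at positive times. They satisfy V_n' = `rhs` of
V_{n+3}, where `rhs` is quadratic and continuous, so each V_n is smooth in time
(`contDiffOn_weighted`). The plane wave divided by a high power of 1+|ξ| is an L²-valued C^k
function of x (`contDiff_weightedWave`). The solution is the pairing of the two, hence jointly C^k
for every k. -/

/-- The bilinear pairing `(a, b) ↦ ∫ a b` on `L²`. -/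
def pairing : L2C →L[ℂ] L2C →L[ℂ] ℂ :=
  (ContinuousLinearMap.mul ℂ ℂ).lpPairing volume 2 2

lemma pairing_apply (a b : L2C) : pairing a b = ∫ x, a x * b x := by
  simp [pairing, ContinuousLinearMap.lpPairing_eq_integral]

lemma integral_mul_fourier (a : L2C) (Ψ : 𝓢(Plane, ℂ)) :
    ∫ x, a x * (𝓕 Ψ) x = ∫ ξ, (𝓕 a : L2C) ξ * Ψ ξ := by
  have h := congrArg (fun T => T Ψ) (Lp.fourier_toTemperedDistribution_eq a)
  simp only [TemperedDistribution.fourier_apply, Lp.toTemperedDistribution_apply,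
    smul_eq_mul] at h
  simpa only [mul_comm] using h

lemma integral_mul_fourierInv (a : L2C) (Ψ : 𝓢(Plane, ℂ)) :
    ∫ x, a x * (𝓕⁻ Ψ) x = ∫ ξ, (𝓕⁻ a : L2C) ξ * Ψ ξ := by
  have h := congrArg (fun T => T Ψ) (Lp.fourierInv_toTemperedDistribution_eq a)
  simp only [TemperedDistribution.fourierInv_apply, Lp.toTemperedDistribution_apply,
    smul_eq_mul] at h
  simpa only [mul_comm] using h

lemma ae_eq_of_integral_mul_schwartz {f g : Plane → ℂ} (hf : LocallyIntegrable f volume)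
    (hg : LocallyIntegrable g volume)
    (h : ∀ Ψ : 𝓢(Plane, ℂ), HasCompactSupport Ψ → ∫ x, f x * Ψ x = ∫ x, g x * Ψ x) :
    f =ᵐ[volume] g := by
  refine ae_eq_of_integral_contDiff_smul_eq hf hg fun φ hφ hc => ?_
  have h1 : HasCompactSupport (Complex.ofRealCLM ∘ φ) := hc.comp_left rfl
  have h2 : ContDiff ℝ ∞ (Complex.ofRealCLM ∘ φ) := by fun_prop
  have h3 := h (h1.toSchwartzMap h2) (by exact h1)
  simpa [mul_comm] using h3

lemma Lp_locallyIntegrable (a : L2C) : LocallyIntegrable a volume :=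
  (Lp.memLp a).locallyIntegrable (by norm_num)

/-- Complex conjugation intertwines with reflection under the Fourier transform. -/
lemma fourier_star (a : L2C) :
    (𝓕 (star a) : L2C) =ᵐ[volume] fun ξ => conj ((𝓕 a : L2C) (-ξ)) := by
  have hm : MemLp (fun ξ => conj ((𝓕 a : L2C) (-ξ))) 2 volume := by
    have h1 : MemLp (fun ξ => (𝓕 a : L2C) (-ξ)) 2 volume :=
      (Lp.memLp (𝓕 a : L2C)).comp_measurePreserving (Measure.measurePreserving_neg volume)
    exact h1.star
  refine ae_eq_of_integral_mul_schwartz (Lp_locallyIntegrable _)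
    (hm.locallyIntegrable (by norm_num)) fun Ψ _ => ?_
  rw [← integral_mul_fourier]
  let Ψ' : 𝓢(Plane, ℂ) := SchwartzMap.compCLMOfContinuousLinearEquiv ℝ
    (ContinuousLinearEquiv.neg ℝ) (Ψ.postcompCLM (Complex.conjCLE : ℂ →L[ℝ] ℂ))
  have hΨ' : ∀ x, Ψ' x = conj (Ψ (-x)) := fun x => by simp [Ψ']
  have key : ∀ x, (𝓕 Ψ') x = conj ((𝓕 Ψ) x) := by
    intro x
    rw [SchwartzMap.fourier_coe, SchwartzMap.fourier_coe, Real.fourier_eq', Real.fourier_eq',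
      ← integral_conj, ← integral_neg_eq_self]
    congr 1 with v
    simp only [hΨ', neg_neg, smul_eq_mul, map_mul, ← Complex.exp_conj]
    congr 2
    simp only [Complex.conj_ofReal, Complex.conj_I, inner_neg_left]
    push_cast
    ring
  have h1 := integral_mul_fourier a Ψ'
  calc ∫ x, (star a : L2C) x * (𝓕 Ψ) x = ∫ x, conj (a x * (𝓕 Ψ') x) := by
        apply integral_congr_ae
        filter_upwards [Lp.coeFn_star a] with x hx
        rw [hx, key]; simp
    _ = conj (∫ ξ, (𝓕 a : L2C) ξ * Ψ' ξ) := by rw [integral_conj, h1]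
    _ = ∫ ξ, conj ((𝓕 a : L2C) (-ξ)) * Ψ ξ := by
        rw [← integral_conj, ← integral_neg_eq_self]
        congr 1 with v
        simp [hΨ']

lemma coeFn_toComplex (f : L2) : toComplex f =ᵐ[volume] fun x => (f x : ℂ) :=
  Complex.ofRealCLM.coeFn_compLp f

lemma star_toComplex (f : L2) : star (toComplex f) = toComplex f := by
  apply Lp.ext
  filter_upwards [Lp.coeFn_star (toComplex f), coeFn_toComplex f] with x h1 h2
  rw [h1, Pi.star_apply, h2]; simp

/-- The Fourier transform of a real function is Hermitian. -/
lemma fourierL2_neg (f : L2) :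
    ∀ᵐ ξ : Plane, fourierL2 f (-ξ) = conj (fourierL2 f ξ) := by
  have h := fourier_star (toComplex f)
  rw [star_toComplex] at h
  filter_upwards [h] with ξ hξ
  change (𝓕 (toComplex f) : L2C) (-ξ) = conj ((𝓕 (toComplex f) : L2C) ξ)
  rw [hξ]; simp

/-- The inverse transform a of a Hermitian g agrees with its conjugate, since both have transform g.
Hence the real part taken in `fourierMultiplier` discards nothing. -/
lemma toComplex_re_fourierInv (g : L2C) (hg : ∀ᵐ ξ : Plane, g (-ξ) = conj (g ξ)) :
    toComplex (Complex.reCLM.compLp (𝓕⁻ g : L2C)) = 𝓕⁻ g := by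
  set a : L2C := 𝓕⁻ g with ha
  have h1 : (𝓕 a : L2C) = g := FourierTransform.fourier_fourierInv_eq g
  have h2 : star a = a := by
    have h3 : (𝓕 (star a) : L2C) = 𝓕 a := by
      apply Lp.ext
      filter_upwards [fourier_star a, hg] with ξ h4 h5
      rw [h4, h1, h5]; simp
    have := congrArg (fun b : L2C => (𝓕⁻ b : L2C)) h3
    simpa using this
  apply Lp.ext
  filter_upwards [coeFn_toComplex (Complex.reCLM.compLp a), Complex.reCLM.coeFn_compLp a,
    Lp.coeFn_star a] with x h3 h4 h5
  rw [h3, h4]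
  rw [h2, Pi.star_apply] at h5
  exact Complex.conj_eq_iff_re.1 h5.symm

lemma ae_neg_of_ae {P : Plane → Prop} (h : ∀ᵐ ξ : Plane, P ξ) : ∀ᵐ ξ : Plane, P (-ξ) :=
  (Measure.measurePreserving_neg (volume : Measure Plane)).quasiMeasurePreserving.ae h

lemma fourierL2_fourierMultiplier {m : Plane → ℂ} (hm : ∀ ξ, m (-ξ) = conj (m ξ)) (f : L2)
    (h : MemLp (fun ξ => m ξ * fourierL2 f ξ) 2 volume) :
    fourierL2 (fourierMultiplier m f) =ᵐ[volume] fun ξ => m ξ * fourierL2 f ξ := by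
  have h1 : ∀ᵐ ξ : Plane, (h.toLp _ : L2C) (-ξ) = conj ((h.toLp _ : L2C) ξ) := by
    filter_upwards [h.coeFn_toLp, ae_neg_of_ae h.coeFn_toLp, fourierL2_neg f] with ξ h2 h3 h4
    rw [h2, h3, hm, h4]; simp
  rw [fourierL2, fourierMultiplier, dif_pos h, toComplex_re_fourierInv _ h1,
    FourierTransform.fourier_fourierInv_eq]
  exact h.coeFn_toLp

/-- On `L¹ ∩ L²`, the inverse Fourier transform is given by the integral. -/
lemma coeFn_fourierInv_of_integrable (v : L2C) (hv : Integrable v volume) :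
    (𝓕⁻ v : L2C) =ᵐ[volume] 𝓕⁻ (v : Plane → ℂ) := by
  have hcont : Continuous (𝓕⁻ (v : Plane → ℂ)) := by
    rw [Real.fourierInv_eq_fourier_comp_neg]
    exact VectorFourier.fourierIntegral_continuous Real.continuous_fourierChar
      (by exact continuous_inner) hv.comp_neg
  refine ae_eq_of_integral_mul_schwartz (Lp_locallyIntegrable _) hcont.locallyIntegrable
    fun Ψ _ => ?_
  rw [← integral_mul_fourierInv, SchwartzMap.fourierInv_coe]
  have h := VectorFourier.integral_fourierIntegral_smul_eq_flip (e := Real.fourierChar)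
    (μ := (volume : Measure Plane)) (ν := (volume : Measure Plane)) (L := -innerₗ Plane)
    (f := v) (g := Ψ) Real.continuous_fourierChar (by
      change Continuous fun p : Plane × Plane => -(inner ℝ p.1 p.2)
      fun_prop) hv Ψ.integrable
  have e1 : VectorFourier.fourierIntegral Real.fourierChar volume (-innerₗ Plane)
      (v : Plane → ℂ) = 𝓕⁻ (v : Plane → ℂ) := rfl
  have e2 : VectorFourier.fourierIntegral Real.fourierChar volume (-innerₗ Plane).flip
      (Ψ : Plane → ℂ) = 𝓕⁻ (Ψ : Plane → ℂ) := by
    ext x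
    simp [VectorFourier.fourierIntegral, Real.fourierInv_eq, real_inner_comm]
  rw [e1, e2] at h
  simpa using h.symm

/-- Both sides are continuous in v, and for Schwartz v the identity is the duality of the Fourier
transform. The pairing has no conjugate, which is why one factor carries the inverse transform. -/
lemma integral_mul_eq_integral_fourier_mul_fourierInv (a v : L2C) :
    ∫ x, a x * v x = ∫ ξ, (𝓕 a : L2C) ξ * (𝓕⁻ v : L2C) ξ := by
  rw [← pairing_apply, ← pairing_apply]
  refine DenseRange.induction_on (p := fun v : L2C => pairing a v = pairing (𝓕 a) (𝓕⁻ v))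
    (SchwartzMap.denseRange_toLpCLM (E := Plane) (F := ℂ) (p := 2) (μ := volume)
      ENNReal.ofNat_ne_top) v ?_ ?_
  · exact isClosed_eq (pairing a).continuous
      ((pairing (𝓕 a)).continuous.comp (Lp.fourierTransformₗᵢ Plane ℂ).symm.continuous)
  · intro Φ
    simp only [SchwartzMap.toLpCLM_apply, SchwartzMap.toLp_fourierInv_eq, pairing_apply]
    have := integral_mul_fourier a (𝓕⁻ Φ)
    rw [FourierTransform.fourier_fourierInv_eq] at this
    rw [integral_congr_ae, this, integral_congr_ae]
    · filter_upwards [SchwartzMap.coeFn_toLp (𝓕⁻ Φ) 2] with x hx using by rw [hx]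
    · filter_upwards [SchwartzMap.coeFn_toLp Φ 2] with x hx using by rw [hx]

lemma integrable_mul_L2 (a b : L2C) : Integrable (fun x => a x * b x) volume :=
  MemLp.integrable_mul (Lp.memLp a) (Lp.memLp b)

lemma memLp_comp_sub (b : L2C) (ξ : Plane) : MemLp (fun η => b (ξ - η)) 2 volume :=
  (Lp.memLp b).comp_measurePreserving (Measure.measurePreserving_sub_left volume ξ)

lemma integrable_mul_comp_sub (a b : L2C) (ξ : Plane) :
    Integrable (fun η => a η * b (ξ - η)) volume :=
  MemLp.integrable_mul (Lp.memLp a) (memLp_comp_sub b ξ)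

lemma eLpNorm_comp_sub (b : L2C) (ξ : Plane) :
    eLpNorm (fun η => b (ξ - η)) 2 volume = eLpNorm b 2 volume :=
  eLpNorm_comp_measurePreserving (Lp.aestronglyMeasurable b)
    (Measure.measurePreserving_sub_left volume ξ)

lemma integral_norm_mul_comp_sub_le (a b : L2C) (ξ : Plane) :
    ∫ η, ‖a η‖ * ‖b (ξ - η)‖ ≤ ‖a‖ * ‖b‖ := by
  have h := integral_mul_norm_le_Lp_mul_Lq (μ := (volume : Measure Plane))
    (f := a) (g := fun η => b (ξ - η)) Real.HolderConjugate.two_two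
    (by simpa using Lp.memLp a) (by simpa using memLp_comp_sub b ξ)
  refine h.trans (le_of_eq ?_)
  have e : ∀ g : Plane → ℂ, MemLp g 2 volume →
      (∫ x, ‖g x‖ ^ (2 : ℝ)) ^ (1 / (2 : ℝ)) = (eLpNorm g 2 volume).toReal := by
    intro g hg
    rw [MemLp.eLpNorm_eq_integral_rpow_norm (by norm_num) (by norm_num) hg]
    simp only [ENNReal.toReal_ofNat, one_div]
    rw [ENNReal.toReal_ofReal (by positivity)]
  rw [e _ (Lp.memLp a), e _ (memLp_comp_sub b ξ), eLpNorm_comp_sub, ← Lp.norm_def, ← Lp.norm_def]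

lemma aestronglyMeasurable_comp_sub_prod {b : Plane → ℂ} (hb : AEStronglyMeasurable b volume) :
    AEStronglyMeasurable (fun p : Plane × Plane => b (p.1 - p.2)) (volume.prod volume) :=
  hb.comp_quasiMeasurePreserving (quasiMeasurePreserving_sub volume volume)

lemma integrable_prod_convolution_mul (a b : L2C) {Ψ : Plane → ℂ} (hΨ : Integrable Ψ volume) :
    Integrable (fun p : Plane × Plane => a p.2 * b (p.1 - p.2) * Ψ p.1)
      (volume.prod volume) := by
  have hmeas : AEStronglyMeasurable (fun p : Plane × Plane => a p.2 * b (p.1 - p.2) * Ψ p.1)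
      (volume.prod volume) :=
    ((Lp.aestronglyMeasurable a).comp_snd.mul
      (aestronglyMeasurable_comp_sub_prod (Lp.aestronglyMeasurable b))).mul hΨ.1.comp_fst
  rw [integrable_prod_iff hmeas]
  refine ⟨Eventually.of_forall fun ξ => (integrable_mul_comp_sub a b ξ).mul_const (Ψ ξ), ?_⟩
  refine (hΨ.norm.const_mul (‖a‖ * ‖b‖)).mono' hmeas.norm.integral_prod_right'
    (Eventually.of_forall fun ξ => ?_)
  rw [Real.norm_of_nonneg (by positivity)]
  simp only [norm_mul, integral_mul_const]
  gcongr
  exact integral_norm_mul_comp_sub_le a b ξ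

/-- The Fourier transform of a product of `L²` functions is the convolution of the transforms,
tested against Schwartz functions. -/
lemma integral_mul_mul_fourier (a b : L2C) (Ψ : 𝓢(Plane, ℂ)) :
    ∫ x, a x * b x * (𝓕 Ψ) x =
      ∫ ξ, (∫ η, (𝓕 a : L2C) η * (𝓕 b : L2C) (ξ - η)) * Ψ ξ := by
  -- Absorbing `𝓕 Ψ` into b gives v in L¹ ∩ L², so its inverse transform is an honest integral,
  -- computed in `h2` by translating Ψ.
  have hv : MemLp (fun x => b x * (𝓕 Ψ) x) 2 volume :=
    MemLp.mul (p := 2) (q := ⊤) ((𝓕 Ψ).memLp_top) (Lp.memLp b)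
  have hv1 : Integrable (fun x => b x * (𝓕 Ψ) x) volume :=
    MemLp.integrable_mul (Lp.memLp b) ((𝓕 Ψ).memLp 2)
  set v : L2C := hv.toLp _ with hvdef
  have hvi : Integrable v volume := hv1.congr hv.coeFn_toLp.symm
  have h1 : ∫ x, a x * b x * (𝓕 Ψ) x = ∫ x, a x * v x := by
    apply integral_congr_ae
    filter_upwards [hv.coeFn_toLp] with x hx
    rw [hx]; ring
  have h2 : ∀ η : Plane, 𝓕⁻ (v : Plane → ℂ) η = ∫ ξ, (𝓕 b : L2C) (ξ - η) * Ψ ξ := by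
    intro η
    let Ψη : 𝓢(Plane, ℂ) := SchwartzMap.compSubConstCLM ℝ (-η) Ψ
    have hΨη : ∀ x, Ψη x = Ψ (x + η) := fun x => by simp [Ψη]
    have h3 := integral_mul_fourier b Ψη
    have h4 : ∫ ξ, (𝓕 b : L2C) (ξ - η) * Ψ ξ = ∫ κ, (𝓕 b : L2C) κ * Ψη κ := by
      rw [← integral_add_right_eq_self _ η]
      simp [hΨη]
    rw [h4, ← h3, Real.fourierInv_eq']
    apply integral_congr_ae
    filter_upwards [hv.coeFn_toLp] with x hx
    rw [hx]
    have h5 : (𝓕 Ψη) x = Complex.exp (2 * Real.pi * inner ℝ x η * Complex.I) * (𝓕 Ψ) x := by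
      rw [SchwartzMap.fourier_coe, SchwartzMap.fourier_coe, Real.fourier_eq', Real.fourier_eq',
        ← integral_const_mul, ← integral_sub_right_eq_self _ η]
      congr 1 with y
      simp only [hΨη, sub_add_cancel, smul_eq_mul, ← mul_assoc, ← Complex.exp_add]
      congr 2
      rw [inner_sub_left, real_inner_comm x η]
      push_cast; ring
    rw [h5, smul_eq_mul]
    push_cast
    ring
  rw [h1, integral_mul_eq_integral_fourier_mul_fourierInv]
  have h6 : ∫ ξ, (𝓕 a : L2C) ξ * (𝓕⁻ v : L2C) ξ =
      ∫ η, ∫ ξ, (𝓕 a : L2C) η * (𝓕 b : L2C) (ξ - η) * Ψ ξ := by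
    apply integral_congr_ae
    filter_upwards [coeFn_fourierInv_of_integrable v hvi] with η hη
    rw [hη, h2, ← integral_const_mul]
    simp only [mul_assoc]
  rw [h6, integral_integral_swap]
  · simp only [integral_mul_const]
  · exact (integrable_prod_convolution_mul (𝓕 a) (𝓕 b) Ψ.integrable).swap

/-! ### Bounded multiplication operators on `L²` -/

/-- Measurable bounded symbols. -/
def BoundedSymbol (m : Plane → ℂ) : Prop := Measurable m ∧ ∃ C : ℝ, ∀ ξ, ‖m ξ‖ ≤ C

lemma BoundedSymbol.memLp {m : Plane → ℂ} (hm : BoundedSymbol m) {f : Plane → ℂ}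
    (hf : MemLp f 2 volume) : MemLp (fun ξ => m ξ * f ξ) 2 volume := by
  obtain ⟨hmeas, C, hC⟩ := hm
  exact MemLp.mul (p := ⊤) (q := 2) hf
    (memLp_top_of_bound hmeas.aestronglyMeasurable C (Eventually.of_forall hC))

lemma norm_toLp_le_of_bound {f : L2C} {g : Plane → ℂ} (hg : MemLp g 2 volume) {C : ℝ}
    (h : ∀ᵐ ξ, ‖g ξ‖ ≤ C * ‖f ξ‖) : ‖(hg.toLp g : L2C)‖ ≤ C * ‖f‖ := by
  apply Lp.norm_le_mul_norm_of_ae_le_mul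
  filter_upwards [h, hg.coeFn_toLp] with ξ h1 h2
  rw [h2]; exact h1

/-- Multiplication by a bounded symbol, as an operator on `L²`. -/
def mulOp (m : Plane → ℂ) (hm : BoundedSymbol m) : L2C →L[ℂ] L2C :=
  LinearMap.mkContinuous
    { toFun := fun f => (hm.memLp (Lp.memLp f)).toLp _
      map_add' := fun f g => by
        apply Lp.ext
        filter_upwards [(hm.memLp (Lp.memLp (f + g))).coeFn_toLp, Lp.coeFn_add f g,
          (hm.memLp (Lp.memLp f)).coeFn_toLp, (hm.memLp (Lp.memLp g)).coeFn_toLp,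
          Lp.coeFn_add ((hm.memLp (Lp.memLp f)).toLp _) ((hm.memLp (Lp.memLp g)).toLp _)]
          with ξ h1 h2 h3 h4 h5
        rw [h1, h5, Pi.add_apply, h3, h4, h2, Pi.add_apply, mul_add]
      map_smul' := fun c f => by
        apply Lp.ext
        filter_upwards [(hm.memLp (Lp.memLp (c • f))).coeFn_toLp, Lp.coeFn_smul c f,
          (hm.memLp (Lp.memLp f)).coeFn_toLp,
          Lp.coeFn_smul c ((hm.memLp (Lp.memLp f)).toLp _)] with ξ h1 h2 h3 h5
        rw [h1, RingHom.id_apply, h5, Pi.smul_apply, h3, h2, Pi.smul_apply, smul_eq_mul,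
          smul_eq_mul]
        ring }
    hm.2.choose fun f => by
      refine norm_toLp_le_of_bound (hm.memLp (Lp.memLp f)) (Eventually.of_forall fun ξ => ?_)
      rw [norm_mul]
      gcongr
      exact hm.2.choose_spec ξ

lemma coeFn_mulOp {m : Plane → ℂ} (hm : BoundedSymbol m) (f : L2C) :
    mulOp m hm f =ᵐ[volume] fun ξ => m ξ * f ξ :=
  (hm.memLp (Lp.memLp f)).coeFn_toLp

/-! ### The convolution form of the nonlinearity -/

/-- The weight `1 + |ξ|`. -/
def wt (ξ : Plane) : ℝ := 1 + ‖ξ‖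

lemma one_le_wt (ξ : Plane) : 1 ≤ wt ξ := by simp [wt]

lemma wt_pos (ξ : Plane) : 0 < wt ξ := lt_of_lt_of_le one_pos (one_le_wt ξ)

lemma norm_le_wt (ξ : Plane) : ‖ξ‖ ≤ wt ξ := by simp [wt]

@[fun_prop]
lemma continuous_wt : Continuous wt := by unfold wt; fun_prop

/-- Submultiplicativity of the weight is what makes convolution compatible with the weighted spaces:
a weight in ξ is dominated by the product of the weights in η and ξ−η. -/
lemma wt_le_mul (ξ η : Plane) : wt ξ ≤ wt η * wt (ξ - η) := by
  have h : ‖ξ‖ ≤ ‖η‖ + ‖ξ - η‖ := by simpa using norm_add_le η (ξ - η)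
  unfold wt
  nlinarith [norm_nonneg η, norm_nonneg (ξ - η), mul_nonneg (norm_nonneg η) (norm_nonneg (ξ - η))]

/-- The kernel `η^⊥ · ξ / |η|` of the nonlinearity. -/
def kernel (ξ η : Plane) : ℝ := (ξ 1 * η 0 - ξ 0 * η 1) / ‖η‖

lemma abs_cross_le (ξ η : Plane) : |ξ 1 * η 0 - ξ 0 * η 1| ≤ ‖ξ‖ * ‖η‖ := by
  apply abs_le_of_sq_le_sq _ (by positivity)
  rw [mul_pow, EuclideanSpace.norm_sq_eq, EuclideanSpace.norm_sq_eq]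
  simp only [Fin.sum_univ_two, Real.norm_eq_abs, sq_abs]
  nlinarith [sq_nonneg (ξ 0 * η 0 + ξ 1 * η 1)]

lemma abs_kernel_le (ξ η : Plane) : |kernel ξ η| ≤ ‖ξ‖ := by
  rw [kernel, abs_div, abs_norm]
  exact div_le_of_le_mul₀ (norm_nonneg _) (norm_nonneg _) (abs_cross_le ξ η)

/-- The cross product of η with itself vanishes, which is div u = 0 on the Fourier side. It allows
the derivative to be placed on either ξ or ξ−η. -/
lemma kernel_sub_left (ξ η : Plane) : kernel (ξ - η) η = kernel ξ η := by
  simp only [kernel, PiLp.sub_apply]; congr 1; ring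

lemma kernel_neg_left (ξ η : Plane) : kernel (-ξ) η = -kernel ξ η := by
  simp only [kernel, PiLp.neg_apply]; ring

lemma measurable_kernel : Measurable (fun p : Plane × Plane => kernel p.1 p.2) := by
  unfold kernel
  have h (i : Fin 2) : Measurable fun p : Plane × Plane => p.1 i :=
    (by fun_prop : Continuous fun p : Plane × Plane => p.1 i).measurable
  have h' (i : Fin 2) : Measurable fun p : Plane × Plane => p.2 i :=
    (by fun_prop : Continuous fun p : Plane × Plane => p.2 i).measurable
  exact (((h 1).mul (h' 0)).sub ((h 0).mul (h' 1))).div measurable_snd.norm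

/-- The bilinear convolution `∫ k(ξ, η) f(η) g(ξ - η) dη`. -/
def nonlin (f g : Plane → ℂ) (ξ : Plane) : ℂ := ∫ η, (kernel ξ η : ℂ) * f η * g (ξ - η)

lemma nonlin_congr {f f' g g' : Plane → ℂ} (hf : f =ᵐ[volume] f') (hg : g =ᵐ[volume] g')
    (ξ : Plane) : nonlin f g ξ = nonlin f' g' ξ := by
  apply integral_congr_ae
  have h := (Measure.measurePreserving_sub_left (volume : Measure Plane) ξ
    ).quasiMeasurePreserving.ae_eq_comp hg
  filter_upwards [hf, h] with η h1 h2
  rw [h1, show g (ξ - η) = g' (ξ - η) from h2]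

lemma aestronglyMeasurable_nonlin_integrand {f g : Plane → ℂ}
    (hf : AEStronglyMeasurable f volume) (hg : AEStronglyMeasurable g volume) :
    AEStronglyMeasurable (fun p : Plane × Plane => (kernel p.1 p.2 : ℂ) * f p.2 * g (p.1 - p.2))
      (volume.prod volume) :=
  ((Complex.measurable_ofReal.comp measurable_kernel).aestronglyMeasurable.mul hf.comp_snd).mul
    (aestronglyMeasurable_comp_sub_prod hg)

lemma aestronglyMeasurable_nonlin {f g : Plane → ℂ}
    (hf : AEStronglyMeasurable f volume) (hg : AEStronglyMeasurable g volume) :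
    AEStronglyMeasurable (nonlin f g) volume :=
  (aestronglyMeasurable_nonlin_integrand hf hg).integral_prod_right'

lemma measurable_kernel_right (ξ : Plane) : Measurable (kernel ξ) :=
  measurable_kernel.comp measurable_prodMk_left

lemma integrable_nonlin (F G : L2C) (ξ : Plane) :
    Integrable (fun η => (kernel ξ η : ℂ) * F η * G (ξ - η)) volume := by
  simp only [mul_assoc]
  refine (integrable_mul_comp_sub F G ξ).bdd_mul (c := ‖ξ‖)
    (Complex.measurable_ofReal.comp (measurable_kernel_right ξ)).aestronglyMeasurable
    (Eventually.of_forall fun η => ?_)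
  simpa using abs_kernel_le ξ η

/-- The symbol `(1 + |ξ|)^{-n}`. -/
def wtInv (n : ℕ) (ξ : Plane) : ℂ := (((wt ξ ^ n)⁻¹ : ℝ) : ℂ)

lemma norm_wtInv (n : ℕ) (ξ : Plane) : ‖wtInv n ξ‖ = (wt ξ ^ n)⁻¹ := by
  have := wt_pos ξ
  rw [wtInv, Complex.norm_real, Real.norm_of_nonneg (by positivity)]

@[fun_prop]
lemma continuous_wtInv (n : ℕ) : Continuous (wtInv n) := by
  unfold wtInv
  exact Complex.continuous_ofReal.comp ((continuous_wt.pow n).inv₀ fun ξ =>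
    (pow_pos (wt_pos ξ) n).ne')

lemma boundedSymbol_wtInv (n : ℕ) : BoundedSymbol (wtInv n) :=
  ⟨(continuous_wtInv n).measurable, 1, fun ξ => by
    rw [norm_wtInv]; exact inv_le_one_of_one_le₀ (one_le_pow₀ (one_le_wt ξ))⟩

/-- The square decays like |ξ|^{−4}, integrable in dimension two. Exponent 1 would just fail, so 2
is the number of powers reserved for square integrability from here on. -/
lemma memLp_wtInv_two : MemLp (wtInv 2) 2 (volume : Measure Plane) := by
  rw [memLp_two_iff_integrable_sq_norm (continuous_wtInv 2).aestronglyMeasurable]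
  have h := integrable_one_add_norm (E := Plane) (μ := volume) (r := 4) (by simp; norm_num)
  refine h.congr (Eventually.of_forall fun ξ => ?_)
  simp only [norm_wtInv]
  rw [Real.rpow_neg (by positivity), inv_pow, ← pow_mul]
  norm_cast

/-- The integrand of the weighted nonlinearity. -/
def weightedNonlin (n : ℕ) (F G : L2C) (ξ : Plane) : ℂ :=
  ((wt ξ ^ n : ℝ) : ℂ) * wtInv 3 ξ *
    nonlin (mulOp _ (boundedSymbol_wtInv n) F) (mulOp _ (boundedSymbol_wtInv n) G) ξ

lemma norm_nonlin_weighted_le (n : ℕ) (F G : L2C) (ξ : Plane) :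
    ‖nonlin (mulOp _ (boundedSymbol_wtInv n) F) (mulOp _ (boundedSymbol_wtInv n) G) ξ‖ ≤
      ‖ξ‖ * (wt ξ ^ n)⁻¹ * (‖F‖ * ‖G‖) := by
  have hint : Integrable (fun η => ‖F η‖ * ‖G (ξ - η)‖) volume := by
    simpa using (integrable_mul_comp_sub F G ξ).norm
  calc ‖nonlin (mulOp _ (boundedSymbol_wtInv n) F) (mulOp _ (boundedSymbol_wtInv n) G) ξ‖
      ≤ ∫ η, (‖ξ‖ * (wt ξ ^ n)⁻¹) * (‖F η‖ * ‖G (ξ - η)‖) := by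
        refine norm_integral_le_of_norm_le (hint.const_mul _) ?_
        have h := (Measure.measurePreserving_sub_left (volume : Measure Plane) ξ
          ).quasiMeasurePreserving.ae_eq_comp (coeFn_mulOp (boundedSymbol_wtInv n) G)
        filter_upwards [coeFn_mulOp (boundedSymbol_wtInv n) F, h] with η h1 h2
        simp only [Function.comp_apply] at h2
        rw [h1, h2]
        simp only [norm_mul, norm_wtInv, Complex.norm_real, Real.norm_eq_abs]
        have h3 : (wt η ^ n)⁻¹ * (wt (ξ - η) ^ n)⁻¹ ≤ (wt ξ ^ n)⁻¹ := by
          rw [← mul_inv, ← mul_pow]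
          have := wt_pos ξ
          exact inv_anti₀ (by positivity) (pow_le_pow_left₀ this.le (wt_le_mul ξ η) n)
        calc |kernel ξ η| * ((wt η ^ n)⁻¹ * ‖F η‖) * ((wt (ξ - η) ^ n)⁻¹ * ‖G (ξ - η)‖)
            = |kernel ξ η| * ((wt η ^ n)⁻¹ * (wt (ξ - η) ^ n)⁻¹) * (‖F η‖ * ‖G (ξ - η)‖) := by
              ring
          _ ≤ _ := by
              have := wt_pos ξ
              have := wt_pos η
              have := wt_pos (ξ - η)
              gcongr
              exact abs_kernel_le ξ η
    _ ≤ _ := by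
        have := wt_pos ξ
        rw [integral_const_mul]
        gcongr
        exact integral_norm_mul_comp_sub_le F G ξ

/-- Of the three powers removed by `wtInv 3`, one pays for the factor |ξ| of the kernel and two are
left over to make the result square integrable. -/
lemma norm_weightedNonlin_le (n : ℕ) (F G : L2C) (ξ : Plane) :
    ‖weightedNonlin n F G ξ‖ ≤ ‖F‖ * ‖G‖ * ‖wtInv 2 ξ‖ := by
  have hw := wt_pos ξ
  rw [weightedNonlin, norm_mul, norm_mul, norm_wtInv, norm_wtInv, Complex.norm_real,
    Real.norm_of_nonneg (by positivity)]
  calc wt ξ ^ n * (wt ξ ^ 3)⁻¹ * ‖nonlin _ _ ξ‖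
      ≤ wt ξ ^ n * (wt ξ ^ 3)⁻¹ * (wt ξ * (wt ξ ^ n)⁻¹ * (‖F‖ * ‖G‖)) := by
        gcongr
        refine (norm_nonlin_weighted_le n F G ξ).trans ?_
        gcongr
        exact norm_le_wt ξ
    _ = ‖F‖ * ‖G‖ * (wt ξ ^ 2)⁻¹ := by field_simp

lemma memLp_weightedNonlin (n : ℕ) (F G : L2C) :
    MemLp (weightedNonlin n F G) 2 volume := by
  refine (memLp_wtInv_two.const_mul ((‖F‖ * ‖G‖ : ℝ) : ℂ)).mono ?_
    (Eventually.of_forall fun ξ => ?_)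
  · refine AEStronglyMeasurable.mul ?_ (aestronglyMeasurable_nonlin (Lp.aestronglyMeasurable _)
      (Lp.aestronglyMeasurable _))
    exact ((Complex.continuous_ofReal.comp (continuous_wt.pow n)).mul
      (continuous_wtInv 3)).aestronglyMeasurable
  · refine (norm_weightedNonlin_le n F G ξ).trans (le_of_eq ?_)
    rw [norm_mul, Complex.norm_real, Real.norm_of_nonneg (by positivity)]

lemma nonlin_add_left (F F' G : L2C) (ξ : Plane) :
    nonlin (F + F' : L2C) G ξ = nonlin F G ξ + nonlin F' G ξ := by
  unfold nonlin
  rw [← integral_add (integrable_nonlin F G ξ) (integrable_nonlin F' G ξ)]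
  apply integral_congr_ae
  filter_upwards [Lp.coeFn_add F F'] with η h
  rw [h, Pi.add_apply]; ring

lemma nonlin_smul_left (c : ℂ) (F G : L2C) (ξ : Plane) :
    nonlin (c • F : L2C) G ξ = c * nonlin F G ξ := by
  unfold nonlin
  rw [← integral_const_mul]
  apply integral_congr_ae
  filter_upwards [Lp.coeFn_smul c F] with η h
  rw [h, Pi.smul_apply, smul_eq_mul]; ring

lemma nonlin_add_right (F G G' : L2C) (ξ : Plane) :
    nonlin F (G + G' : L2C) ξ = nonlin F G ξ + nonlin F G' ξ := by
  unfold nonlin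
  rw [← integral_add (integrable_nonlin F G ξ) (integrable_nonlin F G' ξ)]
  apply integral_congr_ae
  have h := (Measure.measurePreserving_sub_left (volume : Measure Plane) ξ
    ).quasiMeasurePreserving.ae_eq_comp (Lp.coeFn_add G G')
  filter_upwards [h] with η h
  simp only [Function.comp_apply, Pi.add_apply] at h
  rw [h]; ring

lemma nonlin_smul_right (c : ℂ) (F G : L2C) (ξ : Plane) :
    nonlin F (c • G : L2C) ξ = c * nonlin F G ξ := by
  unfold nonlin
  rw [← integral_const_mul]
  apply integral_congr_ae
  have h := (Measure.measurePreserving_sub_left (volume : Measure Plane) ξ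
    ).quasiMeasurePreserving.ae_eq_comp (Lp.coeFn_smul c G)
  filter_upwards [h] with η h
  simp only [Function.comp_apply, Pi.smul_apply, smul_eq_mul] at h
  rw [h]; ring

/-- The nonlinearity as a bounded bilinear map between weighted `L²` spaces. -/
def bilin (n : ℕ) : L2C →L[ℂ] L2C →L[ℂ] L2C :=
  LinearMap.mkContinuous₂
    (LinearMap.mk₂ ℂ (fun F G => (memLp_weightedNonlin n F G).toLp _)
      (fun F F' G => by
        rw [← MemLp.toLp_add, MemLp.toLp_eq_toLp_iff]
        refine Eventually.of_forall fun ξ => ?_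
        simp only [weightedNonlin, Pi.add_apply, map_add, nonlin_add_left]; ring)
      (fun c F G => by
        rw [← MemLp.toLp_const_smul, MemLp.toLp_eq_toLp_iff]
        refine Eventually.of_forall fun ξ => ?_
        simp only [weightedNonlin, Pi.smul_apply, map_smul, nonlin_smul_left, smul_eq_mul]; ring)
      (fun F G G' => by
        rw [← MemLp.toLp_add, MemLp.toLp_eq_toLp_iff]
        refine Eventually.of_forall fun ξ => ?_
        simp only [weightedNonlin, Pi.add_apply, map_add, nonlin_add_right]; ring)
      (fun c F G => by
        rw [← MemLp.toLp_const_smul, MemLp.toLp_eq_toLp_iff]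
        refine Eventually.of_forall fun ξ => ?_
        simp only [weightedNonlin, Pi.smul_apply, map_smul, nonlin_smul_right, smul_eq_mul]
        ring))
    ‖(memLp_wtInv_two.toLp _ : L2C)‖ (fun F G => by
      have h : ‖((memLp_weightedNonlin n F G).toLp _ : L2C)‖ ≤
          (‖F‖ * ‖G‖) * ‖(memLp_wtInv_two.toLp _ : L2C)‖ := by
        refine norm_toLp_le_of_bound _ ?_
        filter_upwards [memLp_wtInv_two.coeFn_toLp] with ξ h1
        rw [h1]
        exact norm_weightedNonlin_le n F G ξ
      calc _ ≤ _ := h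
        _ = _ := by ring)

lemma coeFn_bilin (n : ℕ) (F G : L2C) :
    bilin n F G =ᵐ[volume] weightedNonlin n F G :=
  (memLp_weightedNonlin n F G).coeFn_toLp

/-! ### The right-hand side of the equation -/

/-- The symbol `(2π|ξ|)^γ` of the dissipation. -/
def lapSymbol (γ : ℝ) (ξ : Plane) : ℝ := (2 * Real.pi * ‖ξ‖) ^ γ

lemma lapSymbol_nonneg (γ : ℝ) (ξ : Plane) : 0 ≤ lapSymbol γ ξ :=
  Real.rpow_nonneg (by positivity) _

lemma lapSymbol_neg (γ : ℝ) (ξ : Plane) : lapSymbol γ (-ξ) = lapSymbol γ ξ := by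
  simp [lapSymbol]

lemma measurable_lapSymbol (γ : ℝ) : Measurable (lapSymbol γ) := by
  unfold lapSymbol; fun_prop

lemma lapSymbol_le {γ : ℝ} (hγ : γ ∈ Ioc (0 : ℝ) 1) (ξ : Plane) :
    lapSymbol γ ξ ≤ 2 * Real.pi * wt ξ := by
  have h1 : (1 : ℝ) ≤ 2 * Real.pi * wt ξ := by
    nlinarith [Real.pi_gt_three, one_le_wt ξ]
  calc lapSymbol γ ξ ≤ (2 * Real.pi * wt ξ) ^ γ :=
        Real.rpow_le_rpow (by positivity) (by gcongr; exact norm_le_wt ξ) hγ.1.le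
    _ ≤ (2 * Real.pi * wt ξ) ^ (1 : ℝ) := Real.rpow_le_rpow_of_exponent_le h1 hγ.2
    _ = _ := Real.rpow_one _

/-- The symbol of the weighted dissipation. -/
def dissSymbol (γ : ℝ) (ξ : Plane) : ℂ := -((lapSymbol γ ξ : ℝ) : ℂ) * wtInv 3 ξ

lemma boundedSymbol_dissSymbol {γ : ℝ} (hγ : γ ∈ Ioc (0 : ℝ) 1) :
    BoundedSymbol (dissSymbol γ) := by
  refine ⟨(Complex.measurable_ofReal.comp (measurable_lapSymbol γ)).neg.mul
    (continuous_wtInv 3).measurable, 2 * Real.pi, fun ξ => ?_⟩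
  have hw := wt_pos ξ
  rw [dissSymbol, norm_mul, norm_neg, Complex.norm_real,
    Real.norm_of_nonneg (lapSymbol_nonneg γ ξ), norm_wtInv]
  calc lapSymbol γ ξ * (wt ξ ^ 3)⁻¹ ≤ (2 * Real.pi * wt ξ) * (wt ξ ^ 1)⁻¹ := by
        gcongr
        · exact lapSymbol_le hγ ξ
        · exact one_le_wt ξ
        · norm_num
    _ = 2 * Real.pi := by field_simp

/-- The weighted right-hand side `(1+|ξ|)^{n-3} (2π N(f,f) - (2π|ξ|)^γ f)` as a function of
`V = (1+|ξ|)^n f`. -/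
def rhs {γ : ℝ} (hγ : γ ∈ Ioc (0 : ℝ) 1) (n : ℕ) (V : L2C) : L2C :=
  mulOp _ (boundedSymbol_dissSymbol hγ) V + (2 * Real.pi : ℂ) • bilin n V V

/-- The map is a continuous linear term plus a continuous quadratic one. This is what propagates
regularity in time from V to its derivative. -/
lemma contDiff_rhs {γ : ℝ} (hγ : γ ∈ Ioc (0 : ℝ) 1) (n : ℕ) {k : WithTop ℕ∞} :
    ContDiff ℝ k (rhs hγ n) := by
  have h1 : ContDiff ℂ k (rhs hγ n) := by
    unfold rhs
    exact (mulOp _ _).contDiff.add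
      ((((bilin n).contDiff).clm_apply contDiff_id).const_smul _)
  exact h1.restrict_scalars ℝ

/-- The Fourier transform of `-u·∇θ - (-Δ)^{γ/2} θ` in terms of that of `θ`. -/
def fourierRhs (γ : ℝ) (f : Plane → ℂ) (ξ : Plane) : ℂ :=
  2 * Real.pi * nonlin f f ξ - (lapSymbol γ ξ : ℂ) * f ξ

lemma coeFn_rhs {γ : ℝ} (hγ : γ ∈ Ioc (0 : ℝ) 1) (n : ℕ) {f : Plane → ℂ} {V : L2C}
    (hV : V =ᵐ[volume] fun ξ => ((wt ξ ^ n : ℝ) : ℂ) * f ξ) :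
    rhs hγ n V =ᵐ[volume]
      fun ξ => ((wt ξ ^ n : ℝ) : ℂ) * wtInv 3 ξ * fourierRhs γ f ξ := by
  have hf : mulOp _ (boundedSymbol_wtInv n) V =ᵐ[volume] f := by
    filter_upwards [coeFn_mulOp (boundedSymbol_wtInv n) V, hV] with ξ h1 h2
    have : ((wt ξ ^ n : ℝ) : ℂ) ≠ 0 := by exact_mod_cast (pow_pos (wt_pos ξ) n).ne'
    rw [h1, h2, wtInv, Complex.ofReal_inv, inv_mul_cancel_left₀ this]
  unfold rhs
  filter_upwards [Lp.coeFn_add (mulOp _ (boundedSymbol_dissSymbol hγ) V)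
      ((2 * Real.pi : ℂ) • bilin n V V), Lp.coeFn_smul (2 * Real.pi : ℂ) (bilin n V V),
    coeFn_bilin n V V, coeFn_mulOp (boundedSymbol_dissSymbol hγ) V, hV] with ξ h1 h2 h3 h4 h5
  rw [h1, Pi.add_apply, h2, Pi.smul_apply, h3, h4, h5, weightedNonlin, nonlin_congr hf hf,
    fourierRhs, dissSymbol, smul_eq_mul]
  ring

/-! ### The weak formulation on the Fourier side -/

lemma coeFn_fourierInv_eq_fourier_neg (v : L2C) :
    (𝓕⁻ v : L2C) =ᵐ[volume] fun ξ => (𝓕 v : L2C) (-ξ) := by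
  have hm : MemLp (fun ξ => (𝓕 v : L2C) (-ξ)) 2 volume :=
    (Lp.memLp (𝓕 v : L2C)).comp_measurePreserving (Measure.measurePreserving_neg volume)
  refine ae_eq_of_integral_mul_schwartz (Lp_locallyIntegrable _)
    (hm.locallyIntegrable (by norm_num)) fun Ψ _ => ?_
  let Ψ' : 𝓢(Plane, ℂ) := SchwartzMap.compCLMOfContinuousLinearEquiv ℝ
    (ContinuousLinearEquiv.neg ℝ) Ψ
  have hΨ' : ∀ x, Ψ' x = Ψ (-x) := fun x => by simp [Ψ']
  have key : ∀ x, (𝓕 Ψ') x = (𝓕⁻ Ψ) x := by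
    intro x
    rw [SchwartzMap.fourier_coe, SchwartzMap.fourierInv_coe,
      Real.fourierInv_eq_fourier_comp_neg]
    congr 1
  rw [← integral_mul_fourierInv]
  simp only [← key]
  rw [integral_mul_fourier, ← integral_neg_eq_self]
  simp [hΨ']

lemma boundedSymbol_riesz (j : Fin 2) :
    BoundedSymbol (fun ξ : Plane => Complex.I * ((ξ j / ‖ξ‖ : ℝ) : ℂ)) := by
  have h : Measurable fun ξ : Plane => ξ j :=
    (by fun_prop : Continuous fun ξ : Plane => ξ j).measurable
  refine ⟨(Complex.measurable_ofReal.comp (h.div measurable_norm)).const_mul _, 1, fun ξ => ?_⟩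
  rw [norm_mul, Complex.norm_I, one_mul, Complex.norm_real, norm_div, norm_norm]
  exact div_le_one_of_le₀ (PiLp.norm_apply_le ξ j) (norm_nonneg _)

lemma fourierL2_riesz (j : Fin 2) (f : L2) :
    fourierL2 (riesz j f) =ᵐ[volume]
      fun ξ => Complex.I * ((ξ j / ‖ξ‖ : ℝ) : ℂ) * fourierL2 f ξ := by
  refine fourierL2_fourierMultiplier (fun ξ => ?_) f
    ((boundedSymbol_riesz j).memLp (Lp.memLp _))
  simp only [PiLp.neg_apply, norm_neg, map_mul, Complex.conj_I, Complex.conj_ofReal, neg_div]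
  push_cast; ring

/-! ### Test functions on the Fourier side. -/

/-- The complexification of a real Schwartz function. -/
def schwartzC (φ : 𝓢(Plane, ℝ)) : 𝓢(Plane, ℂ) := φ.postcompCLM Complex.ofRealCLM

lemma schwartzC_apply (φ : 𝓢(Plane, ℝ)) (x : Plane) : schwartzC φ x = (φ x : ℂ) := rfl

lemma toComplex_toLp (φ : 𝓢(Plane, ℝ)) : toComplex (φ.toLp 2) = (schwartzC φ).toLp 2 := by
  apply Lp.ext
  filter_upwards [coeFn_toComplex (φ.toLp 2), φ.coeFn_toLp 2, (schwartzC φ).coeFn_toLp 2]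
    with x h1 h2 h3
  rw [h1, h2, h3, schwartzC_apply]

lemma exists_wt_pow_mul_schwartz_le (n : ℕ) (χ : 𝓢(Plane, ℂ)) :
    ∃ C : ℝ, ∀ ξ, wt ξ ^ n * ‖χ ξ‖ ≤ C := by
  refine ⟨2 ^ n * ((Finset.Iic (n, 0)).sup fun m => SchwartzMap.seminorm ℝ m.1 m.2) χ,
    fun ξ => ?_⟩
  have h := SchwartzMap.one_add_le_sup_seminorm_apply (𝕜 := ℝ) (m := (n, 0)) (k := n) (n := 0)
    le_rfl le_rfl χ ξ
  simpa [wt] using h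

lemma memLp_wt_pow_mul_schwartz (n : ℕ) (χ : 𝓢(Plane, ℂ)) :
    MemLp (fun ξ => ((wt ξ ^ n : ℝ) : ℂ) * χ ξ) 2 volume := by
  obtain ⟨C, hC⟩ := exists_wt_pow_mul_schwartz_le (n + 2) χ
  refine (memLp_wtInv_two.const_mul (C : ℂ)).mono ?_ (Eventually.of_forall fun ξ => ?_)
  · exact ((Complex.continuous_ofReal.comp (continuous_wt.pow n)).mul
      χ.continuous).aestronglyMeasurable
  · have hw := wt_pos ξ
    rw [norm_mul, norm_mul, norm_wtInv, Complex.norm_real, Complex.norm_real,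
      Real.norm_of_nonneg (by positivity : 0 ≤ wt ξ ^ n), ← div_eq_mul_inv,
      le_div_iff₀ (by positivity)]
    calc wt ξ ^ n * ‖χ ξ‖ * wt ξ ^ 2 = wt ξ ^ (n + 2) * ‖χ ξ‖ := by ring
      _ ≤ C := hC ξ
      _ ≤ ‖C‖ := le_abs_self C

lemma memLp_lapSymbol_mul_schwartz {γ : ℝ} (hγ : γ ∈ Ioc (0 : ℝ) 1) (χ : 𝓢(Plane, ℂ)) :
    MemLp (fun ξ => (lapSymbol γ ξ : ℂ) * χ ξ) 2 volume := by
  refine ((memLp_wt_pow_mul_schwartz 1 χ).const_mul (2 * Real.pi : ℂ)).mono ?_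
    (Eventually.of_forall fun ξ => ?_)
  · exact (Complex.measurable_ofReal.comp (measurable_lapSymbol γ)).aestronglyMeasurable.mul
      χ.continuous.aestronglyMeasurable
  · have hw := wt_pos ξ
    rw [norm_mul, Complex.norm_real, Real.norm_of_nonneg (lapSymbol_nonneg γ ξ)]
    have h := lapSymbol_le hγ ξ
    have h2 : ‖(2 * Real.pi : ℂ) * (((wt ξ ^ 1 : ℝ) : ℂ) * χ ξ)‖ =
        2 * Real.pi * wt ξ * ‖χ ξ‖ := by
      rw [norm_mul, norm_mul, norm_mul, Complex.norm_real, Complex.norm_real, pow_one,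
        Real.norm_of_nonneg hw.le, Real.norm_of_nonneg Real.pi_pos.le]
      simp; ring
    rw [h2]
    gcongr

lemma integral_mul_schwartz_eq_fourier (θ : L2) (φ : 𝓢(Plane, ℝ)) :
    ((∫ x, θ x * φ x : ℝ) : ℂ) = ∫ ξ, fourierL2 θ ξ * (𝓕⁻ (schwartzC φ)) ξ := by
  have h := integral_mul_fourier (toComplex θ) (𝓕⁻ (schwartzC φ))
  rw [FourierTransform.fourier_fourierInv_eq] at h
  rw [fourierL2, ← h, ← integral_complex_ofReal]
  apply integral_congr_ae
  filter_upwards [coeFn_toComplex θ] with x hx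
  rw [hx, schwartzC_apply]; push_cast; rfl

lemma integral_mul_fracLaplacian_eq_fourier {γ : ℝ} (hγ : γ ∈ Ioc (0 : ℝ) 1) (θ : L2)
    (φ : 𝓢(Plane, ℝ)) :
    ((∫ x, θ x * fracLaplacian γ (φ.toLp 2) x : ℝ) : ℂ) =
      ∫ ξ, (lapSymbol γ ξ : ℂ) * fourierL2 θ ξ * (𝓕⁻ (schwartzC φ)) ξ := by
  have hF : fourierL2 (φ.toLp 2) = (𝓕 (schwartzC φ)).toLp 2 := by
    rw [fourierL2, toComplex_toLp, SchwartzMap.toLp_fourier_eq]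
  have hmem : MemLp (fun ξ => (lapSymbol γ ξ : ℂ) * fourierL2 (φ.toLp 2) ξ) 2 volume := by
    refine (memLp_lapSymbol_mul_schwartz hγ (𝓕 (schwartzC φ))).ae_eq ?_
    filter_upwards [(𝓕 (schwartzC φ)).coeFn_toLp 2] with ξ h
    rw [hF, h]
  have h1 : fourierL2 (fracLaplacian γ (φ.toLp 2)) =ᵐ[volume]
      fun ξ => (lapSymbol γ ξ : ℂ) * fourierL2 (φ.toLp 2) ξ := by
    refine fourierL2_fourierMultiplier (fun ξ => ?_) _ hmem
    simp
  set v : L2C := toComplex (fracLaplacian γ (φ.toLp 2)) with hv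
  have h2 : ((∫ x, θ x * fracLaplacian γ (φ.toLp 2) x : ℝ) : ℂ) =
      ∫ x, toComplex θ x * v x := by
    rw [← integral_complex_ofReal]
    apply integral_congr_ae
    filter_upwards [coeFn_toComplex θ, coeFn_toComplex (fracLaplacian γ (φ.toLp 2))] with x h3 h4
    rw [h3, hv, h4]; push_cast; rfl
  rw [h2, integral_mul_eq_integral_fourier_mul_fourierInv]
  apply integral_congr_ae
  filter_upwards [coeFn_fourierInv_eq_fourier_neg v, ae_neg_of_ae h1,
    ae_neg_of_ae ((𝓕 (schwartzC φ)).coeFn_toLp 2 volume)] with ξ h3 h4 h5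
  have h6 : (𝓕 (schwartzC φ)) (-ξ) = (𝓕⁻ (schwartzC φ)) ξ := by
    rw [SchwartzMap.fourier_coe, SchwartzMap.fourierInv_coe, Real.fourierInv_eq_fourier_neg]
  rw [h3, show (𝓕 v : L2C) (-ξ) = _ from h4, hF, h5, h6, lapSymbol_neg]
  change fourierL2 θ ξ * _ = _
  ring

lemma integrable_of_norm_le_schwartz {Q : Plane → ℂ} (hQ : AEStronglyMeasurable Q volume) {C : ℝ}
    (hC : ∀ ξ, ‖Q ξ‖ ≤ C) (χ : 𝓢(Plane, ℂ)) : Integrable (fun ξ => Q ξ * χ ξ) volume :=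
  χ.integrable.bdd_mul hQ (Eventually.of_forall hC)

/-- Multiplication of a Schwartz function by a coordinate. -/
def coordMul (k : Fin 2) (χ : 𝓢(Plane, ℂ)) : 𝓢(Plane, ℂ) :=
  SchwartzMap.smulLeftCLM ℂ (fun ξ : Plane => inner ℝ ξ (EuclideanSpace.single k (1 : ℝ))) χ

lemma coordMul_apply (k : Fin 2) (χ : 𝓢(Plane, ℂ)) (ξ : Plane) :
    coordMul k χ ξ = (ξ k : ℂ) * χ ξ := by
  have : (fun ξ : Plane => inner ℝ ξ (EuclideanSpace.single k (1 : ℝ))).HasTemperateGrowth :=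
    ((innerSL ℝ).flip (EuclideanSpace.single k (1 : ℝ))).hasTemperateGrowth
  rw [coordMul, SchwartzMap.smulLeftCLM_apply_apply this, EuclideanSpace.inner_single_right]
  simp

lemma fderiv_schwartz_eq_fourier (φ : 𝓢(Plane, ℝ)) (k : Fin 2) (x : Plane) :
    ((fderiv ℝ φ x (EuclideanSpace.single k 1) : ℝ) : ℂ) =
      (𝓕 ((-(2 * Real.pi * Complex.I)) • coordMul k (𝓕⁻ (schwartzC φ)))) x := by
  have h := SchwartzMap.lineDerivOp_fourier_eq (𝓕⁻ (schwartzC φ))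
    (EuclideanSpace.single k (1 : ℝ))
  rw [FourierTransform.fourier_fourierInv_eq] at h
  rw [coordMul, ← h, SchwartzMap.lineDerivOp_apply_eq_fderiv]
  have h2 : fderiv ℝ (schwartzC φ) x = Complex.ofRealCLM.comp (fderiv ℝ φ x) :=
    (Complex.ofRealCLM.hasFDerivAt.comp x (φ.hasFDerivAt x)).fderiv
  rw [h2]; rfl

/-- The convolution of the Fourier transforms of `R_j θ` and `θ`, up to a factor `i`. -/
def rieszConv (j : Fin 2) (f : L2C) (ξ : Plane) : ℂ :=
  ∫ η, ((η j / ‖η‖ : ℝ) : ℂ) * f η * f (ξ - η)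

lemma integrable_rieszConv (j : Fin 2) (f : L2C) (ξ : Plane) :
    Integrable (fun η => ((η j / ‖η‖ : ℝ) : ℂ) * f η * f (ξ - η)) volume := by
  have h : Measurable fun ξ : Plane => ξ j :=
    (by fun_prop : Continuous fun ξ : Plane => ξ j).measurable
  simp only [mul_assoc]
  refine (integrable_mul_comp_sub f f ξ).bdd_mul (c := 1)
    (Complex.measurable_ofReal.comp (h.div measurable_norm)).aestronglyMeasurable
    (Eventually.of_forall fun η => ?_)
  rw [Complex.norm_real, norm_div, norm_norm]
  exact div_le_one_of_le₀ (PiLp.norm_apply_le η j) (norm_nonneg _)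

/-- The growth in ξ is isolated in two coordinate factors, which can be moved onto the test
function. The remaining convolutions are bounded in ξ, so all integrals against Schwartz functions
converge. -/
lemma nonlin_eq_rieszConv (f : L2C) (ξ : Plane) :
    nonlin f f ξ = ξ 1 * rieszConv 0 f ξ - ξ 0 * rieszConv 1 f ξ := by
  unfold nonlin rieszConv
  rw [← integral_const_mul, ← integral_const_mul,
    ← integral_sub ((integrable_rieszConv _ _ _).const_mul _)
      ((integrable_rieszConv _ _ _).const_mul _)]
  congr 1 with η
  simp only [kernel]
  push_cast
  ring

lemma integrable_rieszConv_mul (j : Fin 2) (f : L2C) (χ : 𝓢(Plane, ℂ)) :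
    Integrable (fun ξ => rieszConv j f ξ * χ ξ) volume := by
  have h : Measurable fun ξ : Plane => ξ j :=
    (by fun_prop : Continuous fun ξ : Plane => ξ j).measurable
  refine integrable_of_norm_le_schwartz (C := ‖f‖ * ‖f‖) ?_ (fun ξ => ?_) χ
  · have hm : AEStronglyMeasurable (fun p : Plane × Plane =>
        ((p.2 j / ‖p.2‖ : ℝ) : ℂ) * f p.2 * f (p.1 - p.2)) (volume.prod volume) :=
      (((Complex.measurable_ofReal.comp
        (h.div measurable_norm)).aestronglyMeasurable.comp_snd).mul
        (Lp.aestronglyMeasurable f).comp_snd).mul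
        (aestronglyMeasurable_comp_sub_prod (Lp.aestronglyMeasurable f))
    exact hm.integral_prod_right'
  · refine le_trans (norm_integral_le_of_norm_le
      (by simpa using (integrable_mul_comp_sub f f ξ).norm) (Eventually.of_forall fun η => ?_))
      (integral_norm_mul_comp_sub_le f f ξ)
    rw [norm_mul, norm_mul, Complex.norm_real, norm_div, norm_norm]
    refine mul_le_mul_of_nonneg_right ?_ (norm_nonneg _)
    exact mul_le_of_le_one_left (norm_nonneg _)
      (div_le_one_of_le₀ (PiLp.norm_apply_le η j) (norm_nonneg _))

lemma integral_riesz_mul_fderiv_eq_fourier (θ : L2) (φ : 𝓢(Plane, ℝ)) (j k : Fin 2) :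
    ((∫ x, θ x * (riesz j θ x * fderiv ℝ φ x (EuclideanSpace.single k 1)) : ℝ) : ℂ) =
      2 * Real.pi * ∫ ξ, rieszConv j (fourierL2 θ) ξ * coordMul k (𝓕⁻ (schwartzC φ)) ξ := by
  set χ := 𝓕⁻ (schwartzC φ) with hχ
  have h1 : ((∫ x, θ x * (riesz j θ x * fderiv ℝ φ x (EuclideanSpace.single k 1)) : ℝ) : ℂ) =
      ∫ x, toComplex (riesz j θ) x * toComplex θ x *
        (𝓕 ((-(2 * Real.pi * Complex.I)) • coordMul k χ)) x := by
    rw [← integral_complex_ofReal]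
    apply integral_congr_ae
    filter_upwards [coeFn_toComplex θ, coeFn_toComplex (riesz j θ)] with x h3 h4
    rw [h3, h4, ← fderiv_schwartz_eq_fourier]
    push_cast; ring
  rw [h1, integral_mul_mul_fourier, ← integral_const_mul]
  congr 1 with ξ
  have h2 : ∫ η, (𝓕 (toComplex (riesz j θ)) : L2C) η * (𝓕 (toComplex θ) : L2C) (ξ - η) =
      Complex.I * rieszConv j (fourierL2 θ) ξ := by
    rw [rieszConv, ← integral_const_mul]
    apply integral_congr_ae
    filter_upwards [fourierL2_riesz j θ] with η hη
    rw [show (𝓕 (toComplex (riesz j θ)) : L2C) η = _ from hη]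
    change _ * fourierL2 θ (ξ - η) = _
    ring
  rw [h2, _root_.smul_apply, smul_eq_mul]
  linear_combination (-2 * Real.pi * rieszConv j (fourierL2 θ) ξ * coordMul k χ ξ) *
    Complex.I_mul_I

lemma integral_transport_eq_fourier (θ : L2) (φ : 𝓢(Plane, ℝ)) :
    ((∫ x, θ x * fderiv ℝ φ x (velocity θ x) : ℝ) : ℂ) =
      2 * Real.pi * ∫ ξ, nonlin (fourierL2 θ) (fourierL2 θ) ξ * (𝓕⁻ (schwartzC φ)) ξ := by
  set χ := 𝓕⁻ (schwartzC φ) with hχ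
  have hv : ∀ x, velocity θ x = (-(riesz 1 θ x)) • EuclideanSpace.single 0 (1 : ℝ) +
      riesz 0 θ x • EuclideanSpace.single 1 (1 : ℝ) := by
    intro x
    ext i
    fin_cases i <;> simp [velocity]
  have hb : ∀ k : Fin 2, ∃ C : ℝ, ∀ x, ‖fderiv ℝ φ x (EuclideanSpace.single k 1)‖ ≤ C := by
    intro k
    refine ⟨SchwartzMap.seminorm ℝ 0 0 (∂_{EuclideanSpace.single k (1 : ℝ)} φ), fun x => ?_⟩
    have := SchwartzMap.norm_le_seminorm ℝ (∂_{EuclideanSpace.single k (1 : ℝ)} φ) x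
    rwa [SchwartzMap.lineDerivOp_apply_eq_fderiv] at this
  have hi : ∀ j k : Fin 2, Integrable
      (fun x => θ x * (riesz j θ x * fderiv ℝ φ x (EuclideanSpace.single k 1))) volume := by
    intro j k
    obtain ⟨C, hC⟩ := hb k
    have h1 : Integrable (fun x => θ x * riesz j θ x) volume :=
      MemLp.integrable_mul (Lp.memLp θ) (Lp.memLp (riesz j θ))
    simp only [← mul_assoc]
    refine h1.mul_bdd (c := C) ?_ (Eventually.of_forall hC)
    have : Continuous fun x => (∂_{EuclideanSpace.single k (1 : ℝ)} φ) x :=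
      (∂_{EuclideanSpace.single k (1 : ℝ)} φ).continuous
    simp only [SchwartzMap.lineDerivOp_apply_eq_fderiv] at this
    exact this.aestronglyMeasurable
  have h1 : ∫ x, θ x * fderiv ℝ φ x (velocity θ x) =
      (∫ x, θ x * (riesz 0 θ x * fderiv ℝ φ x (EuclideanSpace.single 1 1))) -
        ∫ x, θ x * (riesz 1 θ x * fderiv ℝ φ x (EuclideanSpace.single 0 1)) := by
    rw [← integral_sub (hi 0 1) (hi 1 0)]
    congr 1 with x
    rw [hv, map_add, map_smul, map_smul, smul_eq_mul, smul_eq_mul]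
    ring
  rw [h1, Complex.ofReal_sub, integral_riesz_mul_fderiv_eq_fourier,
    integral_riesz_mul_fderiv_eq_fourier, ← mul_sub,
    ← integral_sub (integrable_rieszConv_mul _ _ _) (integrable_rieszConv_mul _ _ _)]
  congr 2 with ξ
  rw [coordMul_apply, coordMul_apply]
  rw [nonlin_eq_rieszConv]; ring

lemma coeFn_rhs_zero {γ : ℝ} (hγ : γ ∈ Ioc (0 : ℝ) 1) (f : L2C) :
    rhs hγ 0 f =ᵐ[volume] fun ξ => wtInv 3 ξ * fourierRhs γ f ξ := by
  have h := coeFn_rhs hγ 0 (f := f) (V := f) (Eventually.of_forall fun ξ => by simp)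
  filter_upwards [h] with ξ hξ
  rw [hξ]; simp

/-- A Schwartz function multiplied by `(1+|ξ|)^3`, as an element of `L²`. -/
def weightedTest (χ : 𝓢(Plane, ℂ)) : L2C := (memLp_wt_pow_mul_schwartz 3 χ).toLp _

lemma coeFn_weightedTest (χ : 𝓢(Plane, ℂ)) :
    weightedTest χ =ᵐ[volume] fun ξ => ((wt ξ ^ 3 : ℝ) : ℂ) * χ ξ :=
  (memLp_wt_pow_mul_schwartz 3 χ).coeFn_toLp

lemma wt_pow_mul_wtInv (n : ℕ) (ξ : Plane) : ((wt ξ ^ n : ℝ) : ℂ) * wtInv n ξ = 1 := by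
  have : ((wt ξ ^ n : ℝ) : ℂ) ≠ 0 := by exact_mod_cast (pow_pos (wt_pos ξ) n).ne'
  rw [wtInv, Complex.ofReal_inv, mul_inv_cancel₀ this]

lemma pairing_mulOp_weightedTest (f : L2C) (χ : 𝓢(Plane, ℂ)) :
    pairing (mulOp _ (boundedSymbol_wtInv 3) f) (weightedTest χ) = ∫ ξ, f ξ * χ ξ := by
  rw [pairing_apply]
  apply integral_congr_ae
  filter_upwards [coeFn_mulOp (boundedSymbol_wtInv 3) f, coeFn_weightedTest χ] with ξ h1 h2
  rw [h1, h2]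
  linear_combination (f ξ * χ ξ) * wt_pow_mul_wtInv 3 ξ

lemma integrable_nonlin_mul (f : L2C) (χ : 𝓢(Plane, ℂ)) :
    Integrable (fun ξ => nonlin f f ξ * χ ξ) volume := by
  refine ((integrable_rieszConv_mul 0 f (coordMul 1 χ)).sub
    (integrable_rieszConv_mul 1 f (coordMul 0 χ))).congr (Eventually.of_forall fun ξ => ?_)
  simp only [Pi.sub_apply, nonlin_eq_rieszConv, coordMul_apply]; ring

lemma pairing_rhs_weightedTest {γ : ℝ} (hγ : γ ∈ Ioc (0 : ℝ) 1) (f : L2C) (χ : 𝓢(Plane, ℂ)) :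
    pairing (rhs hγ 0 f) (weightedTest χ) =
      2 * Real.pi * (∫ ξ, nonlin f f ξ * χ ξ) - ∫ ξ, (lapSymbol γ ξ : ℂ) * f ξ * χ ξ := by
  have hi : Integrable (fun ξ => (lapSymbol γ ξ : ℂ) * f ξ * χ ξ) volume := by
    refine (MemLp.integrable_mul (Lp.memLp f) (memLp_lapSymbol_mul_schwartz hγ χ)).congr
      (Eventually.of_forall fun ξ => ?_)
    simp only [Pi.mul_apply]; ring
  rw [pairing_apply, ← integral_const_mul, ← integral_sub ((integrable_nonlin_mul f χ).const_mul _)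
    hi]
  apply integral_congr_ae
  filter_upwards [coeFn_rhs_zero hγ f, coeFn_weightedTest χ] with ξ h1 h2
  rw [h1, h2, fourierRhs]
  linear_combination ((2 * Real.pi * nonlin f f ξ - (lapSymbol γ ξ : ℂ) * f ξ) * χ ξ) *
    wt_pow_mul_wtInv 3 ξ

/-- Pairing with the weighted test function is integrating (1+|ξ|)³ D against a Schwartz function,
and the weight never vanishes. -/
lemma eq_zero_of_pairing_weightedTest (D : L2C)
    (h : ∀ χ : 𝓢(Plane, ℂ), pairing D (weightedTest χ) = 0) : D = 0 := by
  have h0 : (fun ξ => ((wt ξ ^ 3 : ℝ) : ℂ) * D ξ) =ᵐ[volume] fun _ => 0 := by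
    refine ae_eq_of_integral_mul_schwartz ?_ (locallyIntegrable_const 0) fun χ _ => ?_
    · exact ((Lp_locallyIntegrable D).smul_continuous
        (g := fun ξ => ((wt ξ ^ 3 : ℝ) : ℂ)) (by fun_prop)).congr
        (Eventually.of_forall fun ξ => mul_comm _ _)
    · rw [← sub_eq_zero]
      simp only [zero_mul, integral_zero, sub_zero]
      rw [← h χ, pairing_apply]
      apply integral_congr_ae
      filter_upwards [coeFn_weightedTest χ] with ξ h2
      rw [h2]; ring
  apply (Lp.eq_zero_iff_ae_eq_zero).2
  filter_upwards [h0] with ξ hξ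
  have : ((wt ξ ^ 3 : ℝ) : ℂ) ≠ 0 := by exact_mod_cast (pow_pos (wt_pos ξ) 3).ne'
  exact (mul_eq_zero.1 hξ).resolve_left this

/-- The weak formulation only tests real φ. Splitting the Fourier transform of Ψ into real and
imaginary parts reaches all complex test functions by linearity. -/
lemma weightedTest_eq_re_im (Ψ : 𝓢(Plane, ℂ)) :
    ∃ φ₁ φ₂ : 𝓢(Plane, ℝ), weightedTest Ψ =
      weightedTest (𝓕⁻ (schwartzC φ₁)) + Complex.I • weightedTest (𝓕⁻ (schwartzC φ₂)) := by
  refine ⟨(𝓕 Ψ).postcompCLM Complex.reCLM, (𝓕 Ψ).postcompCLM Complex.imCLM, ?_⟩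
  set χ₁ := 𝓕⁻ (schwartzC ((𝓕 Ψ).postcompCLM Complex.reCLM))
  set χ₂ := 𝓕⁻ (schwartzC ((𝓕 Ψ).postcompCLM Complex.imCLM))
  have h : Ψ = χ₁ + Complex.I • χ₂ := by
    have h1 : 𝓕 Ψ = schwartzC ((𝓕 Ψ).postcompCLM Complex.reCLM) +
        Complex.I • schwartzC ((𝓕 Ψ).postcompCLM Complex.imCLM) := by
      ext x
      simp only [_root_.add_apply, _root_.smul_apply, schwartzC_apply,
        SchwartzMap.postcompCLM_apply, Complex.reCLM_apply, Complex.imCLM_apply, smul_eq_mul]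
      rw [mul_comm]
      exact (Complex.re_add_im _).symm
    have h2 := congrArg (fun Φ : 𝓢(Plane, ℂ) => (𝓕⁻ Φ : 𝓢(Plane, ℂ))) h1
    simpa only [FourierTransform.fourierInv_fourier_eq, FourierTransform.fourierInv_add,
      FourierTransform.fourierInv_smul] using h2
  apply Lp.ext
  filter_upwards [coeFn_weightedTest Ψ, coeFn_weightedTest χ₁, coeFn_weightedTest χ₂,
    Lp.coeFn_add (weightedTest χ₁) (Complex.I • weightedTest χ₂),
    Lp.coeFn_smul Complex.I (weightedTest χ₂)] with ξ h1 h2 h3 h4 h5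
  rw [h1, h4, Pi.add_apply, h5, Pi.smul_apply, h2, h3]
  nth_rewrite 1 [h]
  simp only [_root_.add_apply, _root_.smul_apply, smul_eq_mul]
  ring

/-- The weak formulation gives the integrated equation in a weighted `L²` space on the
Fourier side. -/
lemma fourier_integral_equation {γ : ℝ} (hγ : γ ∈ Ioc (0 : ℝ) 1) {T : ℝ} {θ₀ : L2} {θ : ℝ → L2}
    (hw : IsWeakSolution γ θ₀ T θ)
    (hc : ContinuousOn (fun t => fourierL2 (θ t)) (Icc 0 T)) {t : ℝ} (ht : t ∈ Icc 0 T) :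
    mulOp _ (boundedSymbol_wtInv 3) (fourierL2 (θ t)) -
      mulOp _ (boundedSymbol_wtInv 3) (fourierL2 (θ 0)) =
        ∫ s in (0 : ℝ)..t, rhs hγ 0 (fourierL2 (θ s)) := by
  have hrc : ContinuousOn (fun s => rhs hγ 0 (fourierL2 (θ s))) (Icc 0 T) :=
    (contDiff_rhs hγ 0 (k := 0)).continuous.comp_continuousOn hc
  have hri : IntervalIntegrable (fun s => rhs hγ 0 (fourierL2 (θ s))) volume 0 t := by
    apply ContinuousOn.intervalIntegrable
    rw [uIcc_of_le ht.1]
    exact hrc.mono (Icc_subset_Icc_right ht.2)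
  rw [← sub_eq_zero]
  set D := mulOp _ (boundedSymbol_wtInv 3) (fourierL2 (θ t)) -
      mulOp _ (boundedSymbol_wtInv 3) (fourierL2 (θ 0)) -
        ∫ s in (0 : ℝ)..t, rhs hγ 0 (fourierL2 (θ s)) with hD
  have key : ∀ φ : 𝓢(Plane, ℝ), pairing D (weightedTest (𝓕⁻ (schwartzC φ))) = 0 := by
    intro φ
    set χ := 𝓕⁻ (schwartzC φ) with hχ
    have h1 : pairing (∫ s in (0 : ℝ)..t, rhs hγ 0 (fourierL2 (θ s))) (weightedTest χ) =
        ∫ s in (0 : ℝ)..t, pairing (rhs hγ 0 (fourierL2 (θ s))) (weightedTest χ) :=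
      ((pairing.flip (weightedTest χ)).intervalIntegral_comp_comm hri).symm
    have h2 := congrArg (fun r : ℝ => (r : ℂ)) (hw.2 φ t ht)
    simp only [Complex.ofReal_add] at h2
    rw [integral_mul_schwartz_eq_fourier, integral_mul_schwartz_eq_fourier,
      ← intervalIntegral.integral_ofReal, ← hw.1] at h2
    rw [hD, map_sub, map_sub, _root_.sub_apply, _root_.sub_apply, h1,
      pairing_mulOp_weightedTest, pairing_mulOp_weightedTest, h2]
    simp only [pairing_rhs_weightedTest, Complex.ofReal_sub, integral_transport_eq_fourier,
      integral_mul_fracLaplacian_eq_fourier hγ]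
    ring
  refine eq_zero_of_pairing_weightedTest D fun Ψ => ?_
  obtain ⟨φ₁, φ₂, h⟩ := weightedTest_eq_re_im Ψ
  rw [h, map_add, map_smul, key, key]; simp

/-! ### Trilinear estimates -/

lemma lintegral_mul_le_sqrt {α : Type*} [MeasurableSpace α] (μ : Measure α) {f g : α → ℝ≥0∞}
    (hf : AEMeasurable f μ) (hg : AEMeasurable g μ) :
    ∫⁻ x, f x * g x ∂μ ≤ (∫⁻ x, f x ^ 2 ∂μ) ^ (1 / 2 : ℝ) * (∫⁻ x, g x ^ 2 ∂μ) ^ (1 / 2 : ℝ) := by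
  have h := ENNReal.lintegral_mul_le_Lp_mul_Lq μ Real.HolderConjugate.two_two hf hg
  simpa using h

lemma sqrt_mul_sqrt_self (x : ℝ≥0∞) : x ^ (1 / 2 : ℝ) * x ^ (1 / 2 : ℝ) = x := by
  rw [← ENNReal.rpow_add_of_nonneg _ _ (by norm_num) (by norm_num)]
  norm_num

/-- In polar coordinates the integrand is r^{1−2a}, integrable at 0 exactly when a < 1. -/
lemma lintegral_closedBall_norm_rpow_lt_top {a : ℝ} (ha : a < 1) :
    ∫⁻ m in Metric.closedBall (0 : Plane) 1, ENNReal.ofReal (‖m‖ ^ (-2 * a)) < ⊤ := by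
  have h : IntegrableOn (fun m : Plane => ‖m‖ ^ (-2 * a)) (Metric.ball 0 2) volume := by
    rw [integrableOn_fun_norm_addHaar volume (f := fun y : ℝ => y ^ (-2 * a))]
    have h2 : IntegrableOn (fun y : ℝ => y ^ (1 - 2 * a)) (Ioo 0 2) := by
      rw [intervalIntegral.integrableOn_Ioo_rpow_iff (by norm_num)]
      linarith
    refine h2.congr_fun (fun y hy => ?_) measurableSet_Ioo
    simp only [finrank_euclideanSpace, Fintype.card_fin, smul_eq_mul]
    rw [show (1 : ℝ) - 2 * a = 1 + (-2 * a) by ring, Real.rpow_add hy.1, Real.rpow_one]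
    norm_num
  refine lt_of_le_of_lt (lintegral_mono_set (t := Metric.ball 0 2)
    (Metric.closedBall_subset_ball (by norm_num))) ?_
  have := h.2
  rw [hasFiniteIntegral_iff_norm] at this
  refine lt_of_le_of_lt (lintegral_mono fun m => ?_) this
  exact ENNReal.ofReal_le_ofReal (le_abs_self _)

lemma lintegral_eq_mul_lintegral_comp_smul {g : Plane → ℝ≥0∞} (hg : Measurable g) {r : ℝ}
    (hr : 0 < r) : ∫⁻ m, g m = ENNReal.ofReal (r ^ 2) * ∫⁻ x, g (r • x) := by
  have h : ∫⁻ x, g (r • x) = ∫⁻ m, g m ∂(Measure.map (r • ·) (volume : Measure Plane)) :=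
    (lintegral_map hg (measurable_const_smul r)).symm
  rw [h, Measure.map_addHaar_smul _ hr.ne', lintegral_smul_measure, smul_eq_mul, ← mul_assoc,
    ← ENNReal.ofReal_mul (by positivity)]
  simp only [finrank_euclideanSpace, Fintype.card_fin]
  rw [abs_of_pos (by positivity), mul_inv_cancel₀ (by positivity)]
  simp

lemma lintegral_closedBall_norm_rpow (a : ℝ) {r : ℝ} (hr : 0 < r) :
    ∫⁻ m in Metric.closedBall (0 : Plane) r, ENNReal.ofReal (‖m‖ ^ (-2 * a)) =
      ENNReal.ofReal (r ^ (2 - 2 * a)) *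
        ∫⁻ m in Metric.closedBall (0 : Plane) 1, ENNReal.ofReal (‖m‖ ^ (-2 * a)) := by
  have hm : Measurable fun m : Plane => ENNReal.ofReal (‖m‖ ^ (-2 * a)) := by fun_prop
  rw [← lintegral_indicator Metric.isClosed_closedBall.measurableSet,
    ← lintegral_indicator Metric.isClosed_closedBall.measurableSet,
    lintegral_eq_mul_lintegral_comp_smul
      (hm.indicator Metric.isClosed_closedBall.measurableSet) hr,
    show r ^ (2 - 2 * a) = r ^ 2 * r ^ (-2 * a) by
      rw [← Real.rpow_natCast, ← Real.rpow_add hr]; congr 1; push_cast; ring,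
    ENNReal.ofReal_mul (by positivity), mul_assoc, ← lintegral_const_mul _
      (hm.indicator Metric.isClosed_closedBall.measurableSet)]
  congr 2 with x
  simp only [indicator, Metric.mem_closedBall, dist_zero_right, norm_smul,
    Real.norm_of_nonneg hr.le]
  by_cases h : ‖x‖ ≤ 1
  · rw [if_pos (by nlinarith), if_pos h, Real.mul_rpow hr.le (norm_nonneg _),
      ENNReal.ofReal_mul (by positivity)]
  · rw [if_neg (by intro h'; exact h (by nlinarith)), if_neg h, mul_zero]

/-! ### The trilinear form localized by its smallest frequency. -/

open Classical in
/-- The trilinear integrand, restricted to the region where the first frequency is the smallest. -/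
def triTerm (A B : Plane → ℝ≥0∞) (m p q : Plane) : ℝ≥0∞ :=
  if ‖m‖ ≤ ‖p‖ ∧ ‖m‖ ≤ ‖q‖ then A m * (B p * B q) else 0

/-- The trilinear form in which the first frequency is the smallest. -/
def tri (A B : Plane → ℝ≥0∞) : ℝ≥0∞ := ∫⁻ m, ∫⁻ p, triTerm A B m p (m + p)

lemma triTerm_le (A B : Plane → ℝ≥0∞) (m p q : Plane) :
    triTerm A B m p q ≤ A m * (B p * B q) := by
  unfold triTerm; split_ifs <;> simp

lemma measurable_triTerm_comp {α : Type*} [MeasurableSpace α] {A B : Plane → ℝ≥0∞}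
    (hA : Measurable A) (hB : Measurable B) {u v w : α → Plane} (hu : Measurable u)
    (hv : Measurable v) (hw : Measurable w) : Measurable fun x => triTerm A B (u x) (v x) (w x) := by
  unfold triTerm
  refine Measurable.ite ?_ ((hA.comp hu).mul ((hB.comp hv).mul (hB.comp hw))) measurable_const
  exact (measurableSet_le hu.norm hv.norm).inter (measurableSet_le hu.norm hw.norm)

/-- The low-frequency bound for the trilinear form. -/
lemma tri_le_lintegral_mul {A B : Plane → ℝ≥0∞} (hA : Measurable A) (hB : Measurable B) :
    tri A B ≤ (∫⁻ m, A m) * ∫⁻ p, B p ^ 2 := by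
  rw [← lintegral_mul_const _ hA]
  refine lintegral_mono fun m => ?_
  calc ∫⁻ p, triTerm A B m p (m + p) ≤ ∫⁻ p, A m * (B p * B (m + p)) :=
        lintegral_mono fun p => triTerm_le _ _ _ _ _
    _ = A m * ∫⁻ p, B p * B (m + p) :=
        lintegral_const_mul _ (hB.mul (hB.comp (measurable_const_add m)))
    _ ≤ A m * ∫⁻ p, B p ^ 2 := by
        gcongr A m * ?_
        have hBm : Measurable fun p => B (m + p) := hB.comp (measurable_const_add m)
        refine (lintegral_mul_le_sqrt volume hB.aemeasurable hBm.aemeasurable).trans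
          (le_of_eq ?_)
        rw [lintegral_add_left_eq_self (fun p => B p ^ 2) m, sqrt_mul_sqrt_self]

lemma rpow_mul_rpow_neg {x : ℝ} (hx : 0 < x) (y : ℝ) :
    ENNReal.ofReal (x ^ (-y)) * ENNReal.ofReal (x ^ y) = 1 := by
  rw [← ENNReal.ofReal_mul (by positivity), ← Real.rpow_add hx]; simp

/-- Insert |m|^a |p|^b |m+p|^b with b = (1−a)/2, together with its inverse. Since |m| ≤ |p| forces
|m+p| ≤ 2|p|, the factor |p|^{−b} becomes at most 2|m+p|^{−b}. The inverse weight then depends on m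
and m+p only, through |m|^{−a} |m+p|^{−(1−a)}. -/
lemma triTerm_le_weighted {a : ℝ} (ha0 : 0 ≤ a) (ha1 : a < 1) (A B : Plane → ℝ≥0∞) {m : Plane}
    (hm : m ≠ 0) (p : Plane) :
    triTerm A B m p (m + p) ≤
      ((ENNReal.ofReal (‖m‖ ^ a) * A m) * (ENNReal.ofReal (‖p‖ ^ ((1 - a) / 2)) * B p)) *
      (2 * (Metric.closedBall (0 : Plane) ‖m + p‖).indicator
        (fun m => ENNReal.ofReal (‖m‖ ^ (-a))) m *
          (ENNReal.ofReal (‖m + p‖ ^ (-(1 - a))) *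
            (ENNReal.ofReal (‖m + p‖ ^ ((1 - a) / 2)) * B (m + p)))) := by
  unfold triTerm
  split_ifs with h
  · have hm0 : 0 < ‖m‖ := norm_pos_iff.2 hm
    have hp0 : 0 < ‖p‖ := lt_of_lt_of_le hm0 h.1
    have hq0 : 0 < ‖m + p‖ := lt_of_lt_of_le hm0 h.2
    rw [indicator_of_mem (by simpa using h.2)]
    set b := (1 - a) / 2 with hb
    have hb0 : 0 < b := by simp only [hb]; linarith
    have h1 : ENNReal.ofReal (‖p‖ ^ (-b)) ≤ 2 * ENNReal.ofReal (‖m + p‖ ^ (-b)) := by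
      have hq : ‖m + p‖ ≤ 2 * ‖p‖ := by linarith [norm_add_le m p]
      have hb1 : b ≤ 1 := by simp only [hb]; linarith
      have h2 : (2 : ℝ≥0∞) * ENNReal.ofReal (‖m + p‖ ^ (-b)) =
          ENNReal.ofReal (2 * ‖m + p‖ ^ (-b)) := by
        rw [ENNReal.ofReal_mul (by norm_num), ENNReal.ofReal_ofNat]
      rw [h2]
      apply ENNReal.ofReal_le_ofReal
      calc ‖p‖ ^ (-b) ≤ (2⁻¹ * ‖m + p‖) ^ (-b) :=
            Real.rpow_le_rpow_of_nonpos (by positivity) (by linarith) (by linarith)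
        _ = 2 ^ b * ‖m + p‖ ^ (-b) := by
            rw [Real.mul_rpow (by norm_num) hq0.le, Real.inv_rpow (by norm_num),
              Real.rpow_neg (by norm_num), inv_inv]
        _ ≤ 2 ^ (1 : ℝ) * ‖m + p‖ ^ (-b) := by
            gcongr
            norm_num
        _ = 2 * ‖m + p‖ ^ (-b) := by rw [Real.rpow_one]
    have e1 : (1 - a) = b + b := by rw [hb]; ring
    calc A m * (B p * B (m + p))
        = (ENNReal.ofReal (‖m‖ ^ (-a)) * ENNReal.ofReal (‖m‖ ^ a)) * A m *
          (((ENNReal.ofReal (‖p‖ ^ (-b)) * ENNReal.ofReal (‖p‖ ^ b)) * B p) *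
          ((ENNReal.ofReal (‖m + p‖ ^ (-b)) * ENNReal.ofReal (‖m + p‖ ^ b)) * B (m + p))) := by
          rw [rpow_mul_rpow_neg hm0, rpow_mul_rpow_neg hp0, rpow_mul_rpow_neg hq0]; simp
      _ ≤ (ENNReal.ofReal (‖m‖ ^ (-a)) * ENNReal.ofReal (‖m‖ ^ a)) * A m *
          ((((2 * ENNReal.ofReal (‖m + p‖ ^ (-b))) * ENNReal.ofReal (‖p‖ ^ b)) * B p) *
          ((ENNReal.ofReal (‖m + p‖ ^ (-b)) * ENNReal.ofReal (‖m + p‖ ^ b)) * B (m + p))) := by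
          gcongr
      _ = _ := by
          have e2 : ENNReal.ofReal (‖m + p‖ ^ (-(1 - a))) =
              ENNReal.ofReal (‖m + p‖ ^ (-b)) * ENNReal.ofReal (‖m + p‖ ^ (-b)) := by
            rw [← ENNReal.ofReal_mul (by positivity), ← Real.rpow_add hq0, e1]
            congr 2; ring
          rw [e2]; ring
  · exact zero_le

/-- The weight in the critical trilinear bound. -/
def critWeight (a : ℝ) (h : Plane → ℝ≥0∞) (m q : Plane) : ℝ≥0∞ :=
  2 * (Metric.closedBall (0 : Plane) ‖q‖).indicator (fun m => ENNReal.ofReal (‖m‖ ^ (-a))) m *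
    (ENNReal.ofReal (‖q‖ ^ (-(1 - a))) * h q)

lemma measurable_critWeight (a : ℝ) {h : Plane → ℝ≥0∞} (hh : Measurable h) :
    Measurable fun x : Plane × Plane => critWeight a h x.1 x.2 := by
  have h1 : Measurable fun x : Plane × Plane =>
      {x : Plane × Plane | ‖x.1‖ ≤ ‖x.2‖}.indicator
        (fun x => ENNReal.ofReal (‖x.1‖ ^ (-a))) x :=
    (by fun_prop : Measurable fun x : Plane × Plane => ENNReal.ofReal (‖x.1‖ ^ (-a))).indicator
      (measurableSet_le (by fun_prop) (by fun_prop))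
  have h2 : (fun x : Plane × Plane => critWeight a h x.1 x.2) = fun x : Plane × Plane =>
      2 * {x : Plane × Plane | ‖x.1‖ ≤ ‖x.2‖}.indicator
        (fun x => ENNReal.ofReal (‖x.1‖ ^ (-a))) x *
        (ENNReal.ofReal (‖x.2‖ ^ (-(1 - a))) * h x.2) := by
    ext ⟨m, q⟩
    simp [critWeight, indicator]
  rw [h2]
  exact (h1.const_mul 2).mul ((by fun_prop : Measurable fun x : Plane × Plane =>
    ENNReal.ofReal (‖x.2‖ ^ (-(1 - a)))).mul (hh.comp measurable_snd))

/-- By scaling, the integral of |m|^{−2a} over |m| ≤ |q| is a constant times |q|^{2−2a}, which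
cancels the power of |q| in the weight exactly. This cancellation is the criticality of the
estimate. -/
lemma lintegral_critWeight_sq (a : ℝ) (h : Plane → ℝ≥0∞) {q : Plane} (hq : q ≠ 0) :
    ∫⁻ m, critWeight a h m q ^ 2 =
      4 * (∫⁻ m in Metric.closedBall (0 : Plane) 1, ENNReal.ofReal (‖m‖ ^ (-2 * a))) *
        h q ^ 2 := by
  have hq0 : 0 < ‖q‖ := norm_pos_iff.2 hq
  have e2 : ∀ m, critWeight a h m q ^ 2 = (Metric.closedBall (0 : Plane) ‖q‖).indicator
      (fun m => ENNReal.ofReal (‖m‖ ^ (-2 * a))) m *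
        (4 * ENNReal.ofReal (‖q‖ ^ (-(2 - 2 * a))) * h q ^ 2) := by
    intro m
    have e3 : (ENNReal.ofReal (‖q‖ ^ (-(1 - a)))) ^ 2 =
        ENNReal.ofReal (‖q‖ ^ (-(2 - 2 * a))) := by
      rw [← ENNReal.ofReal_pow (by positivity), ← Real.rpow_mul_natCast (by positivity)]
      congr 2; push_cast; ring
    have e4 : (ENNReal.ofReal (‖m‖ ^ (-a))) ^ 2 = ENNReal.ofReal (‖m‖ ^ (-2 * a)) := by
      rw [← ENNReal.ofReal_pow (by positivity), ← Real.rpow_mul_natCast (by positivity)]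
      congr 2; push_cast; ring
    simp only [critWeight, mul_pow, e3]
    by_cases hm : m ∈ Metric.closedBall (0 : Plane) ‖q‖
    · rw [indicator_of_mem hm, indicator_of_mem hm, e4]; ring
    · rw [indicator_of_notMem hm, indicator_of_notMem hm]; simp
  simp only [e2]
  rw [lintegral_mul_const _ ((by fun_prop : Measurable fun m : Plane =>
      ENNReal.ofReal (‖m‖ ^ (-2 * a))).indicator Metric.isClosed_closedBall.measurableSet),
    lintegral_indicator Metric.isClosed_closedBall.measurableSet,
    lintegral_closedBall_norm_rpow a hq0]
  set K₀ := ∫⁻ m in Metric.closedBall (0 : Plane) 1, ENNReal.ofReal (‖m‖ ^ (-2 * a))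
  calc ENNReal.ofReal (‖q‖ ^ (2 - 2 * a)) * K₀ *
        (4 * ENNReal.ofReal (‖q‖ ^ (-(2 - 2 * a))) * h q ^ 2)
      = (ENNReal.ofReal (‖q‖ ^ (-(2 - 2 * a))) * ENNReal.ofReal (‖q‖ ^ (2 - 2 * a))) *
        (4 * K₀ * h q ^ 2) := by ring
    _ = 4 * K₀ * h q ^ 2 := by rw [rpow_mul_rpow_neg hq0, one_mul]

lemma lintegral_swap {g : Plane → Plane → ℝ≥0∞}
    (hg : Measurable fun x : Plane × Plane => g x.1 x.2) :
    ∫⁻ x, ∫⁻ y, g x y = ∫⁻ y, ∫⁻ x, g x y :=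
  lintegral_lintegral_swap (f := g) hg.aemeasurable

lemma measurable_critWeight_add (a : ℝ) {h : Plane → ℝ≥0∞} (hh : Measurable h) :
    Measurable fun x : Plane × Plane => critWeight a h x.1 (x.1 + x.2) := by
  have h1 : Measurable fun x : Plane × Plane => (x.1, x.1 + x.2) :=
    measurable_fst.prodMk (measurable_fst.add measurable_snd)
  have h2 := (measurable_critWeight a hh).comp h1
  exact h2

lemma ae_ne_zero : ∀ᵐ m : Plane, m ≠ 0 := by
  simp [ae_iff, measure_singleton]

lemma lintegral_prod_critWeight_sq_le (a : ℝ) {h : Plane → ℝ≥0∞} (hh : Measurable h) :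
    ∫⁻ x : Plane × Plane, critWeight a h x.1 (x.1 + x.2) ^ 2 ∂(volume.prod volume) ≤
      4 * (∫⁻ m in Metric.closedBall (0 : Plane) 1, ENNReal.ofReal (‖m‖ ^ (-2 * a))) *
        ∫⁻ p, h p ^ 2 := by
  have hwm := (measurable_critWeight a hh).pow_const 2
  have hwadd : Measurable fun x : Plane × Plane => critWeight a h x.1 (x.1 + x.2) ^ 2 :=
    (measurable_critWeight_add a hh).pow_const 2
  rw [lintegral_prod _ hwadd.aemeasurable]
  have e1 : ∀ m : Plane, ∫⁻ p, critWeight a h m (m + p) ^ 2 = ∫⁻ q, critWeight a h m q ^ 2 :=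
    fun m => lintegral_add_left_eq_self (fun q => critWeight a h m q ^ 2) m
  simp only [e1]
  rw [lintegral_swap hwm, ← lintegral_const_mul _ (hh.pow_const 2)]
  refine lintegral_mono_ae ?_
  filter_upwards [ae_ne_zero] with q hq
  exact (lintegral_critWeight_sq a h hq).le

/-- The critical bound for the trilinear form. -/
lemma tri_le_critical {a : ℝ} (ha0 : 0 ≤ a) (ha1 : a < 1) : ∃ K : ℝ≥0∞, K ≠ ⊤ ∧
    ∀ A B : Plane → ℝ≥0∞, Measurable A → Measurable B →
      tri A B ≤ K * (∫⁻ m, (ENNReal.ofReal (‖m‖ ^ a) * A m) ^ 2) ^ (1 / 2 : ℝ) *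
        ∫⁻ p, (ENNReal.ofReal (‖p‖ ^ ((1 - a) / 2)) * B p) ^ 2 := by
  set K₀ := ∫⁻ m in Metric.closedBall (0 : Plane) 1, ENNReal.ofReal (‖m‖ ^ (-2 * a)) with hK₀
  have hK₀t : K₀ ≠ ⊤ := (lintegral_closedBall_norm_rpow_lt_top ha1).ne
  refine ⟨(4 * K₀) ^ (1 / 2 : ℝ), ENNReal.rpow_ne_top_of_nonneg (by norm_num)
    (ENNReal.mul_ne_top (by norm_num) hK₀t), fun A B hA hB => ?_⟩
  let g : Plane → ℝ≥0∞ := fun m => ENNReal.ofReal (‖m‖ ^ a) * A m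
  let h : Plane → ℝ≥0∞ := fun p => ENNReal.ofReal (‖p‖ ^ ((1 - a) / 2)) * B p
  have hgm : Measurable g := by simp only [g]; fun_prop
  have hhm : Measurable h := by simp only [h]; fun_prop
  have hgh : Measurable fun x : Plane × Plane => g x.1 * h x.2 :=
    (hgm.comp measurable_fst).mul (hhm.comp measurable_snd)
  have hwadd : Measurable fun x : Plane × Plane => critWeight a h x.1 (x.1 + x.2) :=
    measurable_critWeight_add a hhm
  have step1 : tri A B ≤ ∫⁻ m, ∫⁻ p, (g m * h p) * critWeight a h m (m + p) := by
    refine lintegral_mono_ae ?_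
    filter_upwards [ae_ne_zero] with m hm
    exact lintegral_mono fun p => triTerm_le_weighted ha0 ha1 A B hm p
  have step2 : ∫⁻ m, ∫⁻ p, (g m * h p) * critWeight a h m (m + p) =
      ∫⁻ x : Plane × Plane, (g x.1 * h x.2) * critWeight a h x.1 (x.1 + x.2)
        ∂(volume.prod volume) :=
    (lintegral_prod _ (hgh.mul hwadd).aemeasurable).symm
  have step3 : ∫⁻ x : Plane × Plane, (g x.1 * h x.2) ^ 2 ∂(volume.prod volume) =
      (∫⁻ m, g m ^ 2) * ∫⁻ p, h p ^ 2 := by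
    simp only [mul_pow]
    exact lintegral_prod_mul (hgm.pow_const 2).aemeasurable (hhm.pow_const 2).aemeasurable
  -- Cauchy–Schwarz on the product space: the square of g(m)h(p) factorizes, while the square of the
  -- weight integrates first in m at fixed q = m+p. Each side supplies one norm of h.
  calc tri A B ≤ ∫⁻ x : Plane × Plane, (g x.1 * h x.2) * critWeight a h x.1 (x.1 + x.2)
        ∂(volume.prod volume) := step1.trans step2.le
    _ ≤ _ := lintegral_mul_le_sqrt _ hgh.aemeasurable hwadd.aemeasurable
    _ ≤ ((∫⁻ m, g m ^ 2) * ∫⁻ p, h p ^ 2) ^ (1 / 2 : ℝ) *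
          ((4 * K₀) * ∫⁻ p, h p ^ 2) ^ (1 / 2 : ℝ) := by
        rw [step3]
        gcongr
        exact lintegral_prod_critWeight_sq_le a hhm
    _ = (4 * K₀) ^ (1 / 2 : ℝ) * (∫⁻ m, g m ^ 2) ^ (1 / 2 : ℝ) *
          ((∫⁻ p, h p ^ 2) ^ (1 / 2 : ℝ) * (∫⁻ p, h p ^ 2) ^ (1 / 2 : ℝ)) := by
        rw [ENNReal.mul_rpow_of_nonneg _ _ (by norm_num),
          ENNReal.mul_rpow_of_nonneg _ _ (by norm_num)]
        ring
    _ = _ := by rw [sqrt_mul_sqrt_self]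

lemma tri_add_left {A A' B : Plane → ℝ≥0∞} (hA : Measurable A) (hB : Measurable B) :
    tri (fun m => A m + A' m) B = tri A B + tri A' B := by
  unfold tri
  have h : Measurable fun m : Plane => ∫⁻ p, triTerm A B m p (m + p) :=
    Measurable.lintegral_prod_right' (f := fun x : Plane × Plane => triTerm A B x.1 x.2 (x.1 + x.2))
      (measurable_triTerm_comp hA hB measurable_fst measurable_snd
        (measurable_fst.add measurable_snd))
  rw [← lintegral_add_left h]
  congr 1 with m
  rw [← lintegral_add_left (measurable_triTerm_comp hA hB (u := fun _ => m) (v := fun p => p)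
    measurable_const measurable_id (measurable_const_add m))]
  congr 1 with p
  unfold triTerm
  split_ifs <;> simp [add_mul]

lemma lintegral_add_add {f g h : Plane → ℝ≥0∞} (hf : Measurable f) (hg : Measurable g) :
    ∫⁻ x, (f x + g x + h x) = (∫⁻ x, f x) + (∫⁻ x, g x) + ∫⁻ x, h x := by
  have hfg : Measurable fun x => f x + g x := hf.add hg
  rw [lintegral_add_left hfg, lintegral_add_left hf]

/-- A trilinear integral is controlled by `tri` once its integrand is controlled in each of the
three regions given by the smallest frequency. -/
lemma lintegral_le_three_tri {A B : Plane → ℝ≥0∞} (hA : Measurable A) (hB : Measurable B)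
    (hBe : ∀ᵐ p, B (-p) = B p) {Φ : Plane → Plane → ℝ≥0∞}
    (h : ∀ ξ η, Φ ξ η ≤ triTerm A B η (ξ - η) ξ + triTerm A B (ξ - η) η ξ +
      triTerm A B ξ η (ξ - η)) :
    ∫⁻ ξ, ∫⁻ η, Φ ξ η ≤ 3 * tri A B := by
  have m1 : Measurable fun x : Plane × Plane => triTerm A B x.2 (x.1 - x.2) x.1 :=
    measurable_triTerm_comp hA hB measurable_snd (measurable_fst.sub measurable_snd)
      measurable_fst
  have m2 : Measurable fun x : Plane × Plane => triTerm A B (x.1 - x.2) x.2 x.1 :=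
    measurable_triTerm_comp hA hB (measurable_fst.sub measurable_snd) measurable_snd
      measurable_fst
  have e1 : ∫⁻ ξ, ∫⁻ η, triTerm A B η (ξ - η) ξ = tri A B := by
    rw [lintegral_swap m1, tri]
    congr 1 with η
    rw [← lintegral_add_left_eq_self (fun ξ => triTerm A B η (ξ - η) ξ) η]
    simp
  have e2 : ∫⁻ ξ, ∫⁻ η, triTerm A B (ξ - η) η ξ = tri A B := by
    rw [← e1]
    congr 1 with ξ
    rw [← lintegral_sub_left_eq_self (fun η => triTerm A B (ξ - η) η ξ) ξ]
    simp
  -- When ξ is smallest, the other two frequencies add up to ξ instead of differing by it. The sign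
  -- of η has to be flipped, which uses that B is even.
  have e3 : ∫⁻ ξ, ∫⁻ η, triTerm A B ξ η (ξ - η) = tri A B := by
    rw [tri]
    congr 1 with ξ
    rw [← (Measure.measurePreserving_neg (volume : Measure Plane)).lintegral_comp_emb
      (MeasurableEquiv.neg Plane).measurableEmbedding (fun η => triTerm A B ξ η (ξ - η))]
    apply lintegral_congr_ae
    filter_upwards [hBe] with p hp
    simp only [triTerm, norm_neg, sub_neg_eq_add, hp]
  have m1' : Measurable fun ξ : Plane => ∫⁻ η, triTerm A B η (ξ - η) ξ := m1.lintegral_prod_right'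
  have m2' : Measurable fun ξ : Plane => ∫⁻ η, triTerm A B (ξ - η) η ξ := m2.lintegral_prod_right'
  calc ∫⁻ ξ, ∫⁻ η, Φ ξ η ≤ ∫⁻ ξ, ∫⁻ η, (triTerm A B η (ξ - η) ξ + triTerm A B (ξ - η) η ξ +
        triTerm A B ξ η (ξ - η)) := lintegral_mono fun ξ => lintegral_mono fun η => h ξ η
    _ = tri A B + tri A B + tri A B := by
        have : ∀ ξ : Plane, ∫⁻ η, (triTerm A B η (ξ - η) ξ + triTerm A B (ξ - η) η ξ +
            triTerm A B ξ η (ξ - η)) = (∫⁻ η, triTerm A B η (ξ - η) ξ) +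
            (∫⁻ η, triTerm A B (ξ - η) η ξ) + ∫⁻ η, triTerm A B ξ η (ξ - η) := by
          intro ξ
          have n1 : Measurable fun η => triTerm A B η (ξ - η) ξ :=
            measurable_triTerm_comp hA hB measurable_id (measurable_const.sub measurable_id)
              measurable_const
          have n2 : Measurable fun η => triTerm A B (ξ - η) η ξ :=
            measurable_triTerm_comp hA hB (measurable_const.sub measurable_id) measurable_id
              measurable_const
          exact lintegral_add_add n1 n2
        simp only [this]
        rw [lintegral_add_add m1' m2', e1, e2, e3]
    _ = 3 * tri A B := by ring

/-! ### Pointwise bounds for the symbols -/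

lemma abs_kernel_le_norm_sub (ξ η : Plane) : |kernel ξ η| ≤ ‖ξ - η‖ := by
  rw [← kernel_sub_left]; exact abs_kernel_le _ _

/-- The truncated modulus `min(|ξ|, N)`. -/
def trunc (N : ℝ) (ξ : Plane) : ℝ := min ‖ξ‖ N

lemma trunc_nonneg {N : ℝ} (hN : 0 ≤ N) (ξ : Plane) : 0 ≤ trunc N ξ :=
  le_min (norm_nonneg _) hN

lemma trunc_neg (N : ℝ) (ξ : Plane) : trunc N (-ξ) = trunc N ξ := by simp [trunc]

lemma measurable_trunc (N : ℝ) : Measurable (trunc N) := by unfold trunc; fun_prop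

lemma trunc_mono {N : ℝ} {ξ η : Plane} (h : ‖ξ‖ ≤ ‖η‖) : trunc N ξ ≤ trunc N η :=
  min_le_min_right _ h

lemma trunc_le_two_mul {N : ℝ} (hN : 0 ≤ N) {ξ η : Plane} (h : ‖ξ‖ ≤ 2 * ‖η‖) :
    trunc N ξ ≤ 2 * trunc N η := by
  unfold trunc
  rcases le_total ‖η‖ N with h1 | h1
  · rw [min_eq_left h1]; exact (min_le_left _ _).trans h
  · rw [min_eq_right h1]; exact (min_le_right _ _).trans (by linarith)

/-- This says that min(x, N)/x is nonincreasing in x: truncation does not increase relative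
increments. -/
lemma trunc_sub_mul_le {N : ℝ} (hN : 0 ≤ N) {ξ η : Plane} (h : ‖η‖ ≤ ‖ξ‖) :
    (trunc N ξ - trunc N η) * ‖ξ‖ ≤ (‖ξ‖ - ‖η‖) * trunc N ξ := by
  unfold trunc
  rcases le_total ‖ξ‖ N with h1 | h1
  · rw [min_eq_left h1, min_eq_left (h.trans h1)]
  · rw [min_eq_right h1]
    rcases le_total ‖η‖ N with h2 | h2
    · rw [min_eq_left h2]; nlinarith [norm_nonneg η]
    · rw [min_eq_right h2]; nlinarith

/-- Bernoulli's inequality for (a/b)^p, multiplied through by a power of b. Keeping the extra factor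
b avoids the exponent p − 1. -/
lemma rpow_sub_rpow_le {a b p : ℝ} (ha : 0 ≤ a) (hab : a ≤ b) (hp : 1 ≤ p) :
    (b ^ p - a ^ p) * b ≤ p * b ^ p * (b - a) := by
  rcases eq_or_lt_of_le (ha.trans hab) with hb | hb
  · have : a = 0 := le_antisymm (hab.trans hb.symm.le) ha
    rw [← hb, this]; simp
  have h := one_add_mul_self_le_rpow_one_add (s := a / b - 1)
    (by have := div_nonneg ha hb.le; linarith) hp
  rw [add_sub_cancel, Real.div_rpow ha hb.le, le_div_iff₀ (by positivity)] at h
  have h2 : (1 + p * (a / b - 1)) * b ^ p * b ≤ a ^ p * b :=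
    mul_le_mul_of_nonneg_right h hb.le
  have h3 : (1 + p * (a / b - 1)) * b ^ p * b = b ^ p * b - p * b ^ p * (b - a) := by
    field_simp; ring
  linarith

/-- Here ξ and κ are comparable high frequencies whose gap is at most e. The relative increment of W
is at most 2s times that of the truncated modulus, which is at most e/|ξ|, so the factor |ξ| is
traded for e. Comparability then redistributes b^{2s} evenly between the two frequencies, at the
cost 2^s. Nothing depends on N. -/
lemma commutator_aux {N s : ℝ} (hN : 0 < N) (hs : 1 ≤ s) {ξ κ : Plane} {e : ℝ}
    (he : ‖ξ‖ - ‖κ‖ ≤ e) (hκ : ‖κ‖ ≤ ‖ξ‖) (hξ2 : ‖ξ‖ ≤ 2 * ‖κ‖) :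
    (trunc N ξ ^ (2 * s) - trunc N κ ^ (2 * s)) * ‖ξ‖ ≤
      2 * s * 2 ^ s * (e * (trunc N κ ^ s * trunc N ξ ^ s)) := by
  set a := trunc N κ with hadef
  set b := trunc N ξ with hbdef
  have ha : 0 ≤ a := trunc_nonneg hN.le _
  have hab : a ≤ b := trunc_mono hκ
  have hb2 : b ≤ 2 * a := trunc_le_two_mul hN.le hξ2
  rcases eq_or_lt_of_le (ha.trans hab) with hb | hb
  · have : a = 0 := le_antisymm (hab.trans hb.symm.le) ha
    rw [← hb, this, Real.zero_rpow (by linarith), Real.zero_rpow (by linarith)]; simp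
  have he0 : 0 ≤ e := le_trans (sub_nonneg.2 hκ) he
  have h1 := rpow_sub_rpow_le (p := 2 * s) ha hab (by linarith)
  have h2 := trunc_sub_mul_le hN.le hκ
  have h3 : ((b ^ (2 * s) - a ^ (2 * s)) * ‖ξ‖) * b ≤ (2 * s * b ^ (2 * s) * e) * b := by
    calc ((b ^ (2 * s) - a ^ (2 * s)) * ‖ξ‖) * b
        = ((b ^ (2 * s) - a ^ (2 * s)) * b) * ‖ξ‖ := by ring
      _ ≤ (2 * s * b ^ (2 * s) * (b - a)) * ‖ξ‖ := by gcongr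
      _ = 2 * s * b ^ (2 * s) * ((b - a) * ‖ξ‖) := by ring
      _ ≤ 2 * s * b ^ (2 * s) * ((‖ξ‖ - ‖κ‖) * b) := by gcongr
      _ ≤ 2 * s * b ^ (2 * s) * (e * b) := by gcongr
      _ = _ := by ring
  have h4 := le_of_mul_le_mul_right h3 hb
  have h5 : b ^ (2 * s) ≤ 2 ^ s * (a ^ s * b ^ s) := by
    rw [two_mul, Real.rpow_add hb]
    calc b ^ s * b ^ s ≤ (2 * a) ^ s * b ^ s := by gcongr
      _ = _ := by rw [Real.mul_rpow (by norm_num) ha]; ring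
  calc _ ≤ 2 * s * b ^ (2 * s) * e := h4
    _ ≤ 2 * s * (2 ^ s * (a ^ s * b ^ s)) * e := by gcongr
    _ = _ := by ring

/-- The multiplier `(W(ξ) - W(ξ-η)) k(ξ, η)` of the energy identity, with
`W = min(|ξ|, N)^{2s}`. -/
def commSymbol (N s : ℝ) (ξ η : Plane) : ℝ :=
  |trunc N ξ ^ (2 * s) - trunc N (ξ - η) ^ (2 * s)| * |kernel ξ η|

lemma norm_le_two_mul_of_low {ξ η : Plane} (h : ‖η‖ ≤ ‖ξ - η‖) : ‖ξ‖ ≤ 2 * ‖ξ - η‖ := by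
  have : ‖ξ‖ ≤ ‖ξ - η‖ + ‖η‖ := by simpa using norm_add_le (ξ - η) η
  linarith

lemma norm_sub_le_two_mul_of_low {ξ η : Plane} (h : ‖η‖ ≤ ‖ξ‖) : ‖ξ - η‖ ≤ 2 * ‖ξ‖ := by
  linarith [norm_sub_le ξ η]

/-- This is the one region where the cancellation in W(ξ) − W(ξ−η) is needed. The kernel is only
bounded by the larger of the two high frequencies, and the difference of weights transfers that
derivative to the low frequency η. -/
lemma commSymbol_le_low {N s : ℝ} (hN : 0 < N) (hs : 1 ≤ s) {ξ η : Plane}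
    (h1 : ‖η‖ ≤ ‖ξ - η‖) (h2 : ‖η‖ ≤ ‖ξ‖) :
    commSymbol N s ξ η ≤ 2 * s * 2 ^ s * (‖η‖ * (trunc N (ξ - η) ^ s * trunc N ξ ^ s)) := by
  unfold commSymbol
  rcases le_total ‖ξ - η‖ ‖ξ‖ with h | h
  · have hW : trunc N (ξ - η) ^ (2 * s) ≤ trunc N ξ ^ (2 * s) :=
      Real.rpow_le_rpow (trunc_nonneg hN.le _) (trunc_mono h) (by linarith)
    rw [abs_of_nonneg (sub_nonneg.2 hW)]
    have h3 : ‖ξ‖ - ‖ξ - η‖ ≤ ‖η‖ := by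
      have : ‖ξ‖ ≤ ‖ξ - η‖ + ‖η‖ := by simpa using norm_add_le (ξ - η) η
      linarith
    refine le_trans ?_ (commutator_aux hN hs h3 h (norm_le_two_mul_of_low h1))
    exact mul_le_mul_of_nonneg_left (abs_kernel_le ξ η) (sub_nonneg.2 hW)
  · have hW : trunc N ξ ^ (2 * s) ≤ trunc N (ξ - η) ^ (2 * s) :=
      Real.rpow_le_rpow (trunc_nonneg hN.le _) (trunc_mono h) (by linarith)
    rw [abs_sub_comm, abs_of_nonneg (sub_nonneg.2 hW)]
    have h3 : ‖ξ - η‖ - ‖ξ‖ ≤ ‖η‖ := by linarith [norm_sub_le ξ η]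
    refine le_trans ?_ ((commutator_aux hN hs h3 h (norm_sub_le_two_mul_of_low h2)).trans
      (le_of_eq (by ring)))
    exact mul_le_mul_of_nonneg_left (abs_kernel_le_norm_sub ξ η) (sub_nonneg.2 hW)

/-- The factor 2s ≥ 1 is superfluous here; it is included so that all three regions share one
constant. -/
lemma trunc_rpow_two_mul_le {N s : ℝ} (hN : 0 < N) (hs : 1 ≤ s) {p q : Plane}
    (h : ‖p‖ ≤ 2 * ‖q‖) : trunc N p ^ (2 * s) ≤
      2 * s * 2 ^ s * (trunc N q ^ s * trunc N p ^ s) := by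
  have ha := trunc_nonneg hN.le p
  have hb := trunc_nonneg hN.le q
  have h1 : trunc N p ^ (2 * s) = trunc N p ^ s * trunc N p ^ s := by
    rw [two_mul, Real.rpow_add_of_nonneg ha (by linarith) (by linarith)]
  rw [h1]
  calc trunc N p ^ s * trunc N p ^ s ≤ (2 * trunc N q) ^ s * trunc N p ^ s := by
        gcongr
        exact trunc_le_two_mul hN.le h
    _ = 1 * (2 ^ s * (trunc N q ^ s * trunc N p ^ s)) := by
        rw [Real.mul_rpow (by norm_num) hb]; ring
    _ ≤ 2 * s * (2 ^ s * (trunc N q ^ s * trunc N p ^ s)) := by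
        gcongr
        linarith
    _ = _ := by ring

lemma abs_sub_le_of_le {x y : ℝ} (hx : 0 ≤ x) (hxy : x ≤ y) : |x - y| ≤ y := by
  rw [abs_le]; constructor <;> linarith

/-- No cancellation between the weights is needed: the kernel is already bounded by the smallest
frequency ξ−η, thanks to div u = 0, and the difference of weights is at most the larger weight. -/
lemma commSymbol_le_mid {N s : ℝ} (hN : 0 < N) (hs : 1 ≤ s) {ξ η : Plane}
    (h1 : ‖ξ - η‖ ≤ ‖η‖) (h2 : ‖ξ - η‖ ≤ ‖ξ‖) :
    commSymbol N s ξ η ≤ 2 * s * 2 ^ s * (‖ξ - η‖ * (trunc N η ^ s * trunc N ξ ^ s)) := by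
  have hW : trunc N (ξ - η) ^ (2 * s) ≤ trunc N ξ ^ (2 * s) :=
    Real.rpow_le_rpow (trunc_nonneg hN.le _) (trunc_mono h2) (by linarith)
  have h0 : 0 ≤ trunc N (ξ - η) ^ (2 * s) := Real.rpow_nonneg (trunc_nonneg hN.le _) _
  have h3 : ‖ξ‖ ≤ 2 * ‖η‖ := by
    have : ‖ξ‖ ≤ ‖ξ - η‖ + ‖η‖ := by simpa using norm_add_le (ξ - η) η
    linarith
  unfold commSymbol
  rw [abs_sub_comm]
  calc |trunc N (ξ - η) ^ (2 * s) - trunc N ξ ^ (2 * s)| * |kernel ξ η|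
      ≤ (2 * s * 2 ^ s * (trunc N η ^ s * trunc N ξ ^ s)) * ‖ξ - η‖ :=
        mul_le_mul ((abs_sub_le_of_le h0 hW).trans (trunc_rpow_two_mul_le hN hs h3))
          (abs_kernel_le_norm_sub ξ η) (abs_nonneg _)
          ((h0.trans hW).trans (trunc_rpow_two_mul_le hN hs h3))
    _ = _ := by ring

/-- The same argument with the other kernel bound, since now ξ itself is the smallest frequency. -/
lemma commSymbol_le_high {N s : ℝ} (hN : 0 < N) (hs : 1 ≤ s) {ξ η : Plane}
    (h1 : ‖ξ‖ ≤ ‖η‖) (h2 : ‖ξ‖ ≤ ‖ξ - η‖) :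
    commSymbol N s ξ η ≤ 2 * s * 2 ^ s * (‖ξ‖ * (trunc N η ^ s * trunc N (ξ - η) ^ s)) := by
  have hW : trunc N ξ ^ (2 * s) ≤ trunc N (ξ - η) ^ (2 * s) :=
    Real.rpow_le_rpow (trunc_nonneg hN.le _) (trunc_mono h2) (by linarith)
  have h0 : 0 ≤ trunc N ξ ^ (2 * s) := Real.rpow_nonneg (trunc_nonneg hN.le _) _
  have h3 : ‖ξ - η‖ ≤ 2 * ‖η‖ := by linarith [norm_sub_le ξ η]
  unfold commSymbol
  calc |trunc N ξ ^ (2 * s) - trunc N (ξ - η) ^ (2 * s)| * |kernel ξ η|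
      ≤ (2 * s * 2 ^ s * (trunc N η ^ s * trunc N (ξ - η) ^ s)) * ‖ξ‖ :=
        mul_le_mul ((abs_sub_le_of_le h0 hW).trans (trunc_rpow_two_mul_le hN hs h3))
          (abs_kernel_le ξ η) (abs_nonneg _)
          ((h0.trans hW).trans (trunc_rpow_two_mul_le hN hs h3))
    _ = _ := by ring

/-! ### From pointwise symbol bounds to integral bounds. -/

/-- Control of a weighted trilinear integral from bounds of the weight in the three regions
given by the smallest frequency. -/
lemma lintegral_trilinear_le {F : Plane → ℝ≥0∞} (hF : Measurable F)
    (hFe : ∀ᵐ p, F (-p) = F p) {a b : Plane → ℝ} (ha : Measurable a) (hb : Measurable b)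
    (ha0 : ∀ p, 0 ≤ a p) (hb0 : ∀ p, 0 ≤ b p) (hbe : ∀ p, b (-p) = b p)
    {c : Plane → Plane → ℝ}
    (h1 : ∀ ξ η, ‖η‖ ≤ ‖ξ - η‖ → ‖η‖ ≤ ‖ξ‖ → c ξ η ≤ a η * (b (ξ - η) * b ξ))
    (h2 : ∀ ξ η, ‖ξ - η‖ ≤ ‖η‖ → ‖ξ - η‖ ≤ ‖ξ‖ → c ξ η ≤ a (ξ - η) * (b η * b ξ))
    (h3 : ∀ ξ η, ‖ξ‖ ≤ ‖η‖ → ‖ξ‖ ≤ ‖ξ - η‖ → c ξ η ≤ a ξ * (b η * b (ξ - η))) :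
    ∫⁻ ξ, ∫⁻ η, ENNReal.ofReal (c ξ η) * (F η * F (ξ - η) * F ξ) ≤
      3 * tri (fun p => ENNReal.ofReal (a p) * F p) (fun p => ENNReal.ofReal (b p) * F p) := by
  refine lintegral_le_three_tri (ha.ennreal_ofReal.mul hF) (hb.ennreal_ofReal.mul hF) ?_
    fun ξ η => ?_
  · filter_upwards [hFe] with p hp
    simp only [Pi.mul_apply, hp, hbe]
  · have key : ∀ u v w : Plane, c ξ η ≤ a u * (b v * b w) →
        ENNReal.ofReal (c ξ η) * (F u * (F v * F w)) ≤
          (ENNReal.ofReal (a u) * F u) *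
            ((ENNReal.ofReal (b v) * F v) * (ENNReal.ofReal (b w) * F w)) := by
      intro u v w h
      calc ENNReal.ofReal (c ξ η) * (F u * (F v * F w))
          ≤ ENNReal.ofReal (a u * (b v * b w)) * (F u * (F v * F w)) := by gcongr
        _ = _ := by
            rw [ENNReal.ofReal_mul (ha0 u), ENNReal.ofReal_mul (hb0 v)]; ring
    by_cases c1 : ‖η‖ ≤ ‖ξ - η‖ ∧ ‖η‖ ≤ ‖ξ‖
    · refine le_trans ?_ (le_trans le_self_add le_self_add)
      rw [triTerm, if_pos c1]
      refine le_trans (le_of_eq (by ring)) (key _ _ _ (h1 ξ η c1.1 c1.2))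
    by_cases c2 : ‖ξ - η‖ ≤ ‖η‖ ∧ ‖ξ - η‖ ≤ ‖ξ‖
    · refine le_trans ?_ (le_trans le_add_self le_self_add)
      rw [triTerm, if_pos c2]
      refine le_trans (le_of_eq (by ring)) (key _ _ _ (h2 ξ η c2.1 c2.2))
    have c3 : ‖ξ‖ ≤ ‖η‖ ∧ ‖ξ‖ ≤ ‖ξ - η‖ := by
      rw [not_and_or, not_le, not_le] at c1 c2
      constructor
      · rcases c1 with c1 | c1 <;> rcases c2 with c2 | c2 <;> linarith
      · rcases c1 with c1 | c1 <;> rcases c2 with c2 | c2 <;> linarith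
    · refine le_trans ?_ le_add_self
      rw [triTerm, if_pos c3]
      refine le_trans (le_of_eq (by ring)) (key _ _ _ (h3 ξ η c3.1 c3.2))

lemma le_sqrt_mul_sqrt_of_le {x y z : ℝ} (hx : 0 ≤ x) (h1 : x ≤ y) (h2 : x ≤ z) :
    x ≤ 1 * (y ^ (1 / 2 : ℝ) * z ^ (1 / 2 : ℝ)) := by
  rw [one_mul, ← Real.mul_rpow (hx.trans h1) (hx.trans h2), ← Real.sqrt_eq_rpow]
  exact Real.le_sqrt_of_sq_le (by nlinarith)

/-- The weighted energy `∫ w² |f|²`. -/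
def energy (w : Plane → ℝ) (f : Plane → ℂ) : ℝ≥0∞ :=
  ∫⁻ ξ, (ENNReal.ofReal (w ξ) * ‖f ξ‖ₑ) ^ 2

lemma energy_mono {w w' : Plane → ℝ} (h : ∀ ξ, w ξ ≤ w' ξ) (f : Plane → ℂ) :
    energy w f ≤ energy w' f := by
  refine lintegral_mono fun ξ => ?_
  gcongr
  exact h ξ

/-- The absolute trilinear integral is controlled by Sobolev energies of order `3/4`. -/
lemma lintegral_kernel_le : ∃ K : ℝ≥0∞, K ≠ ⊤ ∧ ∀ f : Plane → ℂ, Measurable f →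
    (∀ᵐ p, ‖f (-p)‖ₑ = ‖f p‖ₑ) →
    ∫⁻ ξ, ∫⁻ η, ENNReal.ofReal |kernel ξ η| * (‖f η‖ₑ * ‖f (ξ - η)‖ₑ * ‖f ξ‖ₑ) ≤
      K * energy (fun p => ‖p‖ ^ (1 / 2 : ℝ)) f ^ (1 / 2 : ℝ) *
        energy (fun p => ‖p‖ ^ (3 / 4 : ℝ)) f := by
  -- The kernel is dominated by the geometric mean of the two larger frequencies, which puts 1/2
  -- derivative on each. With a = 1/2 the estimate adds (1−a)/2 = 1/4 to these and asks for 1/2 on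
  -- the smallest. All resulting orders are below 1 ≤ 2−γ.
  obtain ⟨K, hK, h⟩ := tri_le_critical (a := 1 / 2) (by norm_num) (by norm_num)
  refine ⟨3 * K, ENNReal.mul_ne_top (by norm_num) hK, fun f hf hfe => ?_⟩
  have hF : Measurable fun p => ‖f p‖ₑ := hf.enorm
  have h1 := lintegral_trilinear_le (F := fun p => ‖f p‖ₑ) hF hfe (a := fun _ => 1)
    (b := fun p => ‖p‖ ^ (1 / 2 : ℝ)) (c := fun ξ η => |kernel ξ η|) measurable_const
    (by fun_prop) (fun _ => zero_le_one) (fun p => by positivity) (fun p => by simp)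
    (fun ξ η _ _ => by
      rw [one_mul, ← Real.mul_rpow (by positivity) (by positivity), ← Real.sqrt_eq_rpow]
      refine Real.le_sqrt_of_sq_le ?_
      rw [sq]
      exact mul_le_mul (abs_kernel_le_norm_sub ξ η) (abs_kernel_le ξ η) (abs_nonneg _)
        (norm_nonneg _))
    (fun ξ η h1 h2 => (abs_kernel_le_norm_sub ξ η).trans
      (le_sqrt_mul_sqrt_of_le (norm_nonneg _) h1 h2))
    (fun ξ η h1 h2 => (abs_kernel_le ξ η).trans
      (le_sqrt_mul_sqrt_of_le (norm_nonneg _) h1 h2))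
  refine h1.trans ?_
  rw [mul_assoc, mul_assoc]
  gcongr 3 * ?_
  refine (h _ _ (measurable_const.mul hF) ((by fun_prop : Measurable fun p : Plane =>
    ENNReal.ofReal (‖p‖ ^ (1 / 2 : ℝ))).mul hF)).trans (le_of_eq ?_)
  rw [mul_assoc]
  congr 2
  · congr 1
    unfold energy
    congr 1 with m
    simp
  · unfold energy
    congr 1 with p
    simp only [Pi.mul_apply]
    rw [← mul_assoc, ← ENNReal.ofReal_mul (by positivity),
      ← Real.rpow_add_of_nonneg (norm_nonneg p) (by norm_num) (by norm_num)]
    norm_num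

/-- The constant in the pointwise commutator bound. -/
def commConst (s : ℝ) : ℝ := 2 * s * 2 ^ s

/-- Cauchy–Schwarz on a ball: the low frequencies of the gradient have an integrable transform,
controlled by the L² norm alone. -/
lemma lintegral_low_le (f : Plane → ℂ) (hf : Measurable f) {c R : ℝ} (hc : 0 ≤ c) :
    ∫⁻ p, (Metric.ball (0 : Plane) R).indicator
        (fun p => ENNReal.ofReal (c * ‖p‖) * ‖f p‖ₑ) p ≤
      ENNReal.ofReal (c * R) * volume (Metric.ball (0 : Plane) R) ^ (1 / 2 : ℝ) *
        energy (fun _ => 1) f ^ (1 / 2 : ℝ) := by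
  have hb : MeasurableSet (Metric.ball (0 : Plane) R) := Metric.isOpen_ball.measurableSet
  have hi : Measurable ((Metric.ball (0 : Plane) R).indicator fun _ => (1 : ℝ≥0∞)) :=
    measurable_const.indicator hb
  calc ∫⁻ p, (Metric.ball (0 : Plane) R).indicator
        (fun p => ENNReal.ofReal (c * ‖p‖) * ‖f p‖ₑ) p
      ≤ ∫⁻ p, ENNReal.ofReal (c * R) *
          ((Metric.ball (0 : Plane) R).indicator (fun _ => 1) p * ‖f p‖ₑ) := by
        refine lintegral_mono fun p => ?_
        by_cases hp : p ∈ Metric.ball (0 : Plane) R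
        · rw [indicator_of_mem hp, indicator_of_mem hp, one_mul]
          gcongr
          exact (mem_ball_zero_iff.1 hp).le
        · rw [indicator_of_notMem hp]; exact zero_le
    _ = ENNReal.ofReal (c * R) *
          ∫⁻ p, (Metric.ball (0 : Plane) R).indicator (fun _ => 1) p * ‖f p‖ₑ :=
        lintegral_const_mul _ (hi.mul hf.enorm)
    _ ≤ ENNReal.ofReal (c * R) * (volume (Metric.ball (0 : Plane) R) ^ (1 / 2 : ℝ) *
        energy (fun _ => 1) f ^ (1 / 2 : ℝ)) := by
        gcongr ENNReal.ofReal (c * R) * ?_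
        refine (lintegral_mul_le_sqrt volume hi.aemeasurable
          hf.enorm.aemeasurable).trans (le_of_eq ?_)
        congr 2
        · have : ∀ p, (Metric.ball (0 : Plane) R).indicator (fun _ => (1 : ℝ≥0∞)) p ^ 2 =
              (Metric.ball (0 : Plane) R).indicator (fun _ => 1) p := by
            intro p
            by_cases hp : p ∈ Metric.ball (0 : Plane) R <;> simp [hp]
          simp only [this]
          rw [lintegral_indicator hb]; simp
        · unfold energy; simp
    _ = _ := by ring

open Classical in
/-- The weight `|ξ|^σ` restricted to `|ξ| ≥ R`. -/
def highWeight (σ R : ℝ) (ξ : Plane) : ℝ := if R ≤ ‖ξ‖ then ‖ξ‖ ^ σ else 0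

/-- The commutator estimate at the critical regularity. -/
lemma lintegral_commSymbol_le {γ : ℝ} (hγ : γ ∈ Ioc (0 : ℝ) 1) {s : ℝ} (hs : 1 ≤ s) :
    ∃ K : ℝ≥0∞, K ≠ ⊤ ∧ ∀ R : ℝ, ∃ L : ℝ≥0∞, L ≠ ⊤ ∧ ∀ N : ℝ, 0 < N →
    ∀ f : Plane → ℂ, Measurable f → (∀ᵐ p, ‖f (-p)‖ₑ = ‖f p‖ₑ) →
    ∫⁻ ξ, ∫⁻ η, ENNReal.ofReal (commSymbol N s ξ η) * (‖f η‖ₑ * ‖f (ξ - η)‖ₑ * ‖f ξ‖ₑ) ≤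
      K * energy (highWeight (2 - γ) R) f ^ (1 / 2 : ℝ) *
          energy (fun p => ‖p‖ ^ (γ / 2) * trunc N p ^ s) f +
        L * energy (fun _ => 1) f ^ (1 / 2 : ℝ) * energy (fun p => trunc N p ^ s) f := by
  -- With a = 1−γ, the derivative already present in A raises its order to the critical 2−γ, and B
  -- receives the γ/2 of the dissipation. The conditions 0 ≤ a < 1 are exactly γ ∈ (0,1].
  obtain ⟨K, hK, h⟩ := tri_le_critical (a := 1 - γ) (by linarith [hγ.2]) (by linarith [hγ.1])
  have hC : 0 ≤ commConst s := by unfold commConst; positivity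
  refine ⟨3 * (K * ENNReal.ofReal (commConst s)), by finiteness, fun R => ?_⟩
  refine ⟨3 * (ENNReal.ofReal (commConst s * R) *
    volume (Metric.ball (0 : Plane) R) ^ (1 / 2 : ℝ)), ?_, fun N hN f hf hfe => ?_⟩
  · refine ENNReal.mul_ne_top (by norm_num) (ENNReal.mul_ne_top ENNReal.ofReal_ne_top
      (ENNReal.rpow_ne_top_of_nonneg (by norm_num) measure_ball_lt_top.ne))
  have hF : Measurable fun p => ‖f p‖ₑ := hf.enorm
  have htm : Measurable fun p => trunc N p ^ s := (measurable_trunc N).pow_const s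
  have hB : Measurable fun p => ENNReal.ofReal (trunc N p ^ s) * ‖f p‖ₑ :=
    htm.ennreal_ofReal.mul hF
  have h1 := lintegral_trilinear_le (F := fun p => ‖f p‖ₑ) hF hfe
    (a := fun p => commConst s * ‖p‖) (b := fun p => trunc N p ^ s) (c := commSymbol N s)
    (by fun_prop) htm (fun p => by positivity)
    (fun p => Real.rpow_nonneg (trunc_nonneg hN.le p) s) (fun p => by rw [trunc_neg])
    (fun ξ η h1 h2 => (commSymbol_le_low hN hs h1 h2).trans
      (le_of_eq (by rw [commConst]; ring)))
    (fun ξ η h1 h2 => (commSymbol_le_mid hN hs h1 h2).trans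
      (le_of_eq (by rw [commConst]; ring)))
    (fun ξ η h1 h2 => (commSymbol_le_high hN hs h1 h2).trans
      (le_of_eq (by rw [commConst]; ring)))
  set A : Plane → ℝ≥0∞ := fun p => ENNReal.ofReal (commConst s * ‖p‖) * ‖f p‖ₑ with hA
  have hAm : Measurable A := by simp only [hA]; fun_prop
  have hb : MeasurableSet (Metric.ball (0 : Plane) R) := Metric.isOpen_ball.measurableSet
  -- Only the lowest-frequency factor is split at radius R. The high part uses the critical bound
  -- with K independent of R; the low part uses the L¹ bound and puts all dependence on R into L.
  have hsplit : A = fun p => (Metric.ball (0 : Plane) R).indicator A p +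
      (Metric.ball (0 : Plane) R)ᶜ.indicator A p := by
    ext p; exact (indicator_self_add_compl_apply _ A p).symm
  have hlow := (tri_le_lintegral_mul (hAm.indicator hb) hB).trans
    (mul_le_mul_left (lintegral_low_le f hf (R := R) hC) _)
  have hhigh := h _ _ (hAm.indicator hb.compl) hB
  have e1 : ∫⁻ m, (ENNReal.ofReal (‖m‖ ^ (1 - γ)) *
      (Metric.ball (0 : Plane) R)ᶜ.indicator A m) ^ 2 =
      ENNReal.ofReal (commConst s) ^ 2 * energy (highWeight (2 - γ) R) f := by
    unfold energy
    have hm : Measurable fun ξ : Plane =>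
        (ENNReal.ofReal (highWeight (2 - γ) R ξ) * ‖f ξ‖ₑ) ^ 2 := by
      have : Measurable (highWeight (2 - γ) R) := by
        unfold highWeight
        exact Measurable.ite (measurableSet_le measurable_const measurable_norm) (by fun_prop)
          measurable_const
      exact (this.ennreal_ofReal.mul hF).pow_const 2
    rw [← lintegral_const_mul _ hm]
    congr 1 with m
    rw [← mul_pow]
    congr 1
    by_cases hm : R ≤ ‖m‖
    · rw [indicator_of_mem (by simpa using hm), highWeight, if_pos hm, hA]
      have e : ‖m‖ ^ (2 - γ) = ‖m‖ ^ (1 - γ) * ‖m‖ := by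
        rw [show (2 - γ) = (1 - γ) + 1 by ring, Real.rpow_add_of_nonneg (norm_nonneg _)
          (by linarith [hγ.2]) zero_le_one, Real.rpow_one]
      simp only
      rw [e, ENNReal.ofReal_mul hC, ENNReal.ofReal_mul (by positivity)]
      ring
    · rw [indicator_of_notMem (by simpa using lt_of_not_ge hm), highWeight, if_neg hm]
      simp
  have e2 : ∫⁻ p, (ENNReal.ofReal (‖p‖ ^ ((1 - (1 - γ)) / 2)) *
      (ENNReal.ofReal (trunc N p ^ s) * ‖f p‖ₑ)) ^ 2 =
      energy (fun p => ‖p‖ ^ (γ / 2) * trunc N p ^ s) f := by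
    unfold energy
    congr 1 with p
    rw [show (1 - (1 - γ)) / 2 = γ / 2 by ring, ENNReal.ofReal_mul (by positivity), mul_assoc]
  rw [e1, e2, ENNReal.mul_rpow_of_nonneg _ _ (by norm_num), ← ENNReal.rpow_natCast_mul] at hhigh
  norm_num at hhigh
  refine h1.trans ?_
  rw [hsplit, tri_add_left (hAm.indicator hb) hB, mul_add, add_comm]
  refine add_le_add ?_ ?_
  · refine (mul_le_mul_right hhigh 3).trans (le_of_eq ?_)
    norm_num
    ring
  · refine (mul_le_mul_right hlow 3).trans (le_of_eq ?_)
    unfold energy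
    ring

/-! ### The energy identity at a fixed time -/

/-- The trilinear integrand of the energy identity. -/
def triIntegrand (f : Plane → ℂ) (x : Plane × Plane) : ℂ :=
  (kernel x.1 x.2 : ℂ) * f x.2 * f (x.1 - x.2) * conj (f x.1)

lemma enorm_triIntegrand (f : Plane → ℂ) (ξ η : Plane) :
    ‖triIntegrand f (ξ, η)‖ₑ =
      ENNReal.ofReal |kernel ξ η| * (‖f η‖ₑ * ‖f (ξ - η)‖ₑ * ‖f ξ‖ₑ) := by
  have h1 : ‖(kernel ξ η : ℂ)‖ₑ = ENNReal.ofReal |kernel ξ η| := by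
    rw [← ofReal_norm, Complex.norm_real, Real.norm_eq_abs]
  have h2 : ‖conj (f ξ)‖ₑ = ‖f ξ‖ₑ := by
    rw [← ofReal_norm, RCLike.norm_conj, ofReal_norm]
  simp only [triIntegrand, enorm_mul, h1, h2]
  ring

lemma measurable_triIntegrand {f : Plane → ℂ} (hf : Measurable f) :
    Measurable (triIntegrand f) := by
  unfold triIntegrand
  exact (((Complex.measurable_ofReal.comp measurable_kernel).mul (hf.comp measurable_snd)).mul
    (hf.comp (measurable_fst.sub measurable_snd))).mul
    (Complex.continuous_conj.measurable.comp (hf.comp measurable_fst))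

lemma measurable_Lp (f : L2C) : Measurable f := (Lp.stronglyMeasurable f).measurable

lemma integrable_triIntegrand {f : Plane → ℂ} (hf : Measurable f)
    (hk : ∫⁻ ξ, ∫⁻ η, ENNReal.ofReal |kernel ξ η| * (‖f η‖ₑ * ‖f (ξ - η)‖ₑ * ‖f ξ‖ₑ) < ⊤) :
    Integrable (triIntegrand f) (volume.prod volume) := by
  refine ⟨(measurable_triIntegrand hf).aestronglyMeasurable, ?_⟩
  rw [HasFiniteIntegral, lintegral_prod _ (measurable_triIntegrand hf).enorm.aemeasurable]
  simpa only [enorm_triIntegrand] using hk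

lemma integral_triIntegrand (f : Plane → ℂ) (ξ : Plane) :
    ∫ η, triIntegrand f (ξ, η) = nonlin f f ξ * conj (f ξ) := by
  simp only [triIntegrand, nonlin, integral_mul_const]

/-- The substitution exchanges ξ and ξ−η up to sign, and Hermitian symmetry restores the conjugates.
The kernel is odd, so the integrand changes sign: this is skew-symmetry of transport by a
divergence-free field. -/
lemma triIntegrand_reflect {f : Plane → ℂ} {ξ η : Plane} (h1 : f (-ξ) = conj (f ξ))
    (h2 : f (-(ξ - η)) = conj (f (ξ - η))) :
    triIntegrand f (η - ξ, η) = -triIntegrand f (ξ, η) := by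
  have h3 : kernel (η - ξ) η = -kernel ξ η := by
    rw [← neg_sub, kernel_neg_left, kernel_sub_left]
  simp only [triIntegrand, h3]
  rw [show η - ξ - η = -ξ by abel, h1, show η - ξ = -(ξ - η) by abel, h2, Complex.conj_conj]
  push_cast; ring

/-- Symmetrization of the trilinear term of the energy identity. -/
lemma enorm_two_mul_integral_nonlin_le {f : Plane → ℂ} (hf : Measurable f)
    (hherm : ∀ᵐ ξ, f (-ξ) = conj (f ξ))
    (hk : ∫⁻ ξ, ∫⁻ η, ENNReal.ofReal |kernel ξ η| * (‖f η‖ₑ * ‖f (ξ - η)‖ₑ * ‖f ξ‖ₑ) < ⊤)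
    {W : Plane → ℝ} (hW : Measurable W) (hWe : ∀ ξ, W (-ξ) = W ξ) {C : ℝ}
    (hWC : ∀ ξ, ‖W ξ‖ ≤ C) :
    ‖2 * ∫ ξ, (W ξ : ℂ) * (nonlin f f ξ * conj (f ξ))‖ₑ ≤
      ∫⁻ ξ, ∫⁻ η, ENNReal.ofReal (|W ξ - W (ξ - η)| * |kernel ξ η|) *
        (‖f η‖ₑ * ‖f (ξ - η)‖ₑ * ‖f ξ‖ₑ) := by
  have hint := integrable_triIntegrand hf hk
  have hWm : Measurable fun ξ => (W ξ : ℂ) := Complex.measurable_ofReal.comp hW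
  have hW1 : Measurable fun x : Plane × Plane => (W x.1 : ℂ) := hWm.comp measurable_fst
  have hW2 : Measurable fun x : Plane × Plane => (W (x.1 - x.2) : ℂ) :=
    hWm.comp (measurable_fst.sub measurable_snd)
  have i1 : Integrable (fun x : Plane × Plane => (W x.1 : ℂ) * triIntegrand f x)
      (volume.prod volume) :=
    hint.bdd_mul (c := C) hW1.aestronglyMeasurable
      (Eventually.of_forall fun x => by simpa using hWC x.1)
  have i2 : Integrable (fun x : Plane × Plane => -((W (x.1 - x.2) : ℂ) * triIntegrand f x))
      (volume.prod volume) :=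
    (hint.bdd_mul (c := C) hW2.aestronglyMeasurable
      (Eventually.of_forall fun x => by simpa using hWC (x.1 - x.2))).neg
  have e1 : ∫ ξ, (W ξ : ℂ) * (nonlin f f ξ * conj (f ξ)) =
      ∫ x : Plane × Plane, (W x.1 : ℂ) * triIntegrand f x ∂(volume.prod volume) := by
    rw [integral_prod _ i1]
    congr 1 with ξ
    change _ = ∫ y, (W ξ : ℂ) * triIntegrand f (ξ, y)
    rw [integral_const_mul, integral_triIntegrand]
  -- For fixed η the reflection ξ ↦ η−ξ is measure preserving. The integrand is odd under it, while
  -- W(ξ) turns into W(ξ−η) by evenness.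
  have e2 : ∫ x : Plane × Plane, (W x.1 : ℂ) * triIntegrand f x ∂(volume.prod volume) =
      ∫ x : Plane × Plane, -((W (x.1 - x.2) : ℂ) * triIntegrand f x) ∂(volume.prod volume) := by
    rw [integral_prod_symm _ i1, integral_prod_symm _ i2]
    congr 1 with η
    rw [← integral_sub_left_eq_self (fun ξ => (W ξ : ℂ) * triIntegrand f (ξ, η)) volume η]
    apply integral_congr_ae
    have h2 := (measurePreserving_sub_right (volume : Measure Plane) η
      ).quasiMeasurePreserving.ae hherm
    filter_upwards [hherm, h2] with ξ h3 h4
    rw [triIntegrand_reflect h3 h4, ← neg_sub ξ η, hWe]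
    ring
  have e3 : 2 * ∫ ξ, (W ξ : ℂ) * (nonlin f f ξ * conj (f ξ)) =
      ∫ x : Plane × Plane, ((W x.1 - W (x.1 - x.2) : ℝ) : ℂ) * triIntegrand f x
        ∂(volume.prod volume) := by
    rw [two_mul]
    nth_rewrite 2 [e1]
    rw [e1, e2, ← e2]
    nth_rewrite 2 [e2]
    rw [← integral_add i1 i2]
    congr 1 with x
    push_cast; ring
  rw [e3]
  refine (enorm_integral_le_lintegral_enorm _).trans (le_of_eq ?_)
  have hm : Measurable fun x : Plane × Plane =>
      ((W x.1 - W (x.1 - x.2) : ℝ) : ℂ) * triIntegrand f x := by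
    simp only [Complex.ofReal_sub]
    exact (hW1.sub hW2).mul (measurable_triIntegrand hf)
  rw [lintegral_prod _ hm.enorm.aemeasurable]
  congr 1 with ξ
  congr 1 with η
  rw [enorm_mul, enorm_triIntegrand, ENNReal.ofReal_mul (abs_nonneg _), ← mul_assoc]
  congr 2
  rw [← ofReal_norm, Complex.norm_real, Real.norm_eq_abs]

lemma enorm_reflect_of_hermitian {f : Plane → ℂ} (hherm : ∀ᵐ ξ, f (-ξ) = conj (f ξ)) :
    ∀ᵐ ξ, ‖f (-ξ)‖ₑ = ‖f ξ‖ₑ := by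
  filter_upwards [hherm] with ξ h
  rw [h, ← ofReal_norm, RCLike.norm_conj, ofReal_norm]

/-- The weight `min(|ξ|, N)^{2s}` is bounded. -/
lemma norm_trunc_rpow_le {N s : ℝ} (hN : 0 < N) (hs : 0 ≤ s) (ξ : Plane) :
    ‖trunc N ξ ^ s‖ ≤ N ^ s := by
  rw [Real.norm_of_nonneg (Real.rpow_nonneg (trunc_nonneg hN.le _) _)]
  exact Real.rpow_le_rpow (trunc_nonneg hN.le _) (min_le_right _ _) hs

/-- The integrand `W conj f ∂ₜf` of the energy identity. -/
def energyIntegrand (γ N s : ℝ) (f : Plane → ℂ) (ξ : Plane) : ℂ :=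
  ((trunc N ξ ^ (2 * s) : ℝ) : ℂ) * (fourierRhs γ f ξ * conj (f ξ))

lemma lapSymbol_eq {γ : ℝ} (ξ : Plane) :
    lapSymbol γ ξ = (2 * Real.pi) ^ γ * (‖ξ‖ ^ (γ / 2)) ^ 2 := by
  rw [lapSymbol, Real.mul_rpow (by positivity) (norm_nonneg _),
    ← Real.rpow_mul_natCast (norm_nonneg _)]
  congr 2; push_cast; ring

lemma integrable_of_energy {w : Plane → ℝ} (hw : Measurable w) (hw0 : ∀ ξ, 0 ≤ w ξ)
    {f : Plane → ℂ} (hf : Measurable f) (h : energy w f < ⊤) :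
    Integrable (fun ξ => w ξ ^ 2 * ‖f ξ‖ ^ 2) volume ∧
      ∫ ξ, w ξ ^ 2 * ‖f ξ‖ ^ 2 = (energy w f).toReal := by
  have e : energy w f = ∫⁻ ξ, ENNReal.ofReal (w ξ ^ 2 * ‖f ξ‖ ^ 2) := by
    unfold energy
    congr 1 with ξ
    rw [← mul_pow, ENNReal.ofReal_pow (mul_nonneg (hw0 ξ) (norm_nonneg _)),
      ENNReal.ofReal_mul (hw0 ξ), ofReal_norm]
  have hm : AEStronglyMeasurable (fun ξ => w ξ ^ 2 * ‖f ξ‖ ^ 2) volume :=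
    ((hw.pow_const 2).mul (hf.norm.pow_const 2)).aestronglyMeasurable
  have h0 : ∀ ξ, 0 ≤ w ξ ^ 2 * ‖f ξ‖ ^ 2 := fun ξ => by positivity
  refine ⟨⟨hm, ?_⟩, ?_⟩
  · rw [hasFiniteIntegral_iff_ofReal (Eventually.of_forall h0), ← e]; exact h
  · rw [integral_eq_lintegral_of_nonneg_ae (Eventually.of_forall h0) hm, e]

/-- Integrability of the integrand of the energy identity, with a bound that is uniform on
bounded sets of `H^{3/4}`. -/
lemma energyIntegrand_bound {γ : ℝ} {N s : ℝ} (hN : 0 < N)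
    (hs : 0 ≤ s) : ∃ K : ℝ≥0∞, K ≠ ⊤ ∧ ∀ f : Plane → ℂ, Measurable f →
      (∀ᵐ ξ, f (-ξ) = conj (f ξ)) →
      ∫⁻ ξ, ‖energyIntegrand γ N s f ξ‖ₑ ≤
        K * (energy (fun p => ‖p‖ ^ (1 / 2 : ℝ)) f ^ (1 / 2 : ℝ) *
          energy (fun p => ‖p‖ ^ (3 / 4 : ℝ)) f + energy (fun p => ‖p‖ ^ (γ / 2)) f) := by
  obtain ⟨K, hK, h⟩ := lintegral_kernel_le
  set c := ENNReal.ofReal (N ^ (2 * s)) with hc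
  set d := ENNReal.ofReal ((2 * Real.pi) ^ γ) with hd
  set e := ENNReal.ofReal (2 * Real.pi) with he
  refine ⟨c * (e * K + d), by finiteness, fun f hf hherm => ?_⟩
  have h1 := h f hf (enorm_reflect_of_hermitian hherm)
  have hmn : AEMeasurable (fun ξ => ‖nonlin f f ξ * conj (f ξ)‖ₑ) volume :=
    ((aestronglyMeasurable_nonlin hf.aestronglyMeasurable hf.aestronglyMeasurable).mul
      (Complex.continuous_conj.measurable.comp hf).aestronglyMeasurable).enorm
  have hme : Measurable fun ξ => (ENNReal.ofReal (‖ξ‖ ^ (γ / 2)) * ‖f ξ‖ₑ) ^ 2 := by fun_prop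
  calc ∫⁻ ξ, ‖energyIntegrand γ N s f ξ‖ₑ
      ≤ ∫⁻ ξ, c * (e * ‖nonlin f f ξ * conj (f ξ)‖ₑ +
          d * (ENNReal.ofReal (‖ξ‖ ^ (γ / 2)) * ‖f ξ‖ₑ) ^ 2) := by
        refine lintegral_mono fun ξ => ?_
        have h2 : ‖conj (f ξ)‖ₑ = ‖f ξ‖ₑ := by
          rw [← ofReal_norm, RCLike.norm_conj, ofReal_norm]
        rw [energyIntegrand, enorm_mul]
        refine mul_le_mul' ?_ ?_
        · rw [← ofReal_norm, Complex.norm_real]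
          exact ENNReal.ofReal_le_ofReal (norm_trunc_rpow_le hN (by linarith) ξ)
        · have h3 : fourierRhs γ f ξ * conj (f ξ) =
              ((2 * Real.pi : ℝ) : ℂ) * (nonlin f f ξ * conj (f ξ)) -
                ((lapSymbol γ ξ : ℝ) : ℂ) * (f ξ * conj (f ξ)) := by
            rw [fourierRhs]; push_cast; ring
          rw [h3]
          refine (enorm_sub_le).trans (add_le_add ?_ ?_)
          · rw [enorm_mul, ← ofReal_norm, Complex.norm_real,
              Real.norm_of_nonneg (by positivity)]
          · rw [enorm_mul, enorm_mul, h2, ← ofReal_norm, Complex.norm_real,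
              Real.norm_of_nonneg (lapSymbol_nonneg γ ξ), lapSymbol_eq,
              ENNReal.ofReal_mul (by positivity), ENNReal.ofReal_pow (by positivity), mul_pow]
            exact le_of_eq (by ring)
    _ = c * (e * (∫⁻ ξ, ‖nonlin f f ξ * conj (f ξ)‖ₑ) +
          d * energy (fun p => ‖p‖ ^ (γ / 2)) f) := by
        rw [lintegral_const_mul' _ _ ENNReal.ofReal_ne_top, lintegral_add_right _
          (hme.const_mul d), lintegral_const_mul' _ _ ENNReal.ofReal_ne_top,
          lintegral_const_mul' _ _ ENNReal.ofReal_ne_top]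
        rfl
    _ ≤ c * (e * (K * energy (fun p => ‖p‖ ^ (1 / 2 : ℝ)) f ^ (1 / 2 : ℝ) *
          energy (fun p => ‖p‖ ^ (3 / 4 : ℝ)) f) + d * energy (fun p => ‖p‖ ^ (γ / 2)) f) := by
        gcongr
        refine le_trans (lintegral_mono fun ξ => ?_) h1
        rw [← integral_triIntegrand]
        refine (enorm_integral_le_lintegral_enorm _).trans (le_of_eq ?_)
        simp only [enorm_triIntegrand]
    _ ≤ _ := by
        set x := energy (fun p => ‖p‖ ^ (1 / 2 : ℝ)) f ^ (1 / 2 : ℝ) *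
          energy (fun p => ‖p‖ ^ (3 / 4 : ℝ)) f with hx
        set y := energy (fun p => ‖p‖ ^ (γ / 2)) f
        rw [mul_assoc K, ← hx, mul_assoc c]
        gcongr c * ?_
        calc e * (K * x) + d * y ≤ e * (K * x) + d * y + (e * K * y + d * x) := le_self_add
          _ = (e * K + d) * (x + y) := by ring

lemma aestronglyMeasurable_energyIntegrand (γ N s : ℝ) {f : Plane → ℂ} (hf : Measurable f) :
    AEStronglyMeasurable (energyIntegrand γ N s f) volume := by
  have h1 : Measurable fun ξ => ((trunc N ξ ^ (2 * s) : ℝ) : ℂ) :=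
    Complex.measurable_ofReal.comp ((measurable_trunc N).pow_const _)
  refine h1.aestronglyMeasurable.mul (AEStronglyMeasurable.mul ?_
    (Complex.continuous_conj.measurable.comp hf).aestronglyMeasurable)
  exact ((aestronglyMeasurable_nonlin hf.aestronglyMeasurable
    hf.aestronglyMeasurable).const_mul _).sub
    ((Complex.measurable_ofReal.comp (measurable_lapSymbol γ)).mul hf).aestronglyMeasurable

/-- The fixed-time energy inequality. -/
lemma re_integral_energyIntegrand_le {γ : ℝ} (hγ : γ ∈ Ioc (0 : ℝ) 1) {s : ℝ} (hs : 1 ≤ s) :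
    ∃ K : ℝ≥0∞, K ≠ ⊤ ∧ ∀ R : ℝ, ∃ L : ℝ≥0∞, L ≠ ⊤ ∧ ∀ N : ℝ, 0 < N →
    ∀ f : Plane → ℂ, Measurable f → (∀ᵐ ξ, f (-ξ) = conj (f ξ)) →
    energy (fun _ => 1) f < ⊤ → energy (fun p => ‖p‖ ^ (1 / 2 : ℝ)) f < ⊤ →
    energy (fun p => ‖p‖ ^ (3 / 4 : ℝ)) f < ⊤ → energy (fun p => ‖p‖ ^ (γ / 2)) f < ⊤ →
    K * energy (highWeight (2 - γ) R) f ^ (1 / 2 : ℝ) ≤ 1 →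
    2 * (∫ ξ, energyIntegrand γ N s f ξ).re ≤
      (L * energy (fun _ => 1) f ^ (1 / 2 : ℝ)).toReal *
          (energy (fun p => trunc N p ^ s) f).toReal -
        (energy (fun p => ‖p‖ ^ (γ / 2) * trunc N p ^ s) f).toReal := by
  obtain ⟨K, hK, h⟩ := lintegral_commSymbol_le hγ hs
  refine ⟨ENNReal.ofReal (2 * Real.pi) * K, by finiteness, fun R => ?_⟩
  obtain ⟨L, hL, h⟩ := h R
  refine ⟨ENNReal.ofReal (2 * Real.pi) * L, by finiteness,
    fun N hN f hf hherm f1 f2 f3 f4 hsmall => ?_⟩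
  have h := h N hN f hf (enorm_reflect_of_hermitian hherm)
  obtain ⟨K₂, hK₂, hk⟩ := lintegral_kernel_le
  have hk := hk f hf (enorm_reflect_of_hermitian hherm)
  have hkt : ∫⁻ ξ, ∫⁻ η, ENNReal.ofReal |kernel ξ η| * (‖f η‖ₑ * ‖f (ξ - η)‖ₑ * ‖f ξ‖ₑ) < ⊤ :=
    lt_of_le_of_lt hk (by finiteness)
  set W : Plane → ℝ := fun ξ => trunc N ξ ^ (2 * s) with hW
  have hWm : Measurable W := (measurable_trunc N).pow_const _
  have hWC : ∀ ξ, ‖W ξ‖ ≤ N ^ (2 * s) := norm_trunc_rpow_le hN (by linarith)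
  have h2 := (enorm_two_mul_integral_nonlin_le hf hherm hkt hWm
    (fun ξ => by simp only [hW, trunc_neg]) hWC).trans h
  set E := energy (fun p => trunc N p ^ s) f with hE
  set D := energy (fun p => ‖p‖ ^ (γ / 2) * trunc N p ^ s) f with hD
  set I := ∫ ξ, (W ξ : ℂ) * (nonlin f f ξ * conj (f ξ)) with hI
  have htr0 : ∀ ξ, 0 ≤ trunc N ξ ^ s := fun ξ => Real.rpow_nonneg (trunc_nonneg hN.le ξ) s
  have htrN : ∀ ξ, ENNReal.ofReal (trunc N ξ ^ s) ≤ ENNReal.ofReal (N ^ s) := fun ξ =>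
    ENNReal.ofReal_le_ofReal ((le_abs_self _).trans (norm_trunc_rpow_le hN (by linarith) ξ))
  have hEt : E < ⊤ := by
    refine lt_of_le_of_lt ?_ (ENNReal.mul_lt_top (ENNReal.ofReal_lt_top
      (r := (N ^ s) ^ 2)) f1)
    rw [hE, energy, energy, ← lintegral_const_mul' _ _ ENNReal.ofReal_ne_top]
    refine lintegral_mono fun ξ => ?_
    rw [ENNReal.ofReal_pow (by positivity), ← mul_pow]
    rw [ENNReal.ofReal_one, one_mul]
    exact pow_le_pow_left' (mul_le_mul' (htrN ξ) le_rfl) 2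
  have hDt : D < ⊤ := by
    refine lt_of_le_of_lt ?_ (ENNReal.mul_lt_top (ENNReal.ofReal_lt_top
      (r := (N ^ s) ^ 2)) f4)
    rw [hD, energy, energy, ← lintegral_const_mul' _ _ ENNReal.ofReal_ne_top]
    refine lintegral_mono fun ξ => ?_
    rw [ENNReal.ofReal_pow (by positivity), ← mul_pow, ← mul_assoc, mul_comm (‖ξ‖ ^ (γ / 2)),
      ENNReal.ofReal_mul (htr0 ξ)]
    exact pow_le_pow_left' (mul_le_mul' (mul_le_mul' (htrN ξ) le_rfl) le_rfl) 2
  obtain ⟨iD, eD⟩ := integrable_of_energy (w := fun p => ‖p‖ ^ (γ / 2) * trunc N p ^ s)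
    (by have := measurable_trunc N; fun_prop) (fun p => mul_nonneg (by positivity) (htr0 p)) hf hDt
  have iI : Integrable (fun ξ => (W ξ : ℂ) * (nonlin f f ξ * conj (f ξ))) volume := by
    have := (integrable_triIntegrand hf hkt).integral_prod_left
    simp only [integral_triIntegrand] at this
    exact this.bdd_mul (c := N ^ (2 * s))
      (Complex.measurable_ofReal.comp hWm).aestronglyMeasurable
      (Eventually.of_forall fun ξ => by simpa using hWC ξ)
  have key : ∫ ξ, energyIntegrand γ N s f ξ =
      ((2 * Real.pi : ℝ) : ℂ) * I - (((2 * Real.pi) ^ γ * D.toReal : ℝ) : ℂ) := by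
    have eD' : (((2 * Real.pi) ^ γ * D.toReal : ℝ) : ℂ) = ∫ ξ, (((2 * Real.pi) ^ γ *
        ((‖ξ‖ ^ (γ / 2) * trunc N ξ ^ s) ^ 2 * ‖f ξ‖ ^ 2) : ℝ) : ℂ) := by
      rw [integral_complex_ofReal, integral_const_mul, eD]
    have iD' : Integrable (fun ξ => (((2 * Real.pi) ^ γ *
        ((‖ξ‖ ^ (γ / 2) * trunc N ξ ^ s) ^ 2 * ‖f ξ‖ ^ 2) : ℝ) : ℂ)) volume :=
      (iD.const_mul _).ofReal
    rw [eD', hI, ← integral_const_mul, ← integral_sub (iI.const_mul _) iD']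
    congr 1 with ξ
    have e1 : (W ξ : ℂ) = ((trunc N ξ ^ s : ℝ) : ℂ) ^ 2 := by
      rw [← Complex.ofReal_pow, ← Real.rpow_mul_natCast (trunc_nonneg hN.le ξ), hW]
      simp only
      congr 2; push_cast; ring
    have e2 : f ξ * conj (f ξ) = ((‖f ξ‖ : ℝ) : ℂ) ^ 2 := by
      rw [Complex.mul_conj, Complex.normSq_eq_norm_sq]; push_cast; rfl
    have e3 : energyIntegrand γ N s f ξ = ((2 * Real.pi : ℝ) : ℂ) *
        ((W ξ : ℂ) * (nonlin f f ξ * conj (f ξ))) -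
          (W ξ : ℂ) * (lapSymbol γ ξ : ℂ) * (f ξ * conj (f ξ)) := by
      simp only [energyIntegrand, fourierRhs, hW]; push_cast; ring
    rw [e3, e2, e1, lapSymbol_eq]
    push_cast
    ring
  rw [key, Complex.sub_re, Complex.ofReal_re, Complex.re_ofReal_mul]
  -- Twice the linear term gives 2(2π)^γ D ≥ 2D. By the smallness hypothesis the nonlinear term
  -- consumes at most one D, so one full D remains on the good side.
  have hπ : (1 : ℝ) ≤ (2 * Real.pi) ^ γ :=
    Real.one_le_rpow (by nlinarith [Real.pi_gt_three]) hγ.1.le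
  have hD0 : 0 ≤ D.toReal := ENNReal.toReal_nonneg
  have hI2 : 2 * Real.pi * (2 * I).re ≤ D.toReal +
      (ENNReal.ofReal (2 * Real.pi) * L * energy (fun _ => 1) f ^ (1 / 2 : ℝ)).toReal *
        E.toReal := by
    have h3 : ENNReal.ofReal (2 * Real.pi) * ‖2 * I‖ₑ ≤ D +
        ENNReal.ofReal (2 * Real.pi) * L * energy (fun _ => 1) f ^ (1 / 2 : ℝ) * E := by
      calc ENNReal.ofReal (2 * Real.pi) * ‖2 * I‖ₑ
          ≤ ENNReal.ofReal (2 * Real.pi) *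
            (K * energy (highWeight (2 - γ) R) f ^ (1 / 2 : ℝ) * D +
              L * energy (fun _ => 1) f ^ (1 / 2 : ℝ) * E) := by gcongr
        _ = (ENNReal.ofReal (2 * Real.pi) * K *
              energy (highWeight (2 - γ) R) f ^ (1 / 2 : ℝ)) * D +
            ENNReal.ofReal (2 * Real.pi) * L * energy (fun _ => 1) f ^ (1 / 2 : ℝ) * E := by
            ring
        _ ≤ _ := by gcongr; exact mul_le_of_le_one_left zero_le hsmall
    have h4 := ENNReal.toReal_mono (by finiteness) h3
    rw [ENNReal.toReal_add hDt.ne (by finiteness), ENNReal.toReal_mul, ENNReal.toReal_mul,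
      ENNReal.toReal_ofReal (by positivity), toReal_enorm] at h4
    refine le_trans ?_ h4
    gcongr
    exact Complex.re_le_norm _
  have h5 : (2 * I).re = 2 * I.re := by simp
  rw [h5] at hI2
  nlinarith

/-! ### Energies of square integrable functions -/

lemma energy_congr {f g : Plane → ℂ} {w w' : Plane → ℝ}
    (h : ∀ᵐ ξ, ENNReal.ofReal (w ξ) * ‖f ξ‖ₑ = ENNReal.ofReal (w' ξ) * ‖g ξ‖ₑ) :
    energy w f = energy w' g := by
  refine lintegral_congr_ae ?_
  filter_upwards [h] with ξ hξ
  rw [hξ]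

lemma ofReal_mul_enorm {w : ℝ} (hw : 0 ≤ w) (z : ℂ) :
    ENNReal.ofReal w * ‖z‖ₑ = ‖(w : ℂ) * z‖ₑ := by
  rw [enorm_mul, ← ofReal_norm (w : ℂ), Complex.norm_real, Real.norm_of_nonneg hw]

lemma lintegral_enorm_sq (g : Plane → ℂ) : ∫⁻ ξ, ‖g ξ‖ₑ ^ 2 = eLpNorm g 2 volume ^ 2 := by
  have h := eLpNorm_nnreal_pow_eq_lintegral (μ := volume) (f := g) (p := 2) (by norm_num)
  simp only [NNReal.coe_ofNat, ENNReal.rpow_ofNat, ENNReal.coe_ofNat] at h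
  exact h.symm

lemma energy_eq_eLpNorm {w : Plane → ℝ} (hw : ∀ ξ, 0 ≤ w ξ) (f : Plane → ℂ) :
    energy w f = eLpNorm (fun ξ => (w ξ : ℂ) * f ξ) 2 volume ^ 2 := by
  rw [← lintegral_enorm_sq, energy]
  simp only [ofReal_mul_enorm (hw _)]

lemma energy_eq_enorm {w : Plane → ℝ} (hw : ∀ ξ, 0 ≤ w ξ) {f : Plane → ℂ} {g : L2C}
    (hg : g =ᵐ[volume] fun ξ => (w ξ : ℂ) * f ξ) : energy w f = ‖g‖ₑ ^ 2 := by
  rw [energy_eq_eLpNorm hw, Lp.enorm_def, eLpNorm_congr_ae hg]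

lemma energy_one (f : L2C) : energy (fun _ => 1) f = ‖f‖ₑ ^ 2 :=
  energy_eq_enorm (fun _ => zero_le_one) (by simp)

lemma memLp_of_energy {w : Plane → ℝ} (hwm : Measurable w) (hw : ∀ ξ, 0 ≤ w ξ) {f : Plane → ℂ}
    (hf : Measurable f) (h : energy w f < ⊤) :
    MemLp (fun ξ => (w ξ : ℂ) * f ξ) 2 volume := by
  refine ⟨((Complex.measurable_ofReal.comp hwm).mul hf).aestronglyMeasurable, ?_⟩
  rw [energy_eq_eLpNorm hw] at h
  by_contra h2
  rw [not_lt_top_iff.1 h2] at h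
  simp at h

lemma energy_rpow_le {σ s : ℝ} (hσ : 0 ≤ σ) (hs : σ ≤ s) {f : Plane → ℂ} (hf : Measurable f) :
    energy (fun ξ => ‖ξ‖ ^ σ) f ≤ energy (fun _ => 1) f + energy (fun ξ => ‖ξ‖ ^ s) f := by
  unfold energy
  rw [← lintegral_add_right _ (by fun_prop)]
  refine lintegral_mono fun ξ => ?_
  rcases le_total ‖ξ‖ 1 with h | h
  · refine le_trans ?_ le_self_add
    gcongr
    exact Real.rpow_le_one (norm_nonneg _) h hσ
  · refine le_trans ?_ le_add_self
    gcongr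
    exact Real.rpow_le_rpow_of_exponent_le h hs

lemma energy_le_const_mul {w w' : Plane → ℝ} {c : ℝ} (hc : 0 ≤ c) (h : ∀ ξ, w ξ ≤ c * w' ξ)
    (f : Plane → ℂ) : energy w f ≤ ENNReal.ofReal (c ^ 2) * energy w' f := by
  unfold energy
  rw [← lintegral_const_mul' _ _ ENNReal.ofReal_ne_top]
  refine lintegral_mono fun ξ => ?_
  rw [ENNReal.ofReal_pow hc, ← mul_pow, ← mul_assoc, ← ENNReal.ofReal_mul hc]
  gcongr
  exact h ξ

lemma energy_eq_iSup {w : ℕ → Plane → ℝ} {W : Plane → ℝ} (hwm : ∀ n, Measurable (w n))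
    (hmono : ∀ ξ, Monotone fun n => w n ξ) (hle : ∀ n ξ, w n ξ ≤ W ξ)
    (heq : ∀ ξ, ∃ n, w n ξ = W ξ) {f : Plane → ℂ} (hf : Measurable f) :
    energy W f = ⨆ n, energy (w n) f := by
  unfold energy
  rw [← lintegral_iSup (fun n => by have := hwm n; fun_prop)]
  · refine lintegral_congr fun ξ => le_antisymm ?_ (iSup_le fun n => ?_)
    · obtain ⟨n, hn⟩ := heq ξ
      rw [← hn]
      exact le_iSup (fun n => (ENNReal.ofReal (w n ξ) * ‖f ξ‖ₑ) ^ 2) n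
    · gcongr; exact hle n ξ
  · intro n m hnm ξ
    dsimp only
    gcongr
    exact hmono ξ hnm

lemma boundedSymbol_ofReal {w : Plane → ℝ} (hwm : Measurable w) {C : ℝ}
    (hC : ∀ ξ, ‖w ξ‖ ≤ C) : BoundedSymbol fun ξ => (w ξ : ℂ) :=
  ⟨Complex.measurable_ofReal.comp hwm, C, fun ξ => by simpa using hC ξ⟩

lemma energy_eq_enorm_mulOp {w : Plane → ℝ} (hw : ∀ ξ, 0 ≤ w ξ)
    (hb : BoundedSymbol fun ξ => (w ξ : ℂ)) (f : L2C) : energy w f = ‖mulOp _ hb f‖ₑ ^ 2 :=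
  energy_eq_enorm hw (coeFn_mulOp hb f)

/-- For unbounded w the energy need not be continuous in t, but it is a countable supremum of
energies with bounded weights min(w, n), each continuous in t. -/
lemma aemeasurable_energy {w : Plane → ℝ} (hwm : Measurable w) (hw : ∀ ξ, 0 ≤ w ξ)
    {f : ℝ → L2C} {S : Set ℝ} (hS : MeasurableSet S) (hf : ContinuousOn f S) :
    AEMeasurable (fun t => energy w (f t)) (volume.restrict S) := by
  have hm (n : ℕ) : Measurable fun ξ => min (w ξ) n := hwm.min measurable_const
  have h0 (n : ℕ) (ξ : Plane) : 0 ≤ min (w ξ) n := le_min (hw ξ) n.cast_nonneg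
  have h (t : ℝ) : energy w (f t) = ⨆ n : ℕ, energy (fun ξ => min (w ξ) n) (f t) := by
    refine energy_eq_iSup hm (fun ξ n m hnm => min_le_min_left _ (by exact_mod_cast hnm))
      (fun n ξ => min_le_left _ _) (fun ξ => ?_) (measurable_Lp _)
    obtain ⟨n, hn⟩ := exists_nat_ge (w ξ)
    exact ⟨n, min_eq_left hn⟩
  simp only [h]
  refine AEMeasurable.iSup fun n => ?_
  have hb : BoundedSymbol fun ξ => ((min (w ξ) n : ℝ) : ℂ) :=
    boundedSymbol_ofReal (hm n) (C := n) fun ξ => by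
      rw [Real.norm_of_nonneg (h0 n ξ)]; exact min_le_right _ _
  simp only [energy_eq_enorm_mulOp (h0 n) hb]
  have hc : ContinuousOn (fun t => ‖mulOp _ hb (f t)‖) S :=
    ((mulOp _ hb).continuous.comp_continuousOn hf).norm
  simp only [← ofReal_norm]
  exact ((hc.aemeasurable hS).ennreal_ofReal).pow_const 2

/-! ### Uniform smallness of the tails -/

/-- The indicator of `{|ξ| ≥ R}`. -/
def tailCut (R : ℝ) (ξ : Plane) : ℝ := if R ≤ ‖ξ‖ then 1 else 0

lemma tailCut_nonneg (R : ℝ) (ξ : Plane) : 0 ≤ tailCut R ξ := by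
  unfold tailCut; split_ifs <;> norm_num

lemma tailCut_le_one (R : ℝ) (ξ : Plane) : tailCut R ξ ≤ 1 := by
  unfold tailCut; split_ifs <;> norm_num

lemma tailCut_anti {R R' : ℝ} (h : R ≤ R') (ξ : Plane) : tailCut R' ξ ≤ tailCut R ξ := by
  unfold tailCut; split_ifs with h1 h2 <;> linarith

lemma measurable_tailCut (R : ℝ) : Measurable (tailCut R) :=
  Measurable.ite (measurableSet_le measurable_const measurable_norm) measurable_const
    measurable_const

lemma boundedSymbol_tailCut (R : ℝ) : BoundedSymbol fun ξ => (tailCut R ξ : ℂ) :=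
  boundedSymbol_ofReal (measurable_tailCut R) (C := 1) fun ξ => by
    rw [Real.norm_of_nonneg (tailCut_nonneg R ξ)]; exact tailCut_le_one R ξ

lemma tendsto_energy_tailCut (f : L2C) :
    Tendsto (fun n : ℕ => energy (tailCut n) f) atTop (𝓝 0) := by
  have hfin : ∫⁻ ξ, ‖f ξ‖ₑ ^ 2 ≠ ⊤ := by
    rw [lintegral_enorm_sq]; exact ENNReal.pow_ne_top (Lp.eLpNorm_ne_top f)
  have h := tendsto_lintegral_of_dominated_convergence (μ := volume)
    (F := fun (n : ℕ) ξ => (ENNReal.ofReal (tailCut n ξ) * ‖f ξ‖ₑ) ^ 2) (f := fun _ => 0)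
    (fun ξ => ‖f ξ‖ₑ ^ 2)
    (fun n => by have := measurable_tailCut n; have := measurable_Lp f; fun_prop)
    (fun n => Eventually.of_forall fun ξ => by
      dsimp only
      gcongr
      exact mul_le_of_le_one_left zero_le (ENNReal.ofReal_le_one.2 (tailCut_le_one _ _)))
    hfin (Eventually.of_forall fun ξ => ?_)
  · simpa [energy] using h
  · refine tendsto_const_nhds.congr' ?_
    obtain ⟨m, hm⟩ := exists_nat_gt ‖ξ‖
    filter_upwards [eventually_ge_atTop m] with n hn
    have : ¬ (n : ℝ) ≤ ‖ξ‖ := not_le.2 (hm.trans_le (by exact_mod_cast hn))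
    simp [tailCut, this]

/-- Dini's theorem: the tail norms are continuous in t, decrease in the cutoff radius and tend to 0
pointwise, hence uniformly on the compact set. -/
lemma exists_tail_le {G : ℝ → L2C} {S : Set ℝ} (hS : IsCompact S) (hG : ContinuousOn G S)
    {ε : ℝ} (hε : 0 < ε) :
    ∃ R : ℝ, ∀ t ∈ S, energy (tailCut R) (G t) ^ (1 / 2 : ℝ) ≤ ENNReal.ofReal ε := by
  set F : ℕ → ℝ → ℝ := fun n t => ‖mulOp _ (boundedSymbol_tailCut n) (G t)‖ with hF
  have hE (n : ℕ) (t : ℝ) : energy (tailCut n) (G t) ^ (1 / 2 : ℝ) = ENNReal.ofReal (F n t) := by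
    rw [energy_eq_enorm_mulOp (tailCut_nonneg n) (boundedSymbol_tailCut n), ofReal_norm,
      ← ENNReal.rpow_natCast, ← ENNReal.rpow_mul]
    norm_num
  have h := Antitone.tendstoUniformlyOn_of_forall_tendsto (F := F) (f := fun _ => 0) hS
    (fun n => ((mulOp _ (boundedSymbol_tailCut n)).continuous.comp_continuousOn hG).norm)
    (fun t _ n m hnm => by
      refine (ENNReal.ofReal_le_ofReal_iff (norm_nonneg _)).1 ?_
      rw [← hE, ← hE]
      gcongr
      exact energy_mono (tailCut_anti (by exact_mod_cast hnm)) _)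
    continuousOn_const
    (fun t _ => by
      have h1 := ((tendsto_energy_tailCut (G t)).ennrpow_const (1 / 2 : ℝ))
      simp only [hE] at h1
      rw [ENNReal.zero_rpow_of_pos (by norm_num)] at h1
      have h2 := (ENNReal.tendsto_toReal ENNReal.zero_ne_top).comp h1
      refine h2.congr fun n => ?_
      simp [hF])
  rw [Metric.tendstoUniformlyOn_iff] at h
  obtain ⟨n, hn⟩ := (h ε hε).exists
  refine ⟨n, fun t ht => ?_⟩
  rw [hE]
  have h3 := hn t ht
  rw [dist_comm, Real.dist_0_eq_abs] at h3
  exact ENNReal.ofReal_le_ofReal ((le_abs_self _).trans h3.le)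

/-! ### Solutions on the Fourier side -/

/-- The Fourier transform of a solution in the critical class. -/
structure FourierSolution {γ : ℝ} (hγ : γ ∈ Ioc (0 : ℝ) 1) (T : ℝ) (f : ℝ → L2C) : Prop where
  continuousOn : ContinuousOn f (Icc 0 T)
  hermitian : ∀ t, ∀ᵐ ξ, f t (-ξ) = conj (f t ξ)
  critical : ∃ G : ℝ → L2C, ContinuousOn G (Icc 0 T) ∧
    ∀ t ∈ Icc 0 T, G t =ᵐ[volume] fun ξ => ((‖ξ‖ ^ (2 - γ) : ℝ) : ℂ) * f t ξ
  dissipation : ∫⁻ t in Ioo 0 T, energy (fun ξ => ‖ξ‖ ^ (2 - γ / 2)) (f t) < ⊤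
  equation : ∀ t ∈ Icc 0 T, mulOp _ (boundedSymbol_wtInv 3) (f t) -
    mulOp _ (boundedSymbol_wtInv 3) (f 0) = ∫ s in (0 : ℝ)..t, rhs hγ 0 (f s)

namespace FourierSolution

variable {γ : ℝ} {hγ : γ ∈ Ioc (0 : ℝ) 1} {T : ℝ} {f : ℝ → L2C}

lemma exists_energy_le (h : FourierSolution hγ T f) : ∃ B : ℝ≥0∞, B ≠ ⊤ ∧
    ∀ t ∈ Icc 0 T, energy (fun _ => 1) (f t) ≤ B ∧
      ∀ σ : ℝ, 0 ≤ σ → σ ≤ 2 - γ → energy (fun ξ => ‖ξ‖ ^ σ) (f t) ≤ B := by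
  obtain ⟨G, hGc, hG⟩ := h.critical
  obtain ⟨C, hC⟩ := isCompact_Icc.exists_bound_of_continuousOn h.continuousOn
  obtain ⟨D, hD⟩ := isCompact_Icc.exists_bound_of_continuousOn hGc
  have key {g : L2C} {c : ℝ} (hg : ‖g‖ ≤ c) : ‖g‖ₑ ^ 2 ≤ ENNReal.ofReal c ^ 2 := by
    rw [← ofReal_norm]; gcongr
  refine ⟨ENNReal.ofReal C ^ 2 + ENNReal.ofReal D ^ 2, by finiteness, fun t ht => ?_⟩
  have h1 : energy (fun _ => 1) (f t) ≤ ENNReal.ofReal C ^ 2 := by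
    rw [energy_one]; exact key (hC t ht)
  refine ⟨h1.trans le_self_add, fun σ h0 hσ => (energy_rpow_le h0 hσ (measurable_Lp _)).trans
    (add_le_add h1 ?_)⟩
  rw [energy_eq_enorm (fun ξ => by positivity) (hG t ht)]
  exact key (hD t ht)

/-- This gives the smallness that a critical estimate cannot produce by itself. It rests on
continuity in time with values in the critical space. -/
lemma exists_highWeight_le (h : FourierSolution hγ T f) {ε : ℝ} (hε : 0 < ε) :
    ∃ R : ℝ, ∀ t ∈ Icc 0 T,
      energy (highWeight (2 - γ) R) (f t) ^ (1 / 2 : ℝ) ≤ ENNReal.ofReal ε := by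
  obtain ⟨G, hGc, hG⟩ := h.critical
  obtain ⟨R, hR⟩ := exists_tail_le isCompact_Icc hGc hε
  refine ⟨R, fun t ht => le_trans (le_of_eq ?_) (hR t ht)⟩
  congr 1
  refine energy_congr ?_
  filter_upwards [hG t ht] with ξ hξ
  rw [hξ, ← ofReal_mul_enorm (by positivity), highWeight, tailCut]
  split_ifs <;> simp

/-- The weighted solution is differentiable in time. -/
lemma hasDerivAt (h : FourierSolution hγ T f) {t : ℝ} (ht : t ∈ Ioo 0 T) :
    HasDerivAt (fun s => mulOp _ (boundedSymbol_wtInv 3) (f s)) (rhs hγ 0 (f t)) t := by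
  have hrc : ContinuousOn (fun s => rhs hγ 0 (f s)) (Icc 0 T) :=
    (contDiff_rhs hγ 0 (k := 0)).continuous.comp_continuousOn h.continuousOn
  have hri : IntervalIntegrable (fun s => rhs hγ 0 (f s)) volume 0 t := by
    apply ContinuousOn.intervalIntegrable
    rw [uIcc_of_le ht.1.le]
    exact hrc.mono (Icc_subset_Icc_right ht.2.le)
  have hnhds : Icc 0 T ∈ 𝓝 t := Icc_mem_nhds ht.1 ht.2
  have hd := intervalIntegral.integral_hasDerivAt_right hri
    ((hrc.mono Ioo_subset_Icc_self).stronglyMeasurableAtFilter isOpen_Ioo t ht) (hrc.continuousAt hnhds)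
  refine (hd.add_const (mulOp _ (boundedSymbol_wtInv 3) (f 0))).congr_of_eventuallyEq ?_
  filter_upwards [hnhds] with s hs
  rw [← h.equation s hs, sub_add_cancel]

end FourierSolution

/-! ### The energy identity in time -/

/-- The weight `min(|ξ|, N)^s` cut off to `{|ξ| ≤ M}`. -/
def cutWeight (N s M : ℝ) (ξ : Plane) : ℝ := if ‖ξ‖ ≤ M then trunc N ξ ^ s else 0

lemma cutWeight_nonneg {N : ℝ} (hN : 0 ≤ N) (s M : ℝ) (ξ : Plane) : 0 ≤ cutWeight N s M ξ := by
  unfold cutWeight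
  split_ifs
  exacts [Real.rpow_nonneg (trunc_nonneg hN ξ) s, le_rfl]

lemma measurable_cutWeight (N s M : ℝ) : Measurable (cutWeight N s M) :=
  Measurable.ite (measurableSet_le measurable_norm measurable_const)
    ((measurable_trunc N).pow_const s) measurable_const

lemma cutWeight_le {N : ℝ} (hN : 0 ≤ N) (s M : ℝ) (ξ : Plane) :
    cutWeight N s M ξ ≤ trunc N ξ ^ s := by
  unfold cutWeight
  split_ifs
  exacts [le_rfl, Real.rpow_nonneg (trunc_nonneg hN ξ) s]

lemma norm_cutWeight_le {N s : ℝ} (hN : 0 < N) (hs : 0 ≤ s) (M : ℝ) (ξ : Plane) :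
    ‖cutWeight N s M ξ‖ ≤ N ^ s := by
  rw [Real.norm_of_nonneg (cutWeight_nonneg hN.le s M ξ)]
  exact (cutWeight_le hN.le s M ξ).trans
    ((le_abs_self _).trans (norm_trunc_rpow_le hN hs ξ))

lemma boundedSymbol_cutWeight {N s : ℝ} (hN : 0 < N) (hs : 0 ≤ s) (M : ℝ) :
    BoundedSymbol fun ξ => (cutWeight N s M ξ : ℂ) :=
  boundedSymbol_ofReal (measurable_cutWeight N s M) (norm_cutWeight_le hN hs M)

lemma boundedSymbol_cutWeight_mul {N s : ℝ} (hN : 0 < N) (hs : 0 ≤ s) (M : ℝ) :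
    BoundedSymbol fun ξ => ((cutWeight N s M ξ * wt ξ ^ 3 : ℝ) : ℂ) := by
  refine boundedSymbol_ofReal ((measurable_cutWeight N s M).mul
    (continuous_wt.pow 3).measurable) (C := N ^ s * (1 + |M|) ^ 3) fun ξ => ?_
  have hw := wt_pos ξ
  rw [norm_mul, Real.norm_of_nonneg (by positivity : 0 ≤ wt ξ ^ 3)]
  by_cases h : ‖ξ‖ ≤ M
  · have h1 : wt ξ ≤ 1 + |M| := by unfold wt; linarith [le_abs_self M]
    have h2 := norm_cutWeight_le hN hs M ξ
    gcongr
  · simp only [cutWeight, h, if_false, norm_zero, zero_mul]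
    positivity

/-- On |ξ| ≤ M the factor (1+|ξ|)^{−3} can be undone by a bounded operator. Thus the cut-off
solution inherits time differentiability in L² from the weighted equation. -/
lemma mulOp_cutWeight_eq {N s : ℝ} (hN : 0 < N) (hs : 0 ≤ s) (M : ℝ) (f : L2C) :
    mulOp _ (boundedSymbol_cutWeight hN hs M) f =
      mulOp _ (boundedSymbol_cutWeight_mul hN hs M) (mulOp _ (boundedSymbol_wtInv 3) f) := by
  apply Lp.ext
  filter_upwards [coeFn_mulOp (boundedSymbol_cutWeight hN hs M) f,
    coeFn_mulOp (boundedSymbol_cutWeight_mul hN hs M) (mulOp _ (boundedSymbol_wtInv 3) f),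
    coeFn_mulOp (boundedSymbol_wtInv 3) f] with ξ h1 h2 h3
  rw [h1, h2, h3, Complex.ofReal_mul]
  linear_combination (-(cutWeight N s M ξ : ℂ) * f ξ) * wt_pow_mul_wtInv 3 ξ

lemma inner_mulOp_cutWeight {γ : ℝ} (hγ : γ ∈ Ioc (0 : ℝ) 1) {N s : ℝ} (hN : 0 < N)
    (hs : 0 ≤ s) (M : ℝ) (f : L2C) :
    inner ℂ (mulOp _ (boundedSymbol_cutWeight hN hs M) f)
      (mulOp _ (boundedSymbol_cutWeight_mul hN hs M) (rhs hγ 0 f)) =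
      ∫ ξ in {ξ : Plane | ‖ξ‖ ≤ M}, energyIntegrand γ N s f ξ := by
  rw [L2.inner_def, ← integral_indicator (measurableSet_le measurable_norm measurable_const)]
  apply integral_congr_ae
  filter_upwards [coeFn_mulOp (boundedSymbol_cutWeight hN hs M) f,
    coeFn_mulOp (boundedSymbol_cutWeight_mul hN hs M) (rhs hγ 0 f),
    coeFn_rhs_zero hγ f] with ξ h1 h2 h3
  rw [h1, h2, h3, RCLike.inner_apply, map_mul, Complex.conj_ofReal, Complex.ofReal_mul]
  by_cases h : ‖ξ‖ ≤ M
  · rw [indicator_of_mem (by exact h), energyIntegrand, cutWeight, if_pos h]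
    have e1 : ((trunc N ξ ^ (2 * s) : ℝ) : ℂ) = ((trunc N ξ ^ s : ℝ) : ℂ) ^ 2 := by
      rw [← Complex.ofReal_pow, ← Real.rpow_mul_natCast (trunc_nonneg hN.le ξ)]
      congr 2; push_cast; ring
    rw [e1]
    linear_combination (((trunc N ξ ^ s : ℝ) : ℂ) ^ 2 * (fourierRhs γ f ξ * conj (f ξ))) *
      wt_pow_mul_wtInv 3 ξ
  · rw [indicator_of_notMem (by exact h), cutWeight, if_neg h]
    simp

lemma energy_toReal_eq_re_inner {w : Plane → ℝ} (hw : ∀ ξ, 0 ≤ w ξ)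
    (hb : BoundedSymbol fun ξ => (w ξ : ℂ)) (f : L2C) :
    (energy w f).toReal = (inner ℂ (mulOp _ hb f) (mulOp _ hb f)).re := by
  rw [energy_eq_enorm_mulOp hw hb, ENNReal.toReal_pow, toReal_enorm]
  exact (inner_self_eq_norm_sq (𝕜 := ℂ) (mulOp _ hb f)).symm

namespace FourierSolution

variable {γ : ℝ} {hγ : γ ∈ Ioc (0 : ℝ) 1} {T : ℝ} {f : ℝ → L2C}

/-- After the cutoff, τ^{k+1} times the squared norm is differentiable and the fundamental theorem
of calculus applies. The exponent is at least 1, so there is no boundary term at τ = 0. -/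
lemma energy_identity_cut (h : FourierSolution hγ T f) {N s : ℝ} (hN : 0 < N) (hs : 0 ≤ s)
    (M : ℝ) (k : ℕ) {t : ℝ} (ht : t ∈ Icc 0 T) :
    ContinuousOn (fun τ => (energy (cutWeight N s M) (f τ)).toReal) (Icc 0 T) ∧
    ContinuousOn (fun τ => (∫ ξ in {ξ : Plane | ‖ξ‖ ≤ M}, energyIntegrand γ N s (f τ) ξ).re)
      (Icc 0 T) ∧
    t ^ (k + 1) * (energy (cutWeight N s M) (f t)).toReal =
      ∫ τ in (0 : ℝ)..t, ((k + 1) * τ ^ k * (energy (cutWeight N s M) (f τ)).toReal +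
        τ ^ (k + 1) *
          (2 * (∫ ξ in {ξ : Plane | ‖ξ‖ ≤ M}, energyIntegrand γ N s (f τ) ξ).re)) := by
  have hb := boundedSymbol_cutWeight hN hs M
  have hb3 := boundedSymbol_cutWeight_mul hN hs M
  simp only [energy_toReal_eq_re_inner (cutWeight_nonneg hN.le s M) hb,
    ← inner_mulOp_cutWeight hγ hN hs M]
  have hYc : ContinuousOn (fun τ => mulOp _ hb (f τ)) (Icc 0 T) :=
    (mulOp _ hb).continuous.comp_continuousOn h.continuousOn
  have hZc : ContinuousOn (fun τ => mulOp _ hb3 (rhs hγ 0 (f τ))) (Icc 0 T) :=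
    (mulOp _ hb3).continuous.comp_continuousOn
      ((contDiff_rhs hγ 0 (k := 0)).continuous.comp_continuousOn h.continuousOn)
  have c1 : ContinuousOn (fun τ => (inner ℂ (mulOp _ hb (f τ)) (mulOp _ hb (f τ))).re)
      (Icc 0 T) := Complex.continuous_re.comp_continuousOn (hYc.inner hYc)
  have c2 : ContinuousOn (fun τ => (inner ℂ (mulOp _ hb (f τ))
      (mulOp _ hb3 (rhs hγ 0 (f τ)))).re) (Icc 0 T) :=
    Complex.continuous_re.comp_continuousOn (hYc.inner hZc)
  refine ⟨c1, c2, ?_⟩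
  have hsub : Icc 0 t ⊆ Icc 0 T := Icc_subset_Icc_right ht.2
  rw [intervalIntegral.integral_eq_sub_of_hasDerivAt_of_le ht.1
    (f := fun τ => τ ^ (k + 1) * (inner ℂ (mulOp _ hb (f τ)) (mulOp _ hb (f τ))).re)]
  · simp
  · exact (continuous_pow (k + 1)).continuousOn.mul (c1.mono hsub)
  · intro τ hτ
    have hd : HasDerivAt (fun τ => mulOp _ hb (f τ)) (mulOp _ hb3 (rhs hγ 0 (f τ))) τ := by
      simp only [mulOp_cutWeight_eq hN hs M]
      exact ((mulOp _ hb3).restrictScalars ℝ).hasFDerivAt.comp_hasDerivAt τ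
        (h.hasDerivAt ⟨hτ.1, hτ.2.trans_le ht.2⟩)
    have hd2 := Complex.reCLM.hasFDerivAt.comp_hasDerivAt τ (hd.inner ℂ hd)
    have hd3 := (hasDerivAt_pow (k + 1) τ).mul hd2
    refine hd3.congr_deriv ?_
    simp only [Complex.reCLM_apply, Complex.add_re, Function.comp_apply]
    rw [← inner_conj_symm (mulOp _ hb3 (rhs hγ 0 (f τ))) (mulOp _ hb (f τ)), Complex.conj_re]
    push_cast
    ring
  · apply ContinuousOn.intervalIntegrable
    rw [uIcc_of_le ht.1]
    have := c1.mono hsub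
    have := c2.mono hsub
    fun_prop

end FourierSolution

/-! ### The energy inequality -/

lemma tendsto_energy_cutWeight {N : ℝ} (hN : 0 ≤ N) (s : ℝ) {f : Plane → ℂ} (hf : Measurable f) :
    Tendsto (fun n : ℕ => energy (cutWeight N s n) f) atTop
      (𝓝 (energy (fun ξ => trunc N ξ ^ s) f)) := by
  have hmono (ξ : Plane) : Monotone fun n : ℕ => cutWeight N s n ξ := by
    intro n m hnm
    have hnm' : (n : ℝ) ≤ m := by exact_mod_cast hnm
    simp only [cutWeight]
    split_ifs with h1 h2
    · exact le_rfl
    · exact absurd (h1.trans hnm') h2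
    · exact Real.rpow_nonneg (trunc_nonneg hN ξ) s
    · exact le_rfl
  rw [energy_eq_iSup (fun n : ℕ => measurable_cutWeight N s n) hmono
    (fun n ξ => cutWeight_le hN s n ξ) (fun ξ => ?_) hf]
  · exact tendsto_atTop_iSup fun n m hnm => energy_mono (fun ξ => hmono ξ hnm) f
  · obtain ⟨n, hn⟩ := exists_nat_ge ‖ξ‖
    exact ⟨n, if_pos hn⟩

lemma tendsto_setIntegral_norm_le {g : Plane → ℂ} (hg : Integrable g volume) :
    Tendsto (fun n : ℕ => ∫ ξ in {ξ : Plane | ‖ξ‖ ≤ n}, g ξ) atTop (𝓝 (∫ ξ, g ξ)) := by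
  have hU : (⋃ n : ℕ, {ξ : Plane | ‖ξ‖ ≤ n}) = univ :=
    eq_univ_of_forall fun ξ => mem_iUnion.2 (exists_nat_ge ‖ξ‖)
  have h := tendsto_setIntegral_of_monotone (μ := volume) (f := g)
    (s := fun n : ℕ => {ξ : Plane | ‖ξ‖ ≤ n})
    (fun n => measurableSet_le measurable_norm measurable_const)
    (fun n m hnm ξ hξ => le_trans (show ‖ξ‖ ≤ n from hξ) (by exact_mod_cast hnm))
    (by rw [hU]; exact hg.integrableOn)
  rwa [hU, setIntegral_univ] at h

lemma energy_trunc_le {N s : ℝ} (hN : 0 < N) (hs : 0 ≤ s) (w : Plane → ℝ) (hw : ∀ ξ, 0 ≤ w ξ)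
    (f : Plane → ℂ) : energy (fun ξ => w ξ * trunc N ξ ^ s) f ≤
      ENNReal.ofReal ((N ^ s) ^ 2) * energy w f := by
  refine energy_le_const_mul (by positivity) (fun ξ => ?_) f
  rw [mul_comm]
  exact mul_le_mul_of_nonneg_right ((le_abs_self _).trans (norm_trunc_rpow_le hN hs ξ)) (hw ξ)

lemma integrableOn_mul_of_bounded {p g : ℝ → ℝ} (hp : Continuous p) {t C : ℝ}
    (hg : AEStronglyMeasurable g (volume.restrict (Ioo 0 t)))
    (hC : ∀ τ ∈ Ioo 0 t, ‖g τ‖ ≤ C) : IntegrableOn (fun τ => p τ * g τ) (Ioo 0 t) volume := by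
  have h1 : IntegrableOn g (Ioo 0 t) volume :=
    IntegrableOn.of_bound measure_Ioo_lt_top hg C
      ((ae_restrict_iff' measurableSet_Ioo).2 (Eventually.of_forall hC))
  exact h1.continuousOn_mul_of_subset hp.continuousOn isCompact_Icc measurableSet_Ioo
    Ioo_subset_Icc_self

namespace FourierSolution

variable {γ : ℝ} {hγ : γ ∈ Ioc (0 : ℝ) 1} {T : ℝ} {f : ℝ → L2C}

/-- Uniform bounds for the terms of the energy identity. -/
lemma exists_energyIntegrand_le (h : FourierSolution hγ T f) {N s : ℝ} (hN : 0 < N)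
    (hs : 0 ≤ s) : ∃ C : ℝ, ∀ t ∈ Icc 0 T,
      Integrable (energyIntegrand γ N s (f t)) volume ∧
      ∫ ξ, ‖energyIntegrand γ N s (f t) ξ‖ ≤ C ∧
      energy (fun ξ => trunc N ξ ^ s) (f t) ≤ ENNReal.ofReal C ∧
      energy (fun ξ => ‖ξ‖ ^ (γ / 2) * trunc N ξ ^ s) (f t) ≤ ENNReal.ofReal C := by
  obtain ⟨B, hB, hE⟩ := h.exists_energy_le
  obtain ⟨K, hK, hb⟩ := energyIntegrand_bound (γ := γ) hN hs
  set A := K * (B ^ (1 / 2 : ℝ) * B + B) with hA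
  have hAt : A ≠ ⊤ := by finiteness
  have hc : ENNReal.ofReal ((N ^ s) ^ 2) * B ≠ ⊤ := by finiteness
  refine ⟨A.toReal + (ENNReal.ofReal ((N ^ s) ^ 2) * B).toReal, fun t ht => ?_⟩
  have hγ1 := hγ.1
  have hγ2 := hγ.2
  have h1 : ∫⁻ ξ, ‖energyIntegrand γ N s (f t) ξ‖ₑ ≤ A := by
    refine (hb (f t) (measurable_Lp _) (h.hermitian t)).trans ?_
    have e1 := (hE t ht).2 (1 / 2) (by norm_num) (by linarith)
    have e2 := (hE t ht).2 (3 / 4) (by norm_num) (by linarith)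
    have e3 := (hE t ht).2 (γ / 2) (by linarith) (by linarith)
    rw [hA]
    gcongr
  have hm := aestronglyMeasurable_energyIntegrand γ N s (measurable_Lp (f t))
  have hle : ENNReal.ofReal ((N ^ s) ^ 2) * B ≤
      ENNReal.ofReal (A.toReal + (ENNReal.ofReal ((N ^ s) ^ 2) * B).toReal) := by
    rw [ENNReal.ofReal_add ENNReal.toReal_nonneg ENNReal.toReal_nonneg,
      ENNReal.ofReal_toReal hc]
    exact le_add_self
  refine ⟨⟨hm, lt_of_le_of_lt h1 hAt.lt_top⟩, ?_, ?_, ?_⟩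
  · rw [integral_norm_eq_lintegral_enorm hm]
    exact (ENNReal.toReal_mono hAt h1).trans (le_add_of_nonneg_right ENNReal.toReal_nonneg)
  · refine le_trans ?_ hle
    have := energy_trunc_le hN hs (fun _ => 1) (fun _ => zero_le_one) (f t)
    simp only [one_mul] at this
    exact this.trans (mul_le_mul' le_rfl (hE t ht).1)
  · refine le_trans ?_ hle
    exact (energy_trunc_le hN hs (fun ξ => ‖ξ‖ ^ (γ / 2)) (fun ξ => by positivity) (f t)).trans
      (mul_le_mul' le_rfl ((hE t ht).2 (γ / 2) (by linarith) (by linarith)))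

/-- Dominated convergence as the cutoff radius tends to infinity with N fixed;
`exists_energyIntegrand_le` supplies bounds uniform in time. Without the cutoff the time integrand
is only known to be a limit of continuous ones, hence the measurability claim. -/
lemma energy_identity (h : FourierSolution hγ T f) {N s : ℝ} (hN : 0 < N) (hs : 0 ≤ s)
    (k : ℕ) {t : ℝ} (ht : t ∈ Icc 0 T) :
    AEStronglyMeasurable (fun τ => (∫ ξ, energyIntegrand γ N s (f τ) ξ).re)
      (volume.restrict (Ioo 0 t)) ∧
    t ^ (k + 1) * (energy (fun ξ => trunc N ξ ^ s) (f t)).toReal =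
      ∫ τ in Ioo 0 t, ((k + 1) * τ ^ k * (energy (fun ξ => trunc N ξ ^ s) (f τ)).toReal +
        τ ^ (k + 1) * (2 * (∫ ξ, energyIntegrand γ N s (f τ) ξ).re)) := by
  obtain ⟨C, hC⟩ := h.exists_energyIntegrand_le hN hs
  have hC0 : 0 ≤ C := (integral_nonneg fun ξ => norm_nonneg _).trans (hC t ht).2.1
  have hsub : Ioo 0 t ⊆ Icc 0 T := Ioo_subset_Icc_self.trans (Icc_subset_Icc_right ht.2)
  have lim1 (τ : ℝ) (hτ : τ ∈ Icc 0 T) :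
      Tendsto (fun n : ℕ => (energy (cutWeight N s n) (f τ)).toReal) atTop
        (𝓝 (energy (fun ξ => trunc N ξ ^ s) (f τ)).toReal) :=
    (ENNReal.tendsto_toReal
      (lt_of_le_of_lt (hC τ hτ).2.2.1 ENNReal.ofReal_lt_top).ne).comp
      (tendsto_energy_cutWeight hN.le s (measurable_Lp (f τ)))
  have lim2 (τ : ℝ) (hτ : τ ∈ Icc 0 T) :
      Tendsto (fun n : ℕ =>
        (∫ ξ in {ξ : Plane | ‖ξ‖ ≤ n}, energyIntegrand γ N s (f τ) ξ).re) atTop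
        (𝓝 (∫ ξ, energyIntegrand γ N s (f τ) ξ).re) :=
    (Complex.continuous_re.tendsto _).comp (tendsto_setIntegral_norm_le (hC τ hτ).1)
  have hid (n : ℕ) := h.energy_identity_cut hN hs n k ht
  have m2 (n : ℕ) : AEStronglyMeasurable (fun τ =>
      (∫ ξ in {ξ : Plane | ‖ξ‖ ≤ n}, energyIntegrand γ N s (f τ) ξ).re)
      (volume.restrict (Ioo 0 t)) :=
    ((hid n).2.1.mono hsub).aestronglyMeasurable measurableSet_Ioo
  have m1 (n : ℕ) : AEStronglyMeasurable (fun τ => (energy (cutWeight N s n) (f τ)).toReal)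
      (volume.restrict (Ioo 0 t)) :=
    ((hid n).1.mono hsub).aestronglyMeasurable measurableSet_Ioo
  refine ⟨aestronglyMeasurable_of_tendsto_ae atTop m2
    ((ae_restrict_iff' measurableSet_Ioo).2 (Eventually.of_forall fun τ hτ =>
      lim2 τ (hsub hτ))), ?_⟩
  have hL := (lim1 t ht).const_mul (t ^ (k + 1))
  refine tendsto_nhds_unique hL ?_
  have hrw (n : ℕ) : t ^ (k + 1) * (energy (cutWeight N s n) (f t)).toReal =
      ∫ τ in Ioo 0 t, ((k + 1) * τ ^ k * (energy (cutWeight N s n) (f τ)).toReal +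
        τ ^ (k + 1) *
          (2 * (∫ ξ in {ξ : Plane | ‖ξ‖ ≤ n}, energyIntegrand γ N s (f τ) ξ).re)) := by
    rw [(hid n).2.2, intervalIntegral.integral_of_le ht.1, integral_Ioc_eq_integral_Ioo]
  simp only [hrw]
  refine tendsto_integral_of_dominated_convergence
    (fun _ => (k + 1) * t ^ k * C + t ^ (k + 1) * (2 * C)) (fun n => ?_) ?_ (fun n => ?_) ?_
  · have c1 : Continuous fun τ : ℝ => ((k : ℝ) + 1) * τ ^ k := by fun_prop
    have c2 : Continuous fun τ : ℝ => τ ^ (k + 1) := by fun_prop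
    exact (c1.aestronglyMeasurable.mul (m1 n)).add
      (c2.aestronglyMeasurable.mul ((m2 n).const_mul 2))
  · exact integrable_const _
  · refine (ae_restrict_iff' measurableSet_Ioo).2 (Eventually.of_forall fun τ hτ => ?_)
    obtain ⟨i1, i2, i3, i4⟩ := hC τ (hsub hτ)
    have hτ0 : 0 ≤ τ := hτ.1.le
    have hτt : τ ≤ t := hτ.2.le
    have ht0 : 0 ≤ t := ht.1
    have b1 : (energy (cutWeight N s n) (f τ)).toReal ≤ C := by
      refine ENNReal.toReal_le_of_le_ofReal hC0 (le_trans ?_ i3)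
      exact energy_mono (cutWeight_le hN.le s n) _
    have b2 : |(∫ ξ in {ξ : Plane | ‖ξ‖ ≤ n}, energyIntegrand γ N s (f τ) ξ).re| ≤ C := by
      refine (Complex.abs_re_le_norm _).trans ((norm_integral_le_integral_norm _).trans ?_)
      exact (setIntegral_le_integral i1.norm (Eventually.of_forall fun _ => norm_nonneg _)).trans i2
    refine (norm_add_le _ _).trans (add_le_add ?_ ?_)
    · rw [Real.norm_of_nonneg (by positivity)]
      gcongr
    · rw [norm_mul, norm_mul, Real.norm_of_nonneg (by positivity : 0 ≤ τ ^ (k + 1)),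
        Real.norm_of_nonneg (by norm_num : (0 : ℝ) ≤ 2), Real.norm_eq_abs]
      gcongr
  · refine (ae_restrict_iff' measurableSet_Ioo).2 (Eventually.of_forall fun τ hτ => ?_)
    exact ((lim1 τ (hsub hτ)).const_mul _).add (((lim2 τ (hsub hτ)).const_mul 2).const_mul _)

/-- The energy inequality for the truncated weights, uniformly in the truncation. -/
lemma energy_inequality_trunc (h : FourierSolution hγ T f) {s : ℝ} (hs : 1 ≤ s) :
    ∃ K : ℝ, 0 ≤ K ∧ ∀ N : ℝ, 0 < N → ∀ k : ℕ, ∀ t ∈ Icc 0 T,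
      ENNReal.ofReal (t ^ (k + 1)) * energy (fun ξ => trunc N ξ ^ s) (f t) +
        ∫⁻ τ in Ioo 0 t, ENNReal.ofReal (τ ^ (k + 1)) *
          energy (fun ξ => ‖ξ‖ ^ (γ / 2) * trunc N ξ ^ s) (f τ) ≤
      ∫⁻ τ in Ioo 0 t, ENNReal.ofReal ((k + 1) * τ ^ k + K * τ ^ (k + 1)) *
        energy (fun ξ => trunc N ξ ^ s) (f τ) := by
  obtain ⟨B, hB, hE⟩ := h.exists_energy_le
  obtain ⟨K, hK, hineq⟩ := re_integral_energyIntegrand_le hγ hs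
  -- The tail is made at most 1/(K+1), so that K times it is at most 1; the added 1 covers K = 0. R
  -- is fixed before N and k, so the final constant depends on neither.
  obtain ⟨R, hR⟩ := h.exists_highWeight_le (ε := (K.toReal + 1)⁻¹)
    (by have := ENNReal.toReal_nonneg (a := K); positivity)
  obtain ⟨L, hL, hineq⟩ := hineq R
  have hLB : L * B ^ (1 / 2 : ℝ) ≠ ⊤ := by finiteness
  refine ⟨(L * B ^ (1 / 2 : ℝ)).toReal, ENNReal.toReal_nonneg, fun N hN k t ht => ?_⟩
  have hs0 : 0 ≤ s := by linarith
  have hγ1 := hγ.1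
  have hγ2 := hγ.2
  obtain ⟨C, hC⟩ := h.exists_energyIntegrand_le hN hs0
  have hC0 : 0 ≤ C := (integral_nonneg fun ξ => norm_nonneg _).trans (hC t ht).2.1
  have hsub : Ioo 0 t ⊆ Icc 0 T := Ioo_subset_Icc_self.trans (Icc_subset_Icc_right ht.2)
  set Λ := (L * B ^ (1 / 2 : ℝ)).toReal with hΛ
  have hΛ0 : 0 ≤ Λ := ENNReal.toReal_nonneg
  set E : ℝ → ℝ≥0∞ := fun τ => energy (fun ξ => trunc N ξ ^ s) (f τ) with hEdef
  set D : ℝ → ℝ≥0∞ := fun τ => energy (fun ξ => ‖ξ‖ ^ (γ / 2) * trunc N ξ ^ s) (f τ) with hDdef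
  set H : ℝ → ℝ := fun τ => (∫ ξ, energyIntegrand γ N s (f τ) ξ).re with hHdef
  obtain ⟨mH, hid⟩ := h.energy_identity hN hs0 k ht
  have htr0 : ∀ ξ : Plane, 0 ≤ trunc N ξ ^ s :=
    fun ξ => Real.rpow_nonneg (trunc_nonneg hN.le ξ) s
  have htrm := (measurable_trunc N).pow_const s
  have mE : AEStronglyMeasurable (fun τ => (E τ).toReal) (volume.restrict (Ioo 0 t)) :=
    (aemeasurable_energy htrm htr0 measurableSet_Ioo
      (h.continuousOn.mono hsub)).ennreal_toReal.aestronglyMeasurable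
  have mD : AEStronglyMeasurable (fun τ => (D τ).toReal) (volume.restrict (Ioo 0 t)) :=
    (aemeasurable_energy (w := fun ξ => ‖ξ‖ ^ (γ / 2) * trunc N ξ ^ s) (by fun_prop)
      (fun ξ => mul_nonneg (by positivity) (htr0 ξ)) measurableSet_Ioo
      (h.continuousOn.mono hsub)).ennreal_toReal.aestronglyMeasurable
  have hEt : ∀ τ ∈ Icc 0 T, E τ ≠ ⊤ := fun τ hτ =>
    (lt_of_le_of_lt (hC τ hτ).2.2.1 ENNReal.ofReal_lt_top).ne
  have hDt : ∀ τ ∈ Icc 0 T, D τ ≠ ⊤ := fun τ hτ =>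
    (lt_of_le_of_lt (hC τ hτ).2.2.2 ENNReal.ofReal_lt_top).ne
  have bE : ∀ τ ∈ Ioo 0 t, ‖(E τ).toReal‖ ≤ C := fun τ hτ => by
    rw [Real.norm_of_nonneg ENNReal.toReal_nonneg]
    exact ENNReal.toReal_le_of_le_ofReal hC0 (hC τ (hsub hτ)).2.2.1
  have bD : ∀ τ ∈ Ioo 0 t, ‖(D τ).toReal‖ ≤ C := fun τ hτ => by
    rw [Real.norm_of_nonneg ENNReal.toReal_nonneg]
    exact ENNReal.toReal_le_of_le_ofReal hC0 (hC τ (hsub hτ)).2.2.2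
  have bH : ∀ τ ∈ Ioo 0 t, ‖2 * H τ‖ ≤ 2 * C := fun τ hτ => by
    rw [norm_mul, Real.norm_of_nonneg zero_le_two]
    gcongr
    exact (Complex.abs_re_le_norm _).trans
      ((norm_integral_le_integral_norm _).trans (hC τ (hsub hτ)).2.1)
  have iE1 := integrableOn_mul_of_bounded (p := fun τ => ((k : ℝ) + 1) * τ ^ k) (by fun_prop) mE bE
  have iE2 := integrableOn_mul_of_bounded
    (p := fun τ => ((k : ℝ) + 1) * τ ^ k + Λ * τ ^ (k + 1)) (by fun_prop) mE bE
  have iD := integrableOn_mul_of_bounded (p := fun τ => τ ^ (k + 1)) (by fun_prop) mD bD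
  have iH := integrableOn_mul_of_bounded (p := fun τ => τ ^ (k + 1)) (by fun_prop)
    (mH.const_mul 2) bH
  have hHle : ∀ τ ∈ Ioo 0 t, 2 * H τ ≤ Λ * (E τ).toReal - (D τ).toReal := fun τ hτ => by
    have hb := hE τ (hsub hτ)
    refine (hineq N hN (f τ) (measurable_Lp _) (h.hermitian τ)
      (lt_of_le_of_lt hb.1 hB.lt_top)
      (lt_of_le_of_lt (hb.2 _ (by norm_num) (by linarith)) hB.lt_top)
      (lt_of_le_of_lt (hb.2 _ (by norm_num) (by linarith)) hB.lt_top)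
      (lt_of_le_of_lt (hb.2 _ (by linarith) (by linarith)) hB.lt_top) ?_).trans ?_
    · calc K * energy (highWeight (2 - γ) R) (f τ) ^ (1 / 2 : ℝ)
          ≤ ENNReal.ofReal K.toReal * ENNReal.ofReal (K.toReal + 1)⁻¹ := by
            rw [ENNReal.ofReal_toReal hK]
            gcongr
            exact hR τ (hsub hτ)
        _ ≤ 1 := by
            rw [← ENNReal.ofReal_mul ENNReal.toReal_nonneg, ENNReal.ofReal_le_one,
              ← div_eq_mul_inv]
            have := ENNReal.toReal_nonneg (a := K)
            exact div_le_one_of_le₀ (by linarith) (by linarith)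
    · refine sub_le_sub_right (mul_le_mul_of_nonneg_right ?_ ENNReal.toReal_nonneg) _
      refine ENNReal.toReal_mono hLB ?_
      gcongr
      exact hb.1
  have hreal : t ^ (k + 1) * (E t).toReal + ∫ τ in Ioo 0 t, τ ^ (k + 1) * (D τ).toReal ≤
      ∫ τ in Ioo 0 t, ((k + 1) * τ ^ k + Λ * τ ^ (k + 1)) * (E τ).toReal := by
    have i12 : IntegrableOn (fun τ => (k + 1) * τ ^ k * (E τ).toReal +
        τ ^ (k + 1) * (2 * H τ)) (Ioo 0 t) volume := iE1.add iH
    rw [hid, ← integral_add i12 iD]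
    refine setIntegral_mono_on (i12.add iD) iE2 measurableSet_Ioo fun τ hτ => ?_
    have h1 := mul_le_mul_of_nonneg_left (hHle τ hτ) (pow_nonneg hτ.1.le (k + 1))
    linear_combination h1
  -- All quantities are finite for fixed N. Passing to extended nonnegative integrals prepares the
  -- limit N → ∞, where finiteness is not known in advance.
  have h2 := ENNReal.ofReal_le_ofReal hreal
  have n1 : 0 ≤ᵐ[volume.restrict (Ioo 0 t)] fun τ => τ ^ (k + 1) * (D τ).toReal :=
    (ae_restrict_iff' measurableSet_Ioo).2 (Eventually.of_forall fun τ hτ =>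
      mul_nonneg (pow_nonneg hτ.1.le _) ENNReal.toReal_nonneg)
  have p2 : ∀ τ ∈ Ioo 0 t, 0 ≤ ((k : ℝ) + 1) * τ ^ k + Λ * τ ^ (k + 1) := fun τ hτ => by
    have := hτ.1.le
    positivity
  have n2 : 0 ≤ᵐ[volume.restrict (Ioo 0 t)]
      fun τ => ((k + 1) * τ ^ k + Λ * τ ^ (k + 1)) * (E τ).toReal :=
    (ae_restrict_iff' measurableSet_Ioo).2 (Eventually.of_forall fun τ hτ =>
      mul_nonneg (p2 τ hτ) ENNReal.toReal_nonneg)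
  rw [ENNReal.ofReal_add (mul_nonneg (pow_nonneg ht.1 _) ENNReal.toReal_nonneg)
      (integral_nonneg_of_ae n1), ENNReal.ofReal_mul (pow_nonneg ht.1 _),
    ENNReal.ofReal_toReal (hEt t ht), ofReal_integral_eq_lintegral_ofReal iD n1,
    ofReal_integral_eq_lintegral_ofReal iE2 n2] at h2
  refine le_trans (le_of_eq ?_) (h2.trans (le_of_eq ?_))
  · congr 1
    refine setLIntegral_congr_fun measurableSet_Ioo fun τ hτ => ?_
    rw [ENNReal.ofReal_mul (pow_nonneg hτ.1.le _), ENNReal.ofReal_toReal (hDt τ (hsub hτ))]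
  · refine setLIntegral_congr_fun measurableSet_Ioo fun τ hτ => ?_
    rw [ENNReal.ofReal_mul (p2 τ hτ), ENNReal.ofReal_toReal (hEt τ (hsub hτ))]

end FourierSolution

/-! ### Smoothing estimates -/

lemma monotone_energy_trunc {w : Plane → ℝ} (hw : ∀ ξ, 0 ≤ w ξ) {s : ℝ} (hs : 0 ≤ s)
    (f : Plane → ℂ) :
    Monotone fun n : ℕ => energy (fun ξ => w ξ * trunc (n + 1) ξ ^ s) f := by
  intro n m hnm
  refine energy_mono (fun ξ => mul_le_mul_of_nonneg_left (Real.rpow_le_rpow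
    (trunc_nonneg (by positivity) ξ) (min_le_min_left _ ?_) hs) (hw ξ)) f
  have : (n : ℝ) ≤ m := by exact_mod_cast hnm
  linarith

lemma tendsto_energy_trunc {w : Plane → ℝ} (hwm : Measurable w) (hw : ∀ ξ, 0 ≤ w ξ) {s : ℝ}
    (hs : 0 ≤ s) {f : Plane → ℂ} (hf : Measurable f) :
    Tendsto (fun n : ℕ => energy (fun ξ => w ξ * trunc (n + 1) ξ ^ s) f) atTop
      (𝓝 (energy (fun ξ => w ξ * ‖ξ‖ ^ s) f)) := by
  have hN (n : ℕ) : (0 : ℝ) ≤ n + 1 := by positivity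
  rw [energy_eq_iSup (w := fun (n : ℕ) ξ => w ξ * trunc (n + 1) ξ ^ s)
    (fun n => hwm.mul ((measurable_trunc _).pow_const s)) (fun ξ n m hnm => ?_)
    (fun n ξ => ?_) (fun ξ => ?_) hf]
  · exact tendsto_atTop_iSup (monotone_energy_trunc hw hs f)
  · refine mul_le_mul_of_nonneg_left (Real.rpow_le_rpow
      (trunc_nonneg (hN n) ξ) (min_le_min_left _ ?_) hs) (hw ξ)
    have : (n : ℝ) ≤ m := by exact_mod_cast hnm
    linarith
  · exact mul_le_mul_of_nonneg_left (Real.rpow_le_rpow (trunc_nonneg (hN n) ξ)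
      (min_le_left _ _) hs) (hw ξ)
  · obtain ⟨n, hn⟩ := exists_nat_ge ‖ξ‖
    refine ⟨n, ?_⟩
    rw [trunc, min_eq_left (hn.trans (by linarith))]

namespace FourierSolution

variable {γ : ℝ} {hγ : γ ∈ Ioc (0 : ℝ) 1} {T : ℝ} {f : ℝ → L2C}

/-- Monotone convergence in N on the left; on the right the truncated weight is simply at most
|ξ|^s. The inequality is valid even when the right side is infinite, so it needs no a priori
regularity. -/
lemma energy_inequality (h : FourierSolution hγ T f) {s : ℝ} (hs : 1 ≤ s) :
    ∃ K : ℝ, 0 ≤ K ∧ ∀ k : ℕ, ∀ t ∈ Icc 0 T,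
      ENNReal.ofReal (t ^ (k + 1)) * energy (fun ξ => ‖ξ‖ ^ s) (f t) +
        ∫⁻ τ in Ioo 0 t, ENNReal.ofReal (τ ^ (k + 1)) *
          energy (fun ξ => ‖ξ‖ ^ (γ / 2 + s)) (f τ) ≤
      ∫⁻ τ in Ioo 0 t, ENNReal.ofReal ((k + 1) * τ ^ k + K * τ ^ (k + 1)) *
        energy (fun ξ => ‖ξ‖ ^ s) (f τ) := by
  obtain ⟨K, hK, hineq⟩ := h.energy_inequality_trunc hs
  refine ⟨K, hK, fun k t ht => ?_⟩
  have hs0 : 0 ≤ s := by linarith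
  have hγ1 := hγ.1
  have hsub : Ioo 0 t ⊆ Icc 0 T := Ioo_subset_Icc_self.trans (Icc_subset_Icc_right ht.2)
  have hD (τ : ℝ) : energy (fun ξ => ‖ξ‖ ^ (γ / 2 + s)) (f τ) =
      energy (fun ξ => ‖ξ‖ ^ (γ / 2) * ‖ξ‖ ^ s) (f τ) := by
    congr 1 with ξ
    exact Real.rpow_add_of_nonneg (norm_nonneg _) (by linarith) hs0
  have l1 := tendsto_energy_trunc (w := fun _ => 1) measurable_const (fun _ => zero_le_one) hs0
    (measurable_Lp (f t))
  simp only [one_mul] at l1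
  have l2 : Tendsto (fun n : ℕ => ∫⁻ τ in Ioo 0 t, ENNReal.ofReal (τ ^ (k + 1)) *
      energy (fun ξ => ‖ξ‖ ^ (γ / 2) * trunc (n + 1) ξ ^ s) (f τ)) atTop
      (𝓝 (∫⁻ τ in Ioo 0 t, ENNReal.ofReal (τ ^ (k + 1)) *
          energy (fun ξ => ‖ξ‖ ^ (γ / 2 + s)) (f τ))) := by
    refine lintegral_tendsto_of_tendsto_of_monotone (fun n => ?_)
      (Eventually.of_forall fun τ n m hnm => ?_) (Eventually.of_forall fun τ => ?_)
    · have hm := (measurable_trunc ((n : ℝ) + 1)).pow_const s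
      refine AEMeasurable.mul (by fun_prop) (aemeasurable_energy
        (w := fun ξ => ‖ξ‖ ^ (γ / 2) * trunc (n + 1) ξ ^ s) (by fun_prop) (fun ξ => ?_)
        measurableSet_Ioo (h.continuousOn.mono hsub))
      exact mul_nonneg (by positivity) (Real.rpow_nonneg (trunc_nonneg (by positivity) ξ) s)
    · exact mul_le_mul' le_rfl (monotone_energy_trunc (fun ξ => by positivity) hs0 _ hnm)
    · rw [hD]
      exact ENNReal.Tendsto.const_mul (tendsto_energy_trunc (by fun_prop)
        (fun ξ => by positivity) hs0 (measurable_Lp _)) (Or.inr ENNReal.ofReal_ne_top)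
  refine le_of_tendsto' ((ENNReal.Tendsto.const_mul l1 (Or.inr ENNReal.ofReal_ne_top)).add l2)
    fun n => (hineq (n + 1) (by positivity) k t ht).trans (lintegral_mono fun τ => ?_)
  refine mul_le_mul' le_rfl (energy_mono (fun ξ => ?_) _)
  exact Real.rpow_le_rpow (trunc_nonneg (by positivity) ξ) (min_le_left _ _) hs0

lemma energy_inequality_le (h : FourierSolution hγ T f) {s : ℝ} (hs : 1 ≤ s) (k : ℕ) :
    ∃ C : ℝ≥0∞, C ≠ ⊤ ∧ ∀ t ∈ Icc 0 T,
      ENNReal.ofReal (t ^ (k + 1)) * energy (fun ξ => ‖ξ‖ ^ s) (f t) +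
        ∫⁻ τ in Ioo 0 t, ENNReal.ofReal (τ ^ (k + 1)) *
          energy (fun ξ => ‖ξ‖ ^ (γ / 2 + s)) (f τ) ≤
      C * ∫⁻ τ in Ioo 0 t, ENNReal.ofReal (τ ^ k) * energy (fun ξ => ‖ξ‖ ^ s) (f τ) := by
  obtain ⟨K, hK, hineq⟩ := h.energy_inequality hs
  refine ⟨ENNReal.ofReal (k + 1 + K * T), ENNReal.ofReal_ne_top, fun t ht => ?_⟩
  refine (hineq k t ht).trans ?_
  rw [← lintegral_const_mul' _ _ ENNReal.ofReal_ne_top]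
  refine setLIntegral_mono' measurableSet_Ioo fun τ hτ => ?_
  have hT : 0 ≤ T := ht.1.trans ht.2
  have hτ0 := hτ.1.le
  rw [← mul_assoc, ← ENNReal.ofReal_mul (by positivity)]
  refine mul_le_mul' (ENNReal.ofReal_le_ofReal ?_) le_rfl
  have h1 : K * τ ^ (k + 1) ≤ K * T * τ ^ k := by
    rw [pow_succ', ← mul_assoc]
    have := hτ.2.le.trans ht.2
    gcongr
  linarith

/-- The `k`-th regularity index `2 - γ + kγ/2`. -/
def order (γ : ℝ) (k : ℕ) : ℝ := 2 - γ + k * (γ / 2)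

/-- The base case is the assumption θ ∈ L²(0,T; H^{2−γ/2}). Each further step reads off the
dissipation term of the energy inequality: one more power of τ buys γ/2 more derivatives. -/
lemma lintegral_energy_order_lt_top (h : FourierSolution hγ T f) (hT : 0 < T) (k : ℕ) :
    ∫⁻ τ in Ioo 0 T, ENNReal.ofReal (τ ^ k) *
      energy (fun ξ => ‖ξ‖ ^ order γ (k + 1)) (f τ) < ⊤ := by
  induction k with
  | zero =>
    have e : order γ (0 + 1) = 2 - γ / 2 := by unfold order; push_cast; ring
    simpa [e] using h.dissipation
  | succ k ih =>
    have hγ1 := hγ.1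
    have hγ2 := hγ.2
    have hs : 1 ≤ order γ (k + 1) := by
      have : 0 ≤ ((k + 1 : ℕ) : ℝ) * (γ / 2) := by positivity
      unfold order; linarith
    obtain ⟨C, hC, hineq⟩ := h.energy_inequality_le hs k
    have e : γ / 2 + order γ (k + 1) = order γ (k + 1 + 1) := by
      unfold order; push_cast; ring
    have h1 := le_add_self.trans (hineq T ⟨hT.le, le_rfl⟩)
    rw [e] at h1
    exact lt_of_le_of_lt h1 (ENNReal.mul_lt_top hC.lt_top ih)

/-- Smoothing estimate of order `k + 1`. -/
lemma exists_pow_mul_energy_le (h : FourierSolution hγ T f) (k : ℕ) :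
    ∃ C : ℝ≥0∞, C ≠ ⊤ ∧ ∀ t ∈ Icc 0 T,
      ENNReal.ofReal (t ^ (k + 1)) * energy (fun ξ => ‖ξ‖ ^ order γ (k + 1)) (f t) ≤
        C * ∫⁻ τ in Ioo 0 t, ENNReal.ofReal (τ ^ k) *
          energy (fun ξ => ‖ξ‖ ^ order γ (k + 1)) (f τ) := by
  have hγ1 := hγ.1
  have hγ2 := hγ.2
  have hs : 1 ≤ order γ (k + 1) := by
    have : 0 ≤ ((k + 1 : ℕ) : ℝ) * (γ / 2) := by positivity
    unfold order; linarith
  obtain ⟨C, hC, hineq⟩ := h.energy_inequality_le hs k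
  exact ⟨C, hC, fun t ht => le_self_add.trans (hineq t ht)⟩

lemma exists_pow_mul_energy_bound (h : FourierSolution hγ T f) (hT : 0 < T) (k : ℕ) :
    ∃ C : ℝ≥0∞, C ≠ ⊤ ∧ ∀ t ∈ Icc 0 T,
      ENNReal.ofReal (t ^ (k + 1)) * energy (fun ξ => ‖ξ‖ ^ order γ (k + 1)) (f t) ≤ C := by
  obtain ⟨C, hC, hineq⟩ := h.exists_pow_mul_energy_le k
  refine ⟨_, (ENNReal.mul_lt_top hC.lt_top (h.lintegral_energy_order_lt_top hT k)).ne,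
    fun t ht => (hineq t ht).trans ?_⟩
  gcongr
  exact ht.2

/-- The bound is an integral over (0,t) of a function integrable on (0,T), so absolute continuity of
the integral makes it vanish as t → 0. -/
lemma tendsto_pow_mul_energy (h : FourierSolution hγ T f) (hT : 0 < T) (k : ℕ) :
    Tendsto (fun t => ENNReal.ofReal (t ^ (k + 1)) *
      energy (fun ξ => ‖ξ‖ ^ order γ (k + 1)) (f t)) (𝓝[>] 0) (𝓝 0) := by
  obtain ⟨C, hC, hineq⟩ := h.exists_pow_mul_energy_le k
  set g : ℝ → ℝ≥0∞ := fun τ => ENNReal.ofReal (τ ^ k) *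
    energy (fun ξ => ‖ξ‖ ^ order γ (k + 1)) (f τ) with hg
  have hmem : ∀ᶠ t in 𝓝[>] (0 : ℝ), t ∈ Icc 0 T := Icc_mem_nhdsGT hT
  have h1 : Tendsto (fun t : ℝ => ∫⁻ τ in Ioo 0 t, g τ ∂(volume.restrict (Ioo 0 T)))
      (𝓝[>] 0) (𝓝 0) := by
    refine tendsto_setLIntegral_zero (h.lintegral_energy_order_lt_top hT k).ne ?_
    have h2 : Tendsto (fun t : ℝ => ENNReal.ofReal t) (𝓝[>] 0) (𝓝 0) := by
      have := (ENNReal.continuous_ofReal.tendsto 0).mono_left (nhdsWithin_le_nhds (s := Ioi 0))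
      simpa using this
    refine tendsto_of_tendsto_of_tendsto_of_le_of_le tendsto_const_nhds h2 (fun _ => zero_le)
      fun t => ?_
    refine (Measure.restrict_apply_le _ _).trans ?_
    simp
  have h3 : Tendsto (fun t : ℝ => C * ∫⁻ τ in Ioo 0 t, g τ) (𝓝[>] 0) (𝓝 0) := by
    have h4 := ENNReal.Tendsto.const_mul (a := C) h1 (Or.inr hC)
    rw [mul_zero] at h4
    refine h4.congr' ?_
    filter_upwards [hmem] with t ht
    rw [Measure.restrict_restrict measurableSet_Ioo,
      inter_eq_left.2 (Ioo_subset_Ioo_right ht.2)]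
  refine tendsto_of_tendsto_of_tendsto_of_le_of_le' tendsto_const_nhds h3
    (Eventually.of_forall fun _ => zero_le) ?_
  filter_upwards [hmem] with t ht using hineq t ht

end FourierSolution

/-! ### Decay estimates of fractional order -/

/-- Compare y with δ: below δ the first term suffices, above it the second. The free parameter δ is
what later yields limits as well as bounds. -/
lemma rpow_le_add_rpow {y δ lam : ℝ} {n : ℕ} (hy : 0 ≤ y) (hδ : 0 < δ) (hlam : 0 ≤ lam)
    (hn : lam ≤ n) : y ^ lam ≤ δ ^ lam + δ ^ (lam - n) * y ^ n := by
  rcases le_total y δ with h | h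
  · exact (Real.rpow_le_rpow hy h hlam).trans
      (le_add_of_nonneg_right (mul_nonneg (Real.rpow_nonneg hδ.le _) (pow_nonneg hy n)))
  · have hy0 : 0 < y := hδ.trans_le h
    have e : y ^ lam = y ^ (lam - n) * y ^ n := by
      rw [← Real.rpow_natCast y n, ← Real.rpow_add hy0, sub_add_cancel]
    rw [e]
    refine le_add_of_nonneg_of_le (Real.rpow_nonneg hδ.le _) ?_
    gcongr ?_ * _
    exact Real.rpow_le_rpow_of_nonpos hδ h (by linarith)

/-- Applied at y = t|ξ|^γ: there t^{2β/γ}|ξ|^{2β} is y^{2β/γ}, and tⁿ|ξ|^{nγ} is yⁿ, matching the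
squared weight of order n. So fractional smoothing is interpolated pointwise in ξ between the
critical energy and an integer step. -/
lemma rpow_mul_energy_le {γ : ℝ} (hγ : γ ∈ Ioc (0 : ℝ) 1) {β δ t : ℝ} {n : ℕ} (hβ : 0 ≤ β)
    (hδ : 0 < δ) (ht : 0 < t) (hn : 2 * β / γ ≤ n) {f : Plane → ℂ} (hf : Measurable f) :
    ENNReal.ofReal (t ^ (2 * β / γ)) * energy (fun ξ => ‖ξ‖ ^ (2 - γ + β)) f ≤
      ENNReal.ofReal (δ ^ (2 * β / γ)) * energy (fun ξ => ‖ξ‖ ^ (2 - γ)) f +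
        ENNReal.ofReal (δ ^ (2 * β / γ - n)) * (ENNReal.ofReal (t ^ n) *
          energy (fun ξ => ‖ξ‖ ^ FourierSolution.order γ n) f) := by
  have hγ1 := hγ.1
  have hγ2 := hγ.2
  unfold energy
  rw [← mul_assoc, ← ENNReal.ofReal_mul (by positivity),
    ← lintegral_const_mul' _ _ ENNReal.ofReal_ne_top,
    ← lintegral_const_mul' _ _ ENNReal.ofReal_ne_top,
    ← lintegral_const_mul' _ _ ENNReal.ofReal_ne_top, ← lintegral_add_right _ (by fun_prop)]
  refine lintegral_mono fun ξ => ?_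
  set A := ‖ξ‖ with hA
  have hA0 : 0 ≤ A := norm_nonneg _
  have hy : 0 ≤ t * A ^ γ := by positivity
  have h := rpow_le_add_rpow hy hδ (by positivity : 0 ≤ 2 * β / γ) hn
  have e1 : t ^ (2 * β / γ) * (A ^ (2 - γ + β)) ^ 2 =
      (A ^ (2 - γ)) ^ 2 * (t * A ^ γ) ^ (2 * β / γ) := by
    rw [Real.rpow_add_of_nonneg hA0 (by linarith) hβ, Real.mul_rpow ht.le (by positivity),
      ← Real.rpow_mul hA0, mul_pow, ← Real.rpow_mul_natCast hA0 β 2]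
    have : γ * (2 * β / γ) = β * (2 : ℕ) := by push_cast; field_simp
    rw [this]; ring
  have e2 : t ^ n * (A ^ FourierSolution.order γ n) ^ 2 =
      (A ^ (2 - γ)) ^ 2 * (t * A ^ γ) ^ n := by
    rw [FourierSolution.order, Real.rpow_add_of_nonneg hA0 (by linarith) (by positivity), mul_pow,
      mul_pow, ← Real.rpow_mul_natCast hA0 (n * (γ / 2)) 2, ← Real.rpow_mul_natCast hA0 γ n]
    have : (n : ℝ) * (γ / 2) * (2 : ℕ) = γ * n := by push_cast; ring
    rw [this]; ring
  have key : t ^ (2 * β / γ) * (A ^ (2 - γ + β)) ^ 2 ≤ δ ^ (2 * β / γ) * (A ^ (2 - γ)) ^ 2 +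
      δ ^ (2 * β / γ - n) * t ^ n * (A ^ FourierSolution.order γ n) ^ 2 := by
    rw [mul_assoc (δ ^ (2 * β / γ - n)), e1, e2]
    have h2 := mul_le_mul_of_nonneg_left h (by positivity : 0 ≤ (A ^ (2 - γ)) ^ 2)
    linear_combination h2
  simp only [mul_pow, ← mul_assoc, ← hA]
  rw [← ENNReal.ofReal_pow (by positivity), ← ENNReal.ofReal_pow (by positivity),
    ← ENNReal.ofReal_pow (by positivity), ← ENNReal.ofReal_mul (by positivity), ← ENNReal.ofReal_mul (by positivity),
    ← ENNReal.ofReal_mul (by positivity), ← add_mul, ← ENNReal.ofReal_add (by positivity)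
    (by positivity)]
  exact mul_le_mul' (ENNReal.ofReal_le_ofReal key) le_rfl

namespace FourierSolution

variable {γ : ℝ} {hγ : γ ∈ Ioc (0 : ℝ) 1} {T : ℝ} {f : ℝ → L2C}

lemma exists_rpow_mul_energy_bound (h : FourierSolution hγ T f) (hT : 0 < T) {β : ℝ}
    (hβ : 0 ≤ β) : ∃ C : ℝ≥0∞, C ≠ ⊤ ∧ ∀ t ∈ Ioo 0 T,
      ENNReal.ofReal (t ^ (2 * β / γ)) * energy (fun ξ => ‖ξ‖ ^ (2 - γ + β)) (f t) ≤ C := by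
  have hγ2 := hγ.2
  obtain ⟨n, hn⟩ := exists_nat_ge (2 * β / γ)
  obtain ⟨B, hB, hE⟩ := h.exists_energy_le
  obtain ⟨C, hC, hk⟩ := h.exists_pow_mul_energy_bound hT n
  refine ⟨B + C, by finiteness, fun t ht => ?_⟩
  -- The smoothing estimates are indexed by k + 1, so the interpolation exponent is n + 1 rather
  -- than n. The choice δ = 1 is enough for boundedness.
  have hn' : 2 * β / γ ≤ (n + 1 : ℕ) := by push_cast; linarith
  have h1 := rpow_mul_energy_le hγ hβ one_pos ht.1 hn' (measurable_Lp (f t))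
  simp only [Real.one_rpow, ENNReal.ofReal_one, one_mul] at h1
  exact h1.trans (add_le_add ((hE t (Ioo_subset_Icc_self ht)).2 _ (by linarith) le_rfl)
    (hk t (Ioo_subset_Icc_self ht)))

/-- First δ is chosen small, making the critical term at most ε/2; this needs a positive exponent,
hence β > 0. With δ fixed, the second term tends to 0 as t → 0. -/
lemma tendsto_rpow_mul_energy (h : FourierSolution hγ T f) (hT : 0 < T) {β : ℝ} (hβ : 0 < β) :
    Tendsto (fun t => ENNReal.ofReal (t ^ (2 * β / γ)) *
      energy (fun ξ => ‖ξ‖ ^ (2 - γ + β)) (f t)) (𝓝[>] 0) (𝓝 0) := by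
  have hγ1 := hγ.1
  have hγ2 := hγ.2
  obtain ⟨n, hn⟩ := exists_nat_ge (2 * β / γ)
  have hn' : 2 * β / γ ≤ (n + 1 : ℕ) := by push_cast; linarith
  obtain ⟨B, hB, hE⟩ := h.exists_energy_le
  have hlam : 0 < 2 * β / γ := by positivity
  have hδlim : Tendsto (fun δ : ℝ => ENNReal.ofReal (δ ^ (2 * β / γ)) * B) (𝓝[>] 0) (𝓝 0) := by
    have h1 : Tendsto (fun δ : ℝ => δ ^ (2 * β / γ)) (𝓝[>] 0) (𝓝 0) := by
      have := (Real.continuousAt_rpow_const 0 (2 * β / γ) (Or.inr hlam.le)).tendsto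
      rw [Real.zero_rpow hlam.ne'] at this
      exact this.mono_left nhdsWithin_le_nhds
    have h2 := ENNReal.Tendsto.mul_const (b := B) (ENNReal.tendsto_ofReal h1) (Or.inr hB)
    simpa using h2
  rw [ENNReal.tendsto_nhds_zero]
  intro ε hε
  have hε2 : 0 < ε / 2 := ENNReal.half_pos hε.ne'
  obtain ⟨δ, hδ1, hδ0⟩ := (((ENNReal.tendsto_nhds_zero.1 hδlim) (ε / 2) hε2).and
    self_mem_nhdsWithin).exists
  have h3 := ENNReal.Tendsto.const_mul (a := ENNReal.ofReal (δ ^ (2 * β / γ - (n + 1 : ℕ))))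
    (h.tendsto_pow_mul_energy hT n) (Or.inr ENNReal.ofReal_ne_top)
  rw [mul_zero] at h3
  filter_upwards [(ENNReal.tendsto_nhds_zero.1 h3) (ε / 2) hε2, Icc_mem_nhdsGT hT,
    self_mem_nhdsWithin] with t h4 htT ht0
  refine (rpow_mul_energy_le hγ hβ.le hδ0 ht0 hn' (measurable_Lp (f t))).trans ?_
  rw [← ENNReal.add_halves ε]
  refine add_le_add (le_trans ?_ hδ1) h4
  exact mul_le_mul' le_rfl ((hE t htT).2 _ (by linarith) le_rfl)

end FourierSolution

/-! ### Passage to the Fourier side -/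

lemma continuous_fourierL2 : Continuous fourierL2 :=
  (Lp.fourierTransformₗᵢ Plane ℂ).continuous.comp
    (Complex.ofRealCLM.compLpL 2 (volume : Measure Plane)).continuous

lemma fourierL2_sub (f g : L2) : fourierL2 (f - g) = fourierL2 f - fourierL2 g := by
  have h : toComplex (f - g) = toComplex f - toComplex g :=
    (Complex.ofRealCLM.compLpL 2 (volume : Measure Plane)).map_sub f g
  rw [fourierL2, h]
  exact (Lp.fourierTransformₗᵢ Plane ℂ).map_sub _ _

lemma homSobolevNorm_sq (s : ℝ) (f : L2) : homSobolevNorm s f ^ 2 =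
    ENNReal.ofReal ((2 * Real.pi) ^ s) ^ 2 * energy (fun ξ => ‖ξ‖ ^ s) (fourierL2 f) := by
  rw [homSobolevNorm, ← energy_eq_eLpNorm (w := fun ξ => (2 * Real.pi * ‖ξ‖) ^ s)
    (fun ξ => by positivity), energy, energy,
    ← lintegral_const_mul' _ _ (ENNReal.pow_ne_top ENNReal.ofReal_ne_top)]
  refine lintegral_congr fun ξ => ?_
  rw [← mul_pow, ← mul_assoc, ← ENNReal.ofReal_mul (by positivity),
    Real.mul_rpow (by positivity) (norm_nonneg _)]

lemma energy_le_homSobolevNorm_sq {s : ℝ} (hs : 0 ≤ s) (f : L2) :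
    energy (fun ξ => ‖ξ‖ ^ s) (fourierL2 f) ≤ homSobolevNorm s f ^ 2 := by
  rw [homSobolevNorm_sq]
  refine le_mul_of_one_le_left zero_le (one_le_pow₀ ?_)
  rw [ENNReal.one_le_ofReal]
  exact Real.one_le_rpow (by nlinarith [Real.pi_gt_three]) hs

lemma homSobolevNorm_eq_enorm_le {s : ℝ} (hs : 0 ≤ s) (f : L2) {g : L2C}
    (hg : g =ᵐ[volume] fun ξ => ((‖ξ‖ ^ s : ℝ) : ℂ) * fourierL2 f ξ) :
    ‖g‖ₑ ≤ homSobolevNorm s f := by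
  have h := energy_le_homSobolevNorm_sq hs f
  rw [energy_eq_enorm (fun ξ => by positivity) hg] at h
  exact (ENNReal.pow_le_pow_left_iff two_ne_zero).1 h

lemma IsSolution.fourierSolution {γ : ℝ} (hγ : γ ∈ Ioc (0 : ℝ) 1) {θ₀ : L2} {T : ℝ}
    {θ : ℝ → L2} (hθ : IsSolution γ θ₀ T θ) :
    FourierSolution hγ T fun t => fourierL2 (θ t) := by
  have hγ1 := hγ.1
  have hγ2 := hγ.2
  have hσ : 0 ≤ 2 - γ := by linarith
  have hc : ContinuousOn (fun t => fourierL2 (θ t)) (Icc 0 T) := by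
    refine continuous_fourierL2.comp_continuousOn fun t ht => ?_
    rw [ContinuousWithinAt, tendsto_iff_edist_tendsto_0]
    refine tendsto_of_tendsto_of_tendsto_of_le_of_le tendsto_const_nhds (hθ.continuous.2 t ht)
      (fun _ => zero_le) fun r => ?_
    simp only [edist_eq_enorm_sub, Lp.enorm_def]
    exact le_add_self
  have hmem : ∀ t ∈ Icc 0 T,
      MemLp (fun ξ => ((‖ξ‖ ^ (2 - γ) : ℝ) : ℂ) * fourierL2 (θ t) ξ) 2 volume := fun t ht => by
    refine memLp_of_energy (by fun_prop) (fun ξ => by positivity) (measurable_Lp _)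
      (lt_of_le_of_lt (energy_le_homSobolevNorm_sq hσ (θ t)) ?_)
    exact ENNReal.pow_lt_top (lt_of_le_of_lt le_self_add (hθ.continuous.1 t ht))
  refine ⟨hc, fun t => fourierL2_neg (θ t), ?_, ?_, fun t ht =>
    fourier_integral_equation hγ hθ.weak hc ht⟩
  · classical
    -- The value 0 outside [0,T] is arbitrary: continuity and the defining identity are only asked
    -- on that interval.
    refine ⟨fun t => if h : t ∈ Icc 0 T then (hmem t h).toLp _ else 0, fun t ht => ?_,
      fun t ht => ?_⟩
    · rw [ContinuousWithinAt, tendsto_iff_edist_tendsto_0]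
      refine tendsto_of_tendsto_of_tendsto_of_le_of_le' tendsto_const_nhds
        (hθ.continuous.2 t ht) (Eventually.of_forall fun _ => zero_le) ?_
      filter_upwards [self_mem_nhdsWithin] with r hr
      rw [dif_pos hr, dif_pos ht, edist_eq_enorm_sub]
      refine le_trans (homSobolevNorm_eq_enorm_le hσ (θ r - θ t) ?_) le_self_add
      rw [fourierL2_sub]
      filter_upwards [Lp.coeFn_sub ((hmem r hr).toLp _) ((hmem t ht).toLp _),
        (hmem r hr).coeFn_toLp, (hmem t ht).coeFn_toLp,
        Lp.coeFn_sub (fourierL2 (θ r)) (fourierL2 (θ t))] with ξ h1 h2 h3 h4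
      rw [h1, h4, Pi.sub_apply, Pi.sub_apply, h2, h3]
      ring
    · simp only [dif_pos ht]
      exact (hmem t ht).coeFn_toLp
  · refine lt_of_le_of_lt (lintegral_mono fun t => ?_) hθ.square_integrable
    refine (energy_le_homSobolevNorm_sq (by linarith) (θ t)).trans ?_
    gcongr
    exact le_self_add

lemma rpow_mul_homSobolevNorm_sq {γ β : ℝ} (s : ℝ) (f : L2) {t : ℝ} (ht : 0 < t) :
    (ENNReal.ofReal (t ^ (β / γ)) * homSobolevNorm s f) ^ 2 =
      ENNReal.ofReal ((2 * Real.pi) ^ s) ^ 2 *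
        (ENNReal.ofReal (t ^ (2 * β / γ)) * energy (fun ξ => ‖ξ‖ ^ s) (fourierL2 f)) := by
  have h : ENNReal.ofReal (t ^ (β / γ)) ^ 2 = ENNReal.ofReal (t ^ (2 * β / γ)) := by
    rw [← ENNReal.ofReal_pow (by positivity), ← Real.rpow_mul_natCast ht.le]
    congr 2; push_cast; ring
  rw [mul_pow, homSobolevNorm_sq, h]
  ring

/-- The smoothing bounds. -/
lemma IsSolution.iSup_lt_top {γ : ℝ} (hγ : γ ∈ Ioc (0 : ℝ) 1) {θ₀ : L2} {T : ℝ} (hT : 0 < T)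
    {θ : ℝ → L2} (hθ : IsSolution γ θ₀ T θ) {β : ℝ} (hβ : 0 ≤ β) :
    (⨆ t ∈ Ioo 0 T, ENNReal.ofReal (t ^ (β / γ)) * homSobolevNorm (2 - γ + β) (θ t)) < ⊤ := by
  obtain ⟨C, hC, h⟩ := (hθ.fourierSolution hγ).exists_rpow_mul_energy_bound hT hβ
  refine lt_of_le_of_lt (b := (ENNReal.ofReal ((2 * Real.pi) ^ (2 - γ + β)) ^ 2 * C) ^ (1 / 2 : ℝ))
    (iSup₂_le fun t ht => ?_) (by finiteness)
  have e : ENNReal.ofReal (t ^ (β / γ)) * homSobolevNorm (2 - γ + β) (θ t) =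
      ((ENNReal.ofReal (t ^ (β / γ)) * homSobolevNorm (2 - γ + β) (θ t)) ^ 2) ^ (1 / 2 : ℝ) := by
    rw [← ENNReal.rpow_natCast, ← ENNReal.rpow_mul]; norm_num
  rw [e, rpow_mul_homSobolevNorm_sq _ _ ht.1]
  gcongr
  exact h t ht

lemma IsSolution.tendsto_zero {γ : ℝ} (hγ : γ ∈ Ioc (0 : ℝ) 1) {θ₀ : L2} {T : ℝ} (hT : 0 < T)
    {θ : ℝ → L2} (hθ : IsSolution γ θ₀ T θ) {β : ℝ} (hβ : 0 < β) :
    Tendsto (fun t : ℝ => ENNReal.ofReal (t ^ (β / γ)) * homSobolevNorm (2 - γ + β) (θ t))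
      (𝓝[>] 0) (𝓝 0) := by
  have h := (hθ.fourierSolution hγ).tendsto_rpow_mul_energy hT hβ
  have h1 := (ENNReal.Tendsto.const_mul (a := ENNReal.ofReal ((2 * Real.pi) ^ (2 - γ + β)) ^ 2) h
    (Or.inr (by finiteness))).ennrpow_const (1 / 2 : ℝ)
  rw [mul_zero, ENNReal.zero_rpow_of_pos (by norm_num)] at h1
  refine h1.congr' ?_
  filter_upwards [self_mem_nhdsWithin] with t ht
  rw [← rpow_mul_homSobolevNorm_sq _ _ ht, ← ENNReal.rpow_natCast, ← ENNReal.rpow_mul]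
  norm_num

/-! ### Weighted Fourier transforms and their time derivatives -/

open Classical in
/-- The class of `(1+|ξ|)^n g`, if it is square integrable. -/
def weighted (n : ℕ) (g : L2C) : L2C :=
  if h : MemLp (fun ξ => ((wt ξ ^ n : ℝ) : ℂ) * g ξ) 2 volume then h.toLp _ else 0

lemma coeFn_weighted {n : ℕ} {g : L2C}
    (h : MemLp (fun ξ => ((wt ξ ^ n : ℝ) : ℂ) * g ξ) 2 volume) :
    weighted n g =ᵐ[volume] fun ξ => ((wt ξ ^ n : ℝ) : ℂ) * g ξ := by
  rw [weighted, dif_pos h]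
  exact h.coeFn_toLp

lemma wt_pow_nonneg (n : ℕ) (ξ : Plane) : 0 ≤ wt ξ ^ n := pow_nonneg (wt_pos ξ).le n

lemma energy_wt_pow_le (n : ℕ) {s : ℝ} (hs : n ≤ s) {f : Plane → ℂ} (hf : Measurable f) :
    energy (fun ξ => wt ξ ^ n) f ≤ ENNReal.ofReal ((2 ^ n) ^ 2) *
      (energy (fun _ => 1) f + energy (fun ξ => ‖ξ‖ ^ s) f) := by
  unfold energy
  rw [← lintegral_add_right _ (by fun_prop), ← lintegral_const_mul' _ _ ENNReal.ofReal_ne_top]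
  refine lintegral_mono fun ξ => ?_
  have key {b : ℝ} (hb : wt ξ ^ n ≤ 2 ^ n * b) : (ENNReal.ofReal (wt ξ ^ n) * ‖f ξ‖ₑ) ^ 2 ≤
      ENNReal.ofReal ((2 ^ n) ^ 2) * (ENNReal.ofReal b * ‖f ξ‖ₑ) ^ 2 := by
    rw [ENNReal.ofReal_pow (p := 2 ^ n) (by positivity) 2, ← mul_pow, ← mul_assoc,
      ← ENNReal.ofReal_mul (by positivity)]
    gcongr
  have hw := wt_pos ξ
  rcases le_total ‖ξ‖ 1 with h | h
  · refine (key (b := 1) ?_).trans (mul_le_mul' le_rfl le_self_add)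
    rw [mul_one]
    have : wt ξ ≤ 2 := by unfold wt; linarith
    gcongr
  · refine (key (b := ‖ξ‖ ^ s) ?_).trans (mul_le_mul' le_rfl le_add_self)
    have h1 : wt ξ ≤ 2 * ‖ξ‖ := by unfold wt; linarith
    calc wt ξ ^ n ≤ (2 * ‖ξ‖) ^ n := by gcongr
      _ = 2 ^ n * ‖ξ‖ ^ (n : ℝ) := by rw [mul_pow, Real.rpow_natCast]
      _ ≤ 2 ^ n * ‖ξ‖ ^ s := by gcongr

lemma mulOp_wtInv_injective (n : ℕ) :
    Function.Injective (mulOp _ (boundedSymbol_wtInv n)) := by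
  intro g g' h
  apply Lp.ext
  filter_upwards [coeFn_mulOp (boundedSymbol_wtInv n) g,
    coeFn_mulOp (boundedSymbol_wtInv n) g'] with ξ h1 h2
  rw [h, h2] at h1
  have := congrArg (fun z => ((wt ξ ^ n : ℝ) : ℂ) * z) h1
  simp only [← mul_assoc, wt_pow_mul_wtInv, one_mul] at this
  exact this.symm

lemma wtInv_add (m n : ℕ) (ξ : Plane) : wtInv (m + n) ξ = wtInv m ξ * wtInv n ξ := by
  simp only [wtInv, pow_add, mul_inv, Complex.ofReal_mul]

namespace FourierSolution

variable {γ : ℝ} {hγ : γ ∈ Ioc (0 : ℝ) 1} {T : ℝ} {f : ℝ → L2C}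

/-- All weighted norms are locally bounded for positive times. -/
lemma exists_energy_wt_le (h : FourierSolution hγ T f) (n : ℕ) {a : ℝ} (ha : a ∈ Ioo 0 T) :
    ∃ C : ℝ≥0∞, C ≠ ⊤ ∧ ∀ t ∈ Ico a T, energy (fun ξ => wt ξ ^ n) (f t) ≤ C := by
  have hγ1 := hγ.1
  have hγ2 := hγ.2
  obtain ⟨B, hB, hE⟩ := h.exists_energy_le
  obtain ⟨C, hC, hk⟩ := h.exists_rpow_mul_energy_bound (ha.1.trans ha.2) (β := n) n.cast_nonneg
  set c := a ^ (2 * (n : ℝ) / γ) with hc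
  have hc0 : 0 < c := Real.rpow_pos_of_pos ha.1 _
  refine ⟨ENNReal.ofReal ((2 ^ n) ^ 2) * (B + ENNReal.ofReal c⁻¹ * C), by finiteness,
    fun t ht => ?_⟩
  have ht' : t ∈ Ioo 0 T := ⟨ha.1.trans_le ht.1, ht.2⟩
  -- Since 2 − γ ≥ 0, the smoothing bound with β = n already controls n powers of the weight.
  -- Staying at t ≥ a removes the time factor at the cost of a^{−2n/γ}.
  refine (energy_wt_pow_le n (s := 2 - γ + n) (by linarith) (measurable_Lp (f t))).trans ?_
  gcongr
  · exact (hE t (Ioo_subset_Icc_self ht')).1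
  · calc energy (fun ξ => ‖ξ‖ ^ (2 - γ + n)) (f t)
        = ENNReal.ofReal c⁻¹ * (ENNReal.ofReal c * energy (fun ξ => ‖ξ‖ ^ (2 - γ + n)) (f t)) := by
          rw [← mul_assoc, ← ENNReal.ofReal_mul (by positivity), inv_mul_cancel₀ hc0.ne',
            ENNReal.ofReal_one, one_mul]
      _ ≤ ENNReal.ofReal c⁻¹ * (ENNReal.ofReal (t ^ (2 * (n : ℝ) / γ)) *
          energy (fun ξ => ‖ξ‖ ^ (2 - γ + n)) (f t)) := by
          gcongr
          exact Real.rpow_le_rpow ha.1.le ht.1 (by positivity)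
      _ ≤ _ := by gcongr; exact hk t ht'

lemma memLp_weighted (h : FourierSolution hγ T f) (n : ℕ) {t : ℝ} (ht : t ∈ Ioo 0 T) :
    MemLp (fun ξ => ((wt ξ ^ n : ℝ) : ℂ) * f t ξ) 2 volume := by
  obtain ⟨C, hC, hb⟩ := h.exists_energy_wt_le n ht
  exact memLp_of_energy (continuous_wt.pow n).measurable (wt_pow_nonneg n) (measurable_Lp _)
    (lt_of_le_of_lt (hb t ⟨le_rfl, ht.2⟩) hC.lt_top)

lemma coeFn_weighted (h : FourierSolution hγ T f) (n : ℕ) {t : ℝ} (ht : t ∈ Ioo 0 T) :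
    weighted n (f t) =ᵐ[volume] fun ξ => ((wt ξ ^ n : ℝ) : ℂ) * f t ξ :=
  QG.coeFn_weighted (h.memLp_weighted n ht)

lemma exists_norm_weighted_le (h : FourierSolution hγ T f) (n : ℕ) {a : ℝ} (ha : a ∈ Ioo 0 T) :
    ∃ C : ℝ, ∀ t ∈ Ico a T, ‖weighted n (f t)‖ ≤ C := by
  obtain ⟨C, hC, hb⟩ := h.exists_energy_wt_le n ha
  refine ⟨(C ^ (1 / 2 : ℝ)).toReal, fun t ht => ?_⟩
  have h1 := hb t ht
  rw [energy_eq_enorm (wt_pow_nonneg n) (h.coeFn_weighted n ⟨ha.1.trans_le ht.1, ht.2⟩)] at h1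
  have h2 : ‖weighted n (f t)‖ₑ ≤ C ^ (1 / 2 : ℝ) := by
    have := ENNReal.rpow_le_rpow h1 (by norm_num : (0 : ℝ) ≤ 1 / 2)
    rwa [← ENNReal.rpow_natCast, ← ENNReal.rpow_mul, show ((2 : ℕ) : ℝ) * (1 / 2) = 1 by norm_num,
      ENNReal.rpow_one] at this
  rw [← toReal_enorm]
  exact ENNReal.toReal_mono (by finiteness) h2

/-- Interpolation between the weights `1` and `(1+|ξ|)^{2n}`. -/
lemma norm_weighted_sub_sq_le (h : FourierSolution hγ T f) (n : ℕ) {r t : ℝ} (hr : r ∈ Ioo 0 T)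
    (ht : t ∈ Ioo 0 T) : ‖weighted n (f r) - weighted n (f t)‖ ^ 2 ≤
      ‖f r - f t‖ * ‖weighted (2 * n) (f r) - weighted (2 * n) (f t)‖ := by
  have e : inner ℂ (weighted n (f r) - weighted n (f t)) (weighted n (f r) - weighted n (f t)) =
      inner ℂ (f r - f t) (weighted (2 * n) (f r) - weighted (2 * n) (f t)) := by
    rw [L2.inner_def, L2.inner_def]
    apply integral_congr_ae
    filter_upwards [Lp.coeFn_sub (weighted n (f r)) (weighted n (f t)), Lp.coeFn_sub (f r) (f t),
      Lp.coeFn_sub (weighted (2 * n) (f r)) (weighted (2 * n) (f t)), h.coeFn_weighted n hr,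
      h.coeFn_weighted n ht, h.coeFn_weighted (2 * n) hr, h.coeFn_weighted (2 * n) ht]
      with ξ h1 h2 h3 h4 h5 h6 h7
    rw [h1, h2, h3, Pi.sub_apply, Pi.sub_apply, Pi.sub_apply, h4, h5, h6, h7, RCLike.inner_apply,
      RCLike.inner_apply, map_sub, map_sub, map_mul, map_mul, Complex.conj_ofReal, two_mul n,
      pow_add, Complex.ofReal_mul]
    ring
  rw [← inner_self_eq_norm_sq (𝕜 := ℂ), e]
  exact (RCLike.re_le_norm _).trans (norm_inner_le_norm _ _)

/-- Interpolation: the plain L² difference tends to 0, and the difference with the doubled weight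
stays bounded near any positive time. -/
lemma continuousOn_weighted (h : FourierSolution hγ T f) (n : ℕ) :
    ContinuousOn (fun t => weighted n (f t)) (Ioo 0 T) := by
  intro t ht
  apply ContinuousAt.continuousWithinAt
  have ha : t / 2 ∈ Ioo 0 T := ⟨half_pos ht.1, (half_lt_self ht.1).trans ht.2⟩
  obtain ⟨C, hC⟩ := h.exists_norm_weighted_le (2 * n) ha
  have hC0 : 0 ≤ C := (norm_nonneg _).trans (hC t ⟨(half_lt_self ht.1).le, ht.2⟩)
  have hcf : ContinuousAt f t := h.continuousOn.continuousAt (Icc_mem_nhds ht.1 ht.2)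
  have h1 : Tendsto (fun r => √(‖f r - f t‖ * (C + C))) (𝓝 t) (𝓝 0) := by
    have h2 : Tendsto (fun r => ‖f r - f t‖ * (C + C)) (𝓝 t) (𝓝 0) := by
      have := (tendsto_iff_norm_sub_tendsto_zero.1 hcf).mul_const (C + C)
      rwa [zero_mul] at this
    have := (Real.continuous_sqrt.tendsto 0).comp h2
    rwa [Real.sqrt_zero] at this
  rw [ContinuousAt, tendsto_iff_norm_sub_tendsto_zero]
  refine squeeze_zero' (Eventually.of_forall fun _ => norm_nonneg _) ?_ h1
  filter_upwards [Ioo_mem_nhds (half_lt_self ht.1) ht.2] with r hr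
  apply Real.le_sqrt_of_sq_le
  refine (h.norm_weighted_sub_sq_le n ⟨ha.1.trans hr.1, hr.2⟩ ht).trans ?_
  gcongr
  exact (norm_sub_le _ _).trans (add_le_add (hC r ⟨hr.1.le, hr.2⟩)
    (hC t ⟨(half_lt_self ht.1).le, ht.2⟩))

lemma mulOp_weighted (h : FourierSolution hγ T f) (n : ℕ) {t : ℝ} (ht : t ∈ Ioo 0 T) :
    mulOp _ (boundedSymbol_wtInv (n + 3)) (weighted n (f t)) =
      mulOp _ (boundedSymbol_wtInv 3) (f t) := by
  apply Lp.ext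
  filter_upwards [coeFn_mulOp (boundedSymbol_wtInv (n + 3)) (weighted n (f t)),
    coeFn_mulOp (boundedSymbol_wtInv 3) (f t), h.coeFn_weighted n ht] with ξ h1 h2 h3
  rw [h1, h2, h3, wtInv_add]
  linear_combination (wtInv 3 ξ * f t ξ) * wt_pow_mul_wtInv n ξ

lemma mulOp_rhs_weighted (h : FourierSolution hγ T f) (n : ℕ) {t : ℝ} (ht : t ∈ Ioo 0 T) :
    mulOp _ (boundedSymbol_wtInv n) (rhs hγ n (weighted n (f t))) = rhs hγ 0 (f t) := by
  apply Lp.ext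
  filter_upwards [coeFn_mulOp (boundedSymbol_wtInv n) (rhs hγ n (weighted n (f t))),
    coeFn_rhs hγ n (h.coeFn_weighted n ht), coeFn_rhs_zero hγ (f t)] with ξ h1 h2 h3
  rw [h1, h2, h3]
  linear_combination (wtInv 3 ξ * fourierRhs γ (f t) ξ) * wt_pow_mul_wtInv n ξ

/-- The right-hand side loses three powers of the weight, so V_n' is expressed through V_{n+3}. The
integrated equation is verified after the injective operator `wtInv (n + 3)`, which maps it to the
known equation with weight (1+|ξ|)^{−3}. -/
lemma hasDerivAt_weighted (h : FourierSolution hγ T f) (n : ℕ) {t : ℝ} (ht : t ∈ Ioo 0 T) :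
    HasDerivAt (fun s => weighted n (f s)) (rhs hγ (n + 3) (weighted (n + 3) (f t))) t := by
  have hrc : ContinuousOn (fun s => rhs hγ (n + 3) (weighted (n + 3) (f s))) (Ioo 0 T) :=
    (contDiff_rhs hγ (n + 3) (k := 0)).continuous.comp_continuousOn (h.continuousOn_weighted _)
  have hsub {r : ℝ} (hr : r ∈ Ioo 0 T) : uIcc t r ⊆ Ioo 0 T :=
    ordConnected_Ioo.uIcc_subset ht hr
  have hint {r : ℝ} (hr : r ∈ Ioo 0 T) : IntervalIntegrable
      (fun s => rhs hγ (n + 3) (weighted (n + 3) (f s))) volume t r :=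
    (hrc.mono (hsub hr)).intervalIntegrable
  have hnhds : Ioo 0 T ∈ 𝓝 t := Ioo_mem_nhds ht.1 ht.2
  have hd := intervalIntegral.integral_hasDerivAt_right (hint ht)
    (hrc.stronglyMeasurableAtFilter isOpen_Ioo t ht) (hrc.continuousAt hnhds)
  refine (hd.add_const (weighted n (f t))).congr_of_eventuallyEq ?_
  filter_upwards [hnhds] with r hr
  rw [← sub_eq_iff_eq_add]
  apply mulOp_wtInv_injective (n + 3)
  have hcomm := ((mulOp _ (boundedSymbol_wtInv (n + 3))).restrictScalars ℝ
    ).intervalIntegral_comp_comm (hint hr)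
  simp only [ContinuousLinearMap.coe_restrictScalars'] at hcomm
  rw [map_sub, h.mulOp_weighted n hr, h.mulOp_weighted n ht, ← hcomm]
  rw [intervalIntegral.integral_congr (g := fun s => rhs hγ 0 (f s))
    (fun s hs => h.mulOp_rhs_weighted (n + 3) (hsub hr hs))]
  rw [intervalIntegral.integral_eq_sub_of_hasDerivAt (fun s hs => h.hasDerivAt (hsub hr hs))]
  apply ContinuousOn.intervalIntegrable
  exact (contDiff_rhs hγ 0 (k := 0)).continuous.comp_continuousOn
    (h.continuousOn.mono ((hsub hr).trans Ioo_subset_Icc_self))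

/-- All weighted Fourier transforms are smooth in time. -/
lemma contDiffOn_weighted (h : FourierSolution hγ T f) (k n : ℕ) :
    ContDiffOn ℝ k (fun t => weighted n (f t)) (Ioo 0 T) := by
  induction k generalizing n with
  | zero => exact contDiffOn_zero.2 (h.continuousOn_weighted n)
  | succ k ih =>
    rw [Nat.cast_succ, contDiffOn_succ_iff_deriv_of_isOpen isOpen_Ioo]
    refine ⟨fun t ht => (h.hasDerivAt_weighted n ht).differentiableAt.differentiableWithinAt,
      by simp, ?_⟩
    exact ((contDiff_rhs hγ (n + 3)).comp_contDiffOn (ih (n + 3))).congr fun t ht =>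
      (h.hasDerivAt_weighted n ht).deriv

end FourierSolution

/-! ### Weighted plane waves -/

/-- The plane wave `ξ ↦ exp(2πi x·ξ)`. -/
def wave (x ξ : Plane) : ℂ := Complex.exp (Complex.I * ((2 * Real.pi * inner ℝ ξ x : ℝ) : ℂ))

lemma continuous_wave (x : Plane) : Continuous (wave x) := by
  unfold wave; fun_prop

lemma norm_wave (x ξ : Plane) : ‖wave x ξ‖ = 1 := by
  rw [wave, mul_comm, Complex.norm_exp_ofReal_mul_I]

lemma wave_add (x y ξ : Plane) : wave (x + y) ξ = wave x ξ * wave y ξ := by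
  rw [wave, wave, wave, ← Complex.exp_add, inner_add_right]
  congr 1; push_cast; ring

lemma memLp_wtInv_mul_wave (n : ℕ) (x : Plane) :
    MemLp (fun ξ => wtInv (n + 2) ξ * wave x ξ) 2 volume := by
  refine memLp_wtInv_two.mono ((continuous_wtInv _).mul (continuous_wave x)).aestronglyMeasurable
    (Eventually.of_forall fun ξ => ?_)
  rw [norm_mul, norm_wave, mul_one, norm_wtInv, norm_wtInv]
  have := wt_pos ξ
  exact inv_anti₀ (by positivity) (pow_le_pow_right₀ (one_le_wt ξ) (by omega))

/-- The weighted plane wave as an element of `L²`. -/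
def weightedWave (n : ℕ) (x : Plane) : L2C := (memLp_wtInv_mul_wave n x).toLp _

lemma coeFn_weightedWave (n : ℕ) (x : Plane) :
    weightedWave n x =ᵐ[volume] fun ξ => wtInv (n + 2) ξ * wave x ξ :=
  (memLp_wtInv_mul_wave n x).coeFn_toLp

/-- The symbol `2πi ξ_j / (1+|ξ|)`. -/
def derivSymbol (j : Fin 2) (ξ : Plane) : ℂ :=
  Complex.I * ((2 * Real.pi * ξ j : ℝ) : ℂ) * wtInv 1 ξ

lemma boundedSymbol_derivSymbol (j : Fin 2) : BoundedSymbol (derivSymbol j) := by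
  refine ⟨?_, 2 * Real.pi, fun ξ => ?_⟩
  · have : Continuous (derivSymbol j) := by unfold derivSymbol; fun_prop
    exact this.measurable
  · have hw := wt_pos ξ
    have h1 : |ξ j| ≤ wt ξ := (PiLp.norm_apply_le ξ j).trans (norm_le_wt ξ)
    rw [derivSymbol, norm_mul, norm_mul, Complex.norm_I, one_mul, Complex.norm_real, norm_mul,
      Real.norm_of_nonneg (by positivity : 0 ≤ 2 * Real.pi), norm_wtInv, pow_one,
      Real.norm_eq_abs, mul_assoc]
    refine mul_le_of_le_one_right (by positivity) ?_
    rw [← div_eq_mul_inv]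
    exact div_le_one_of_le₀ h1 hw.le

/-- The coordinate functionals of the plane. -/
def coord (j : Fin 2) : Plane →L[ℝ] ℝ := EuclideanSpace.proj j

/-- The derivative of the weighted plane waves in terms of those with a lower weight. -/
def waveDeriv : L2C →L[ℝ] Plane →L[ℝ] L2C :=
  ∑ j : Fin 2, (ContinuousLinearMap.smulRightL ℝ Plane L2C (coord j)).comp
    ((mulOp _ (boundedSymbol_derivSymbol j)).restrictScalars ℝ)

lemma waveDeriv_apply (g : L2C) (v : Plane) :
    waveDeriv g v = v 0 • mulOp _ (boundedSymbol_derivSymbol 0) g +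
      v 1 • mulOp _ (boundedSymbol_derivSymbol 1) g := by
  simp [waveDeriv, coord, Fin.sum_univ_two]

lemma coeFn_waveDeriv (g : L2C) (v : Plane) : waveDeriv g v =ᵐ[volume]
    fun ξ => Complex.I * ((2 * Real.pi * inner ℝ ξ v : ℝ) : ℂ) * wtInv 1 ξ * g ξ := by
  rw [waveDeriv_apply]
  filter_upwards [Lp.coeFn_add (v 0 • mulOp _ (boundedSymbol_derivSymbol 0) g)
      (v 1 • mulOp _ (boundedSymbol_derivSymbol 1) g),
    Lp.coeFn_smul (v 0) (mulOp _ (boundedSymbol_derivSymbol 0) g),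
    Lp.coeFn_smul (v 1) (mulOp _ (boundedSymbol_derivSymbol 1) g),
    coeFn_mulOp (boundedSymbol_derivSymbol 0) g,
    coeFn_mulOp (boundedSymbol_derivSymbol 1) g] with ξ h1 h2 h3 h4 h5
  rw [h1, Pi.add_apply, h2, h3, Pi.smul_apply, Pi.smul_apply, h4, h5, derivSymbol, derivSymbol,
    Complex.real_smul, Complex.real_smul, PiLp.inner_apply, Fin.sum_univ_two]
  simp only [RCLike.inner_apply, conj_trivial]
  push_cast
  ring

/-- Taylor's bound for |y| ≤ 1 and the trivial linear bound beyond, where |y| ≤ y². A bound for all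
y is needed because frequencies are unbounded. -/
lemma norm_exp_sub_one_sub_le (y : ℝ) :
    ‖Complex.exp (Complex.I * y) - 1 - Complex.I * y‖ ≤ 2 * y ^ 2 := by
  have hn : ‖Complex.I * (y : ℂ)‖ = |y| := by simp
  rcases le_total |y| 1 with h | h
  · have h1 := Complex.norm_exp_sub_one_sub_id_le (x := Complex.I * y) (by rw [hn]; exact h)
    rw [hn, sq_abs] at h1
    nlinarith [sq_nonneg y]
  · have h1 : ‖Complex.exp (Complex.I * y) - 1‖ ≤ |y| := Real.norm_exp_I_mul_ofReal_sub_one_le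
    have h2 := norm_sub_le (Complex.exp (Complex.I * y) - 1) (Complex.I * y)
    rw [hn] at h2
    nlinarith [sq_abs y]

/-- The quadratic remainder costs (1+|ξ|)²|v|². The weight has at least two powers beyond the two
needed for square integrability, so these pay for it, uniformly in x. -/
lemma norm_weightedWave_taylor_le (n : ℕ) (x v : Plane) :
    ‖weightedWave (n + 2) (x + v) - weightedWave (n + 2) x -
      waveDeriv (weightedWave (n + 1) x) v‖ ≤
      2 * (2 * Real.pi) ^ 2 * ‖v‖ ^ 2 * ‖weightedWave 0 0‖ := by
  apply Lp.norm_le_mul_norm_of_ae_le_mul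
  filter_upwards [Lp.coeFn_sub (weightedWave (n + 2) (x + v) - weightedWave (n + 2) x)
      (waveDeriv (weightedWave (n + 1) x) v),
    Lp.coeFn_sub (weightedWave (n + 2) (x + v)) (weightedWave (n + 2) x),
    coeFn_waveDeriv (weightedWave (n + 1) x) v, coeFn_weightedWave (n + 2) (x + v),
    coeFn_weightedWave (n + 2) x, coeFn_weightedWave (n + 1) x, coeFn_weightedWave 0 0]
    with ξ h1 h2 h3 h4 h5 h6 h7
  rw [h1, Pi.sub_apply, h2, Pi.sub_apply, h3, h4, h5, h6, h7, wave_add]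
  have hw := wt_pos ξ
  set y : ℝ := 2 * Real.pi * inner ℝ ξ v with hy
  have e : wtInv (n + 2 + 2) ξ * (wave x ξ * wave v ξ) - wtInv (n + 2 + 2) ξ * wave x ξ -
      Complex.I * (y : ℂ) * wtInv 1 ξ * (wtInv (n + 1 + 2) ξ * wave x ξ) =
      wtInv (n + 2 + 2) ξ * wave x ξ * (Complex.exp (Complex.I * y) - 1 - Complex.I * y) := by
    have h8 : wtInv (n + 2 + 2) ξ = wtInv 1 ξ * wtInv (n + 1 + 2) ξ := by
      rw [← wtInv_add]; congr 1; omega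
    rw [h8, show wave v ξ = Complex.exp (Complex.I * y) from rfl]
    ring
  rw [e, norm_mul, norm_mul, norm_mul, norm_wave, norm_wave, mul_one, mul_one, norm_wtInv,
    norm_wtInv]
  have h9 : |y| ≤ 2 * Real.pi * (wt ξ * ‖v‖) := by
    rw [hy, abs_mul, abs_of_nonneg (by positivity : 0 ≤ 2 * Real.pi)]
    gcongr
    exact (abs_real_inner_le_norm _ _).trans (by gcongr; exact norm_le_wt ξ)
  have h10 : y ^ 2 ≤ (2 * Real.pi * (wt ξ * ‖v‖)) ^ 2 := by
    rw [← sq_abs]; gcongr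
  calc (wt ξ ^ (n + 2 + 2))⁻¹ * ‖Complex.exp (Complex.I * y) - 1 - Complex.I * y‖
      ≤ (wt ξ ^ (2 + 2))⁻¹ * (2 * (2 * Real.pi * (wt ξ * ‖v‖)) ^ 2) := by
        gcongr
        · exact one_le_wt ξ
        · omega
        · exact (norm_exp_sub_one_sub_le y).trans (by gcongr)
    _ = 2 * (2 * Real.pi) ^ 2 * ‖v‖ ^ 2 * (wt ξ ^ (0 + 2))⁻¹ := by
        field_simp
        ring

lemma hasFDerivAt_weightedWave (n : ℕ) (x : Plane) :
    HasFDerivAt (weightedWave (n + 2)) (waveDeriv (weightedWave (n + 1) x)) x := by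
  rw [hasFDerivAt_iff_isLittleO_nhds_zero]
  have h1 : (fun v : Plane => weightedWave (n + 2) (x + v) - weightedWave (n + 2) x -
      waveDeriv (weightedWave (n + 1) x) v) =O[𝓝 0] fun v : Plane => ‖v‖ ^ 2 := by
    refine Asymptotics.IsBigO.of_bound (2 * (2 * Real.pi) ^ 2 * ‖weightedWave 0 0‖)
      (Eventually.of_forall fun v => ?_)
    rw [Real.norm_of_nonneg (by positivity)]
    exact (norm_weightedWave_taylor_le n x v).trans (le_of_eq (by ring))
  exact h1.trans_isLittleO (Asymptotics.isLittleO_norm_pow_id one_lt_two)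

/-- Weighted plane waves depend smoothly on the base point. -/
lemma contDiff_weightedWave (k n : ℕ) : ContDiff ℝ k (weightedWave (n + k + 2)) := by
  induction k generalizing n with
  | zero =>
    -- Continuity is deduced from differentiability, which is why the index carries two more powers
    -- than the k consumed by differentiation.
    exact contDiff_zero.2 (continuous_iff_continuousAt.2 fun x =>
      (hasFDerivAt_weightedWave n x).continuousAt)
  | succ k ih =>
    rw [Nat.cast_succ, contDiff_succ_iff_hasFDerivAt]
    refine ⟨fun x => waveDeriv (weightedWave (n + k + 2) x), waveDeriv.contDiff.comp (ih n),
      fun x => hasFDerivAt_weightedWave (n + k + 1) x⟩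

/-! ### Smoothness of the solution -/

lemma fourierInv_eq_integral_wave (g : Plane → ℂ) (x : Plane) :
    𝓕⁻ g x = ∫ ξ, wave x ξ * g ξ := by
  rw [Real.fourierInv_eq]
  congr 1 with ξ
  rw [Circle.smul_def, Real.fourierChar_apply, smul_eq_mul, wave, mul_comm Complex.I]

namespace FourierSolution

variable {γ : ℝ} {hγ : γ ∈ Ioc (0 : ℝ) 1} {T : ℝ} {f : ℝ → L2C}

/-- Two powers of the weight suffice: f is the product of (1+|ξ|)^{−2} and (1+|ξ|)² f, both in L².
The first appears as the weighted wave at x = 0. -/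
lemma integrable (h : FourierSolution hγ T f) {t : ℝ} (ht : t ∈ Ioo 0 T) :
    Integrable (f t) volume := by
  refine (integrable_mul_L2 (weightedWave 0 0) (weighted 2 (f t))).congr ?_
  filter_upwards [coeFn_weightedWave 0 0, h.coeFn_weighted 2 ht] with ξ h1 h2
  rw [h1, h2, wave]
  simp only [inner_zero_right, mul_zero, Complex.ofReal_zero, Complex.exp_zero]
  linear_combination (f t ξ) * wt_pow_mul_wtInv 2 ξ

/-- Moving weight from one factor to the other separates the variables: the wave carries x, the
weighted transform carries t, and n is free. -/
lemma fourierInv_eq_pairing (h : FourierSolution hγ T f) (n : ℕ) {t : ℝ} (ht : t ∈ Ioo 0 T)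
    (x : Plane) :
    𝓕⁻ (f t : Plane → ℂ) x = pairing (weightedWave n x) (weighted (n + 2) (f t)) := by
  rw [fourierInv_eq_integral_wave, pairing_apply]
  apply integral_congr_ae
  filter_upwards [coeFn_weightedWave n x, h.coeFn_weighted (n + 2) ht] with ξ h1 h2
  rw [h1, h2]
  linear_combination (-(wave x ξ * f t ξ)) * wt_pow_mul_wtInv (n + 2) ξ

/-- For each k, take the weight large enough that the wave is C^k in x; the other factor is C^k in t
for any weight, and the pairing is bounded bilinear. The representation changes with k, the function
does not. -/
lemma contDiffOn_fourierInv (h : FourierSolution hγ T f) :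
    ContDiffOn ℝ ∞ (fun p : ℝ × Plane => 𝓕⁻ (f p.1 : Plane → ℂ) p.2) (Ioo 0 T ×ˢ univ) := by
  refine contDiffOn_infty.2 fun k => ?_
  have hB : ContDiff ℝ k fun q : L2C × L2C => pairing q.1 q.2 := by
    have h1 : ContDiff ℂ k fun q : L2C × L2C => pairing q.1 q.2 :=
      pairing.isBoundedBilinearMap.contDiff
    exact h1.restrict_scalars ℝ
  have h2 : ContDiffOn ℝ k (fun p : ℝ × Plane => weighted (0 + k + 2 + 2) (f p.1))
      (Ioo 0 T ×ˢ univ) :=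
    (h.contDiffOn_weighted k (0 + k + 2 + 2)).comp contDiff_fst.contDiffOn fun p hp => hp.1
  have h3 : ContDiffOn ℝ k (fun p : ℝ × Plane => weightedWave (0 + k + 2) p.2)
      (Ioo 0 T ×ˢ univ) := ((contDiff_weightedWave k 0).comp contDiff_snd).contDiffOn
  exact (hB.comp_contDiffOn (h3.prodMk h2)).congr fun p hp =>
    h.fourierInv_eq_pairing (0 + k + 2) hp.1 p.2

end FourierSolution

lemma IsSolution.exists_smooth {γ : ℝ} (hγ : γ ∈ Ioc (0 : ℝ) 1) {θ₀ : L2} {T : ℝ} {θ : ℝ → L2}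
    (hθ : IsSolution γ θ₀ T θ) :
    ∃ Θ : ℝ × Plane → ℝ, ContDiffOn ℝ ∞ Θ (Ioo 0 T ×ˢ univ) ∧
      ∀ t ∈ Ioo 0 T, (fun x => Θ (t, x)) =ᵐ[volume] θ t := by
  have h := hθ.fourierSolution hγ
  refine ⟨fun p => (𝓕⁻ (fourierL2 (θ p.1) : Plane → ℂ) p.2).re,
    Complex.reCLM.contDiff.comp_contDiffOn h.contDiffOn_fourierInv, fun t ht => ?_⟩
  have h1 := coeFn_fourierInv_of_integrable (fourierL2 (θ t)) (h.integrable ht)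
  have h2 : (𝓕⁻ (fourierL2 (θ t)) : L2C) = toComplex (θ t) := by
    rw [fourierL2, FourierTransform.fourierInv_fourier_eq]
  rw [h2] at h1
  filter_upwards [h1, coeFn_toComplex (θ t)] with x h3 h4
  rw [← h3, h4, Complex.ofReal_re]

end QG

end

theorem theorem2p2 (γ : ℝ) (hγ : γ ∈ Ioc (0 : ℝ) 1)
    (θ₀ : QG.L2) (hθ₀ : QG.sobolevNorm (2 - γ) θ₀ < ⊤)
    (T : ℝ) (hT : 0 < T) (θ : ℝ → QG.L2) (hθ : QG.IsSolution γ θ₀ T θ) :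
    (∀ β : ℝ, 0 ≤ β →
      (⨆ t ∈ Ioo 0 T,
        ENNReal.ofReal (t ^ (β / γ)) * QG.homSobolevNorm (2 - γ + β) (θ t)) < ⊤) ∧
    (∀ β : ℝ, 0 < β →
      Tendsto (fun t : ℝ =>
          ENNReal.ofReal (t ^ (β / γ)) * QG.homSobolevNorm (2 - γ + β) (θ t))
        (𝓝[>] 0) (𝓝 0)) ∧
    ∃ Θ : ℝ × QG.Plane → ℝ,
      ContDiffOn ℝ ∞ Θ (Ioo 0 T ×ˢ univ) ∧
      ∀ t ∈ Ioo 0 T, (fun x => Θ (t, x)) =ᵐ[volume] θ t := by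
  exact ⟨fun β hβ => hθ.iSup_lt_top hγ hT hβ, fun β hβ => hθ.tendsto_zero hγ hT hβ,
    hθ.exists_smooth hγ⟩
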